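/- Let $(M,g)$ be a smooth pseudo-Riemannian manifold of dimension $n\ge 5$ (metric of any signature), with Levi-Civita connection $\nabla$, Riemann tensor $R_{jkl}{}^m$ normalised by $[\nabla_j,\nabla_k]\omega_l=R_{jkl}{}^m\omega_m$, Ricci tensor $R_{kl}=-R_{mkl}{}^m$, scalar curvature $R=g^{ij}R_{ij}$ and Weyl tensor $$C_{jklm}=R_{jklm}+\frac{g_{jm}R_{kl}-g_{km}R_{jl}+R_{jm}g_{kl}-R_{km}g_{jl}}{n-2}-R\,\frac{g_{jm}g_{kl}-g_{km}g_{jl}}{(n-1)(n-2)} .$$ Suppose that $M$ is conformally recurrent, i.e. $\nabla_iC_{jklm}=\alpha_iC_{jklm}$ for a non-zero covector field $\alpha$, and that $C^2=C_{jklm}C^{jklm}$ vanishes nowhere. Put $h_{ij}=C_i{}^{klm}C_{jklm}/C^2$ and $\alpha^2=g^{ij}\alpha_i\alpha_j$. Then there is a scalar function $G$ on $M$ with the following properties at every point where $\alpha^2\neq 0$. The value of $G$ is the one and only number for which Grycak's relation $$R_{ij}-\frac{R}{n}\,g_{ij}=G\left(h_{ij}-\frac1n\,g_{ij}\right)$$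 holds at that point; $G$ is smooth near that point; and $$\nabla_jG=\frac{n(n-2)^2}{(n-1)^2(n-4)}\left[\frac{\alpha_j\alpha_m}{\alpha^2}-\frac{g_{jm}}{n}\right]\nabla^mR .$$ -/

import Mathlib

open scoped Manifold ContDiff

noncomputable section

namespace CRn

/-- The coordinate space `ℝⁿ`. -/
abbrev Coord (n : ℕ) : Type := EuclideanSpace ℝ (Fin n)

/-! ### Tensor calculus in a coordinate domain

A metric in coordinates is a matrix-valued function `γ`, with `γ y i j = g_{ij}(y)`; the inverse
matrix `(γ y)⁻¹ i j` is `g^{ij}(y)`. All index positions follow the names below. -/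

section Coordinates

variable {n : ℕ}

/-- The partial derivative `∂_i f` at `y`. -/
def pd (i : Fin n) (f : Coord n → ℝ) (y : Coord n) : ℝ :=
  fderiv ℝ f y (EuclideanSpace.single i 1)

/-- Christoffel symbols of the Levi-Civita connection: `christoffel γ k i j = Γ^k_{ij}`. -/
def christoffel (γ : Coord n → Matrix (Fin n) (Fin n) ℝ) (k i j : Fin n) (y : Coord n) : ℝ :=
  (1 / 2) * ∑ l, (γ y)⁻¹ k l *
    (pd i (fun z => γ z j l) y + pd j (fun z => γ z i l) y - pd l (fun z => γ z i j) y)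

/-- The Riemann tensor `R_{jkl}{}^m`, with the sign such that
`[∇_j, ∇_k] ω_l = R_{jkl}{}^m ω_m`. -/
def riemannUp (γ : Coord n → Matrix (Fin n) (Fin n) ℝ) (j k l m : Fin n) (y : Coord n) : ℝ :=
  pd k (christoffel γ m j l) y - pd j (christoffel γ m k l) y
    + ∑ p, (christoffel γ p j l y * christoffel γ m k p y
        - christoffel γ p k l y * christoffel γ m j p y)

/-- `R_{jklm} = R_{jkl}{}^p g_{pm}`. -/
def riemann (γ : Coord n → Matrix (Fin n) (Fin n) ℝ) (j k l m : Fin n) (y : Coord n) : ℝ :=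
  ∑ p, riemannUp γ j k l p y * γ y p m

/-- The Ricci tensor `R_{kl} = -R_{mkl}{}^m`. -/
def ricci (γ : Coord n → Matrix (Fin n) (Fin n) ℝ) (k l : Fin n) (y : Coord n) : ℝ :=
  -∑ m, riemannUp γ m k l m y

/-- The scalar curvature `R = g^{ij} R_{ij}`. -/
def scalar (γ : Coord n → Matrix (Fin n) (Fin n) ℝ) (y : Coord n) : ℝ :=
  ∑ i, ∑ j, (γ y)⁻¹ i j * ricci γ i j y

/-- The Weyl conformal curvature tensor `C_{jklm}`. -/
def weyl (γ : Coord n → Matrix (Fin n) (Fin n) ℝ) (j k l m : Fin n) (y : Coord n) : ℝ :=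
  riemann γ j k l m y
    + (γ y j m * ricci γ k l y - γ y k m * ricci γ j l y
        + ricci γ j m y * γ y k l - ricci γ k m y * γ y j l) / ((n : ℝ) - 2)
    - scalar γ y * (γ y j m * γ y k l - γ y k m * γ y j l) / (((n : ℝ) - 1) * ((n : ℝ) - 2))

/-- The covariant derivative `∇_i C_{jklm}` of the Weyl tensor. -/
def covWeyl (γ : Coord n → Matrix (Fin n) (Fin n) ℝ) (i j k l m : Fin n) (y : Coord n) : ℝ :=
  pd i (weyl γ j k l m) y
    - ∑ p, (christoffel γ p i j y * weyl γ p k l m y + christoffel γ p i k y * weyl γ j p l m y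
        + christoffel γ p i l y * weyl γ j k p m y + christoffel γ p i m y * weyl γ j k l p y)

/-- `C_i{}^{klm} C_{jklm}`. -/
def weylContr (γ : Coord n → Matrix (Fin n) (Fin n) ℝ) (i j : Fin n) (y : Coord n) : ℝ :=
  ∑ k, ∑ l, ∑ m, ∑ p, ∑ q, ∑ r,
    (γ y)⁻¹ k p * (γ y)⁻¹ l q * (γ y)⁻¹ m r * weyl γ i p q r y * weyl γ j k l m y

/-- The square of the Weyl tensor, `C² = C_{jklm} C^{jklm}`. -/
def weylSq (γ : Coord n → Matrix (Fin n) (Fin n) ℝ) (y : Coord n) : ℝ :=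
  ∑ i, ∑ j, (γ y)⁻¹ i j * weylContr γ i j y

/-- The tensor `h_{ij} = C_i{}^{klm} C_{jklm} / C²` (meaningful where `C² ≠ 0`). -/
def hTensor (γ : Coord n → Matrix (Fin n) (Fin n) ℝ) (i j : Fin n) (y : Coord n) : ℝ :=
  weylContr γ i j y / weylSq γ y

/-- `a² = g^{ij} a_i a_j` for a covector field `a`. -/
def covecSq (γ : Coord n → Matrix (Fin n) (Fin n) ℝ) (a : Coord n → Fin n → ℝ)
    (y : Coord n) : ℝ :=
  ∑ i, ∑ j, (γ y)⁻¹ i j * a y i * a y j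

/-- The gradient `∇^m f = g^{mk} ∂_k f` of a function. -/
def gradUp (γ : Coord n → Matrix (Fin n) (Fin n) ℝ) (f : Coord n → ℝ) (m : Fin n)
    (y : Coord n) : ℝ :=
  ∑ k, (γ y)⁻¹ m k * pd k f y

end Coordinates

/-! ### Pseudo-Riemannian manifolds -/

section Manifolds

variable {n : ℕ} {M : Type*} [TopologicalSpace M] [ChartedSpace (Coord n) M]

/-- The coordinate vector field `∂/∂x^i` of the chart `φ`, at the point with coordinates `y`. -/
def coordVec (φ : OpenPartialHomeomorph M (Coord n)) (i : Fin n) (y : Coord n) :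
    TangentSpace (𝓡 n) (φ.symm y) :=
  mfderiv (𝓡 n) (𝓡 n) φ.symm y (EuclideanSpace.single i (1 : ℝ) : Coord n)

/-- The components `α_i` of a covector field in the chart `φ`. -/
def covecComp (α : (x : M) → TangentSpace (𝓡 n) x →L[ℝ] ℝ)
    (φ : OpenPartialHomeomorph M (Coord n)) (y : Coord n) (i : Fin n) : ℝ :=
  α (φ.symm y) (coordVec φ i y)

/-- The components `g_{ij}` in the chart `φ` of a field of bilinear forms. -/
def bilinComp (g : (x : M) → TangentSpace (𝓡 n) x →L[ℝ] TangentSpace (𝓡 n) x →L[ℝ] ℝ)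
    (φ : OpenPartialHomeomorph M (Coord n)) (y : Coord n) : Matrix (Fin n) (Fin n) ℝ :=
  Matrix.of fun i j => g (φ.symm y) (coordVec φ i y) (coordVec φ j y)

variable (n M) in
/-- A smooth pseudo-Riemannian metric on an `n`-dimensional smooth manifold: a smooth field of
symmetric nondegenerate bilinear forms on the tangent spaces, of any signature. -/
structure PseudoRiemannianMetric where
  /-- the bilinear form on each tangent space -/
  form : (x : M) → TangentSpace (𝓡 n) x →L[ℝ] TangentSpace (𝓡 n) x →L[ℝ] ℝ
  symm : ∀ x (v w : TangentSpace (𝓡 n) x), form x v w = form x w v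
  nondegenerate : ∀ x (v : TangentSpace (𝓡 n) x), (∀ w, form x v w = 0) → v = 0
  smooth : ∀ φ ∈ IsManifold.maximalAtlas (𝓡 n) ∞ M, ∀ i j : Fin n,
    ContDiffOn ℝ ∞ (fun y => bilinComp form φ y i j) φ.target

/-- `(M, g)` is conformally recurrent, `(CR)_n`, with recurrence vector `α`: `α` is a non-zero
covector field and `∇_i C_{jklm} = α_i C_{jklm}` in all coordinates. -/
def IsConformallyRecurrent (g : PseudoRiemannianMetric n M)
    (α : (x : M) → TangentSpace (𝓡 n) x →L[ℝ] ℝ) : Prop :=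
  (∃ x, α x ≠ 0) ∧
  ∀ φ ∈ IsManifold.maximalAtlas (𝓡 n) ∞ M, ∀ y ∈ φ.target, ∀ i j k l m : Fin n,
    covWeyl (bilinComp g.form φ) i j k l m y
      = covecComp α φ y i * weyl (bilinComp g.form φ) j k l m y

/-- Grycak's relation `R_{ij} - (R/n) g_{ij} = c (h_{ij} - (1/n) g_{ij})` with the value `c` of the
scalar, at the point with coordinates `y`. -/
def GrycakRelation (γ : Coord n → Matrix (Fin n) (Fin n) ℝ) (c : ℝ) (y : Coord n) : Prop :=
  ∀ i j : Fin n,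
    ricci γ i j y - scalar γ y / n * γ y i j = c * (hTensor γ i j y - 1 / n * γ y i j)

end Manifolds

end CRn

end

/-! Write s for α with its index raised, N = α² = α(s), and E(x,u) = C(x,s,u,s) for the electric
part of the Weyl tensor.

Contracting the second Bianchi identity of a recurrent C gives the Cotton tensor as
-C(·,·,·,s)/(n-3) (`cotton_eq`). Substituting this back leaves a purely algebraic relation between C
and α, called `BianchiC`. Where N ≠ 0 it recovers C from E (`magnetic_eq`, `weyl_eq`) and makes s an
eigenvector of h with eigenvalue (n-3)/(2(n-2)) (`contr_sharp`).

Since C² has differential 2αC², the covector α is smooth and h is parallel, hence annihilated by the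
curvature. `BianchiC` is linear in the covector, and its covariant derivative says that every ∇_wα
satisfies it as well (`bianchiC_nabla`). If some ∇_wα is not a multiple of α, its part b orthogonal
to α forces E into a type D form (`typeD`). Then h is a combination of g and of the projection P
onto the plane of α and b. The curvature preserves this plane, so Ric has the same shape
(`ricci_typeD`). Two tensors of this shape have proportional trace-free parts, which is Grycak's
relation; evaluating it on (s,s) gives a formula for G (`grycakScalar`).

If instead ∇α were proportional to α near a point, α⊗α/N would be parallel and the curvature would
kill s; comparing the Cotton tensor with its recurrent form then gives E = 0 and C² = 0
(`not_eventually_parallel`). So Grycak's relation holds on a dense subset of {N ≠ 0}, and on all of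
it by continuity (`grycak`).

For the gradient, h being parallel, the Cotton tensor involves only dG and dR. It is trace-free and
vanishes on (x,s,s), and these two linear conditions determine dG (`fderiv_grycakScalar`). G is
built from tensors only, so the local formulas agree between charts (`grycakScalar_chart`). -/

noncomputable section

namespace CRn

/-! ### Multilinear algebra: contractions with a metric and raising of indices. -/

section Forms

set_option maxSynthPendingDepth 5

variable {n : ℕ}

/-- The standard basis vectors of the coordinate space. -/
abbrev bv (i : Fin n) : Coord n := EuclideanSpace.single i (1 : ℝ)

variable (n) in
/-- Covectors. -/
abbrev Form1 : Type := Coord n →L[ℝ] ℝ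
variable (n) in
/-- Bilinear forms. -/
abbrev Form2 : Type := Coord n →L[ℝ] Form1 n
variable (n) in
/-- Quadrilinear forms. -/
abbrev Form4 : Type := Coord n →L[ℝ] Coord n →L[ℝ] Form2 n

theorem sum_smul_bv (x : Coord n) : ∑ i, x i • bv i = x := by
  ext j
  simp [Pi.single_apply]

theorem isLinearMap_apply_eq_sum {f : Coord n → ℝ} (hf : IsLinearMap ℝ f) (x : Coord n) :
    f x = ∑ i, x i * f (bv i) := by
  conv_lhs => rw [← sum_smul_bv x]
  refine (map_sum (hf.mk' f) (fun i => x i • bv i) Finset.univ).trans ?_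
  exact Finset.sum_congr rfl fun i _ => hf.map_smul _ _

theorem isLinearMap_ext {f g : Coord n → ℝ} (hf : IsLinearMap ℝ f) (hg : IsLinearMap ℝ g)
    (h : ∀ i, f (bv i) = g (bv i)) (x : Coord n) : f x = g x := by
  rw [isLinearMap_apply_eq_sum hf, isLinearMap_apply_eq_sum hg]
  simp [h]

/-- The linear map with given values on the standard basis. -/
def lin {E : Type*} [NormedAddCommGroup E] [NormedSpace ℝ E] (f : Fin n → E) : Coord n →L[ℝ] E :=
  ∑ i, (EuclideanSpace.proj (𝕜 := ℝ) i : Coord n →L[ℝ] ℝ).smulRight (f i)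

theorem lin_apply {E : Type*} [NormedAddCommGroup E] [NormedSpace ℝ E] (f : Fin n → E)
    (x : Coord n) : lin f x = ∑ i, x i • f i := by
  simp [lin]

@[simp] theorem lin_bv {E : Type*} [NormedAddCommGroup E] [NormedSpace ℝ E] (f : Fin n → E)
    (i : Fin n) : lin f (bv i) = f i := by
  rw [lin_apply, Finset.sum_eq_single i] <;> simp +contextual

theorem contDiffOn_lin {E F : Type*} [NormedAddCommGroup E] [NormedSpace ℝ E]
    [NormedAddCommGroup F] [NormedSpace ℝ F] {U : Set F} {f : Fin n → F → E}
    (hf : ∀ i, ContDiffOn ℝ ∞ (f i) U) :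
    ContDiffOn ℝ ∞ (fun z => lin fun i => f i z) U := by
  unfold CRn.lin
  refine ContDiffOn.sum fun i _ => ?_
  exact (ContinuousLinearMap.smulRightL ℝ (Coord n) E
    (EuclideanSpace.proj (𝕜 := ℝ) i)).contDiff.comp_contDiffOn (hf i)

/-- The contraction of a bilinear function with a contravariant 2-tensor. -/
def tr (G : Matrix (Fin n) (Fin n) ℝ) (B : Coord n → Coord n → ℝ) : ℝ :=
  ∑ i, ∑ j, G i j * B (bv i) (bv j)

/-- The vector obtained by raising the index of a covector. -/
def sharp (G : Matrix (Fin n) (Fin n) ℝ) (a : Form1 n) : Coord n :=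
  ∑ i, ∑ j, (G i j * a (bv j)) • bv i

variable {G : Matrix (Fin n) (Fin n) ℝ}

theorem tr_add (B B' : Coord n → Coord n → ℝ) :
    tr G (fun u v => B u v + B' u v) = tr G B + tr G B' := by
  simp [tr, mul_add, Finset.sum_add_distrib]

theorem tr_sub (B B' : Coord n → Coord n → ℝ) :
    tr G (fun u v => B u v - B' u v) = tr G B - tr G B' := by
  simp [tr, mul_sub, Finset.sum_sub_distrib]

theorem tr_neg (B : Coord n → Coord n → ℝ) :
    tr G (fun u v => -B u v) = -tr G B := by
  simp [tr]

theorem tr_mul_left (c : ℝ) (B : Coord n → Coord n → ℝ) :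
    tr G (fun u v => c * B u v) = c * tr G B := by
  simp only [tr, Finset.mul_sum]
  exact Finset.sum_congr rfl fun i _ => Finset.sum_congr rfl fun j _ => by ring

theorem tr_mul_right (c : ℝ) (B : Coord n → Coord n → ℝ) :
    tr G (fun u v => B u v * c) = tr G B * c := by
  simp only [tr, Finset.sum_mul]
  exact Finset.sum_congr rfl fun i _ => Finset.sum_congr rfl fun j _ => by ring

theorem tr_div (c : ℝ) (B : Coord n → Coord n → ℝ) :
    tr G (fun u v => B u v / c) = tr G B / c := by
  simp only [div_eq_mul_inv, tr_mul_right]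

theorem tr_zero : tr G (fun _ _ => 0) = 0 := by simp [tr]

theorem tr_tr_comm {G' : Matrix (Fin n) (Fin n) ℝ} (B : Coord n → Coord n → Coord n → Coord n → ℝ) :
    tr G (fun u v => tr G' fun p q => B u v p q)
      = tr G' (fun p q => tr G fun u v => B u v p q) := by
  simp only [tr, Finset.mul_sum]
  have h : ∀ i j, ∑ k, ∑ l, G i j * (G' k l * B (bv i) (bv j) (bv k) (bv l))
      = ∑ kl : Fin n × Fin n, G i j * (G' kl.1 kl.2 * B (bv i) (bv j) (bv kl.1) (bv kl.2)) := by
    intro i j; rw [Fintype.sum_prod_type]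
  have h' : ∀ k l, ∑ i, ∑ j, G' k l * (G i j * B (bv i) (bv j) (bv k) (bv l))
      = ∑ ij : Fin n × Fin n, G' k l * (G ij.1 ij.2 * B (bv ij.1) (bv ij.2) (bv k) (bv l)) := by
    intro i j; rw [Fintype.sum_prod_type]
  simp only [h, h']
  rw [← Fintype.sum_prod_type (f := fun ij : Fin n × Fin n => ∑ kl : Fin n × Fin n,
    G ij.1 ij.2 * (G' kl.1 kl.2 * B (bv ij.1) (bv ij.2) (bv kl.1) (bv kl.2))),
    ← Fintype.sum_prod_type (f := fun kl : Fin n × Fin n => ∑ ij : Fin n × Fin n,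
    G' kl.1 kl.2 * (G ij.1 ij.2 * B (bv ij.1) (bv ij.2) (bv kl.1) (bv kl.2))), Finset.sum_comm]
  exact Finset.sum_congr rfl fun i _ => Finset.sum_congr rfl fun j _ => by ring

/-- `g` is a symmetric bilinear form whose matrix has the inverse `G`. -/
structure IsMetricAt (g : Form2 n) (G : Matrix (Fin n) (Fin n) ℝ) : Prop where
  symm : ∀ x y, g x y = g y x
  inv_symm : ∀ i j, G i j = G j i
  inv : ∀ i k, ∑ j, G i j * g (bv j) (bv k) = if i = k then 1 else 0

namespace IsMetricAt

variable {g : Form2 n} (h : IsMetricAt g G)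
include h

theorem tr_comm (B : Coord n → Coord n → ℝ) : tr G (fun u v => B v u) = tr G B := by
  simp only [tr]
  rw [Finset.sum_comm]
  exact Finset.sum_congr rfl fun i _ => Finset.sum_congr rfl fun j _ => by rw [h.inv_symm]

/-- Raising an index undoes lowering it. This and its variants remove every metric factor from a
contraction; only linearity in the contracted slot is needed. -/
theorem tr_metric_right (x : Coord n) {f : Coord n → ℝ} (hf : IsLinearMap ℝ f) :
    tr G (fun u v => f u * g v x) = f x := by
  have h1 : ∀ i, ∑ j, G i j * g (bv j) x = x i := by
    intro i
    have : ∀ j, g (bv j) x = ∑ k, x k * g (bv j) (bv k) := fun j =>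
      isLinearMap_apply_eq_sum ⟨fun _ _ => map_add _ _ _, fun _ _ => map_smul _ _ _⟩ x
    simp only [this, Finset.mul_sum]
    rw [Finset.sum_comm]
    have : ∀ k, ∑ j, G i j * (x k * g (bv j) (bv k)) = x k * if i = k then 1 else 0 := by
      intro k
      rw [← h.inv i k, Finset.mul_sum]
      exact Finset.sum_congr rfl fun j _ => by ring
    simp [this]
  rw [isLinearMap_apply_eq_sum hf x]
  refine Finset.sum_congr rfl fun i _ => ?_
  rw [← h1 i, Finset.sum_mul]
  exact Finset.sum_congr rfl fun j _ => by ring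

theorem tr_metric_right' (x : Coord n) {f : Coord n → ℝ} (hf : IsLinearMap ℝ f) :
    tr G (fun u v => f u * g x v) = f x := by
  simp only [h.symm x]; exact h.tr_metric_right x hf

theorem tr_metric_left (x : Coord n) {f : Coord n → ℝ} (hf : IsLinearMap ℝ f) :
    tr G (fun u v => f v * g u x) = f x := by
  rw [← h.tr_metric_right x hf]; exact h.tr_comm _

theorem tr_metric_left' (x : Coord n) {f : Coord n → ℝ} (hf : IsLinearMap ℝ f) :
    tr G (fun u v => f v * g x u) = f x := by
  simp only [h.symm x]; exact h.tr_metric_left x hf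

theorem tr_metric : tr G (fun u v => g u v) = n := by
  have : ∀ i : Fin n, ∑ j, G i j * g (bv i) (bv j) = 1 := by
    intro i
    simp only [h.symm (bv i)]
    simpa using h.inv i i
  simp only [tr, this]
  simp

theorem apply_sharp (a : Form1 n) (x : Coord n) : g (sharp G a) x = a x := by
  rw [← h.tr_metric_left x (f := a) ⟨fun _ _ => map_add _ _ _, fun _ _ => map_smul _ _ _⟩]
  simp [sharp, tr, map_sum, mul_assoc]

theorem apply_sharp' (a : Form1 n) (x : Coord n) : g x (sharp G a) = a x := by
  rw [h.symm, h.apply_sharp]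

theorem tr_covec_left (a : Form1 n) {f : Coord n → ℝ} (hf : IsLinearMap ℝ f) :
    tr G (fun u v => f v * a u) = f (sharp G a) := by
  simp only [← h.apply_sharp' a]; exact h.tr_metric_left _ hf

theorem tr_covec_right (a : Form1 n) {f : Coord n → ℝ} (hf : IsLinearMap ℝ f) :
    tr G (fun u v => f u * a v) = f (sharp G a) := by
  simp only [← h.apply_sharp' a]; exact h.tr_metric_right _ hf

/-- Every linear functional of `x` can be written as a contraction with `g x`, so the inverse matrix
supplies nondegeneracy. -/
theorem eq_of_forall {x x' : Coord n} (hx : ∀ v, g x v = g x' v) : x = x' := by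
  have : ∀ f : Form1 n, f x = f x' := fun f => by
    have hf : IsLinearMap ℝ f := ⟨fun _ _ => map_add _ _ _, fun _ _ => map_smul _ _ _⟩
    rw [← h.tr_metric_left' x hf, ← h.tr_metric_left' x' hf]
    simp only [hx]
  ext i
  exact this (EuclideanSpace.proj i)

theorem sharp_comm (a b : Form1 n) : a (sharp G b) = b (sharp G a) := by
  rw [← h.apply_sharp a, h.symm, h.apply_sharp]

end IsMetricAt

theorem sharp_smul (c : ℝ) (a : Form1 n) : sharp G (c • a) = c • sharp G a := by
  simp [sharp, Finset.smul_sum, smul_smul, mul_left_comm]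

theorem sharp_sub (a b : Form1 n) : sharp G (a - b) = sharp G a - sharp G b := by
  simp [sharp, mul_sub, sub_smul, Finset.sum_sub_distrib]

end Forms

/-! ### Pointwise algebra of the Bianchi identity for a recurrent Weyl tensor. -/

section WeylAlgebra

set_option maxSynthPendingDepth 5

variable {n : ℕ} {g : Form2 n} {G : Matrix (Fin n) (Fin n) ℝ} {C : Form4 n}

/-- The algebraic properties of a Weyl tensor `C` for the metric `g`. -/
structure IsWeylAt (g : Form2 n) (G : Matrix (Fin n) (Fin n) ℝ) (C : Form4 n) : Prop
    extends IsMetricAt g G where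
  skew₁₂ : ∀ x y u v, C x y u v = -C y x u v
  skew₃₄ : ∀ x y u v, C x y u v = -C x y v u
  pair : ∀ x y u v, C x y u v = C u v x y
  traceless : ∀ x y, tr G (fun u v => C u x y v) = 0

namespace IsWeylAt

variable (h : IsWeylAt g G C)
include h

theorem traceless₁₃ (x y : Coord n) : tr G (fun u v => C u x v y) = 0 := by
  simp only [h.skew₃₄ _ x _ y, tr_neg, h.traceless, neg_zero]

theorem traceless₂₃ (x y : Coord n) : tr G (fun u v => C x u v y) = 0 := by
  simp only [h.skew₁₂ x, tr_neg, h.traceless₁₃, neg_zero]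

theorem traceless₂₄ (x y : Coord n) : tr G (fun u v => C x u y v) = 0 := by
  simp only [h.skew₁₂ x, tr_neg, h.traceless, neg_zero]

/-- If the recurrence `∇C = a ⊗ C` is compatible with the second Bianchi identity with Cotton
tensor `Y`, then `Y` is trace-free and is determined by `a` and `C`. -/
theorem cotton_eq (hn : 5 ≤ n) {a : Form1 n} {Y : Coord n → Coord n → Coord n → ℝ}
    (hY₁ : ∀ y u, IsLinearMap ℝ fun x => Y x y u) (hY₃ : ∀ x y, IsLinearMap ℝ fun u => Y x y u)
    (hY : ∀ x y u, Y x y u = -Y y x u)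
    (hB : ∀ x y z u v, a x * C y z u v + a y * C z x u v + a z * C x y u v
      = (g z u * Y x y v - g z v * Y x y u) + (g x u * Y y z v - g x v * Y y z u)
        + (g y u * Y z x v - g y v * Y z x u)) :
    (∀ x, tr G (fun y u => Y x y u) = 0) ∧
      ∀ x y u, ((n : ℝ) - 3) * Y x y u = -C x y u (sharp G a) := by
  have hn' : (5 : ℝ) ≤ n := by exact_mod_cast hn
  have hY₂ : ∀ x u, IsLinearMap ℝ fun y => Y x y u := fun x u => by
    simp only [hY x]
    exact (-((hY₁ x u).mk')).isLinear
  have key : ∀ x y u, C x y u (sharp G a) = (3 - (n : ℝ)) * Y x y u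
      + g x u * tr G (fun p q => Y y p q) - g y u * tr G (fun p q => Y x p q) := by
    intro x y u
    -- Contract the third and fifth slots. As `C` is trace-free, only the term `a z * C x y u v`
    -- survives on the left.
    have e := congrArg (tr G) (funext fun p => funext fun q => hB x y p u q)
    simp only [tr_add, tr_sub, tr_mul_left, tr_mul_right, h.traceless₂₄, h.traceless,
      h.tr_metric] at e
    have e1 : tr G (fun p q => a p * C x y u q) = C x y u (sharp G a) := by
      simp only [mul_comm (a _)]
      exact h.tr_covec_left a ⟨fun _ _ => map_add _ _ _, fun _ _ => map_smul _ _ _⟩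
    have e2 : tr G (fun p q => g p u * Y x y q) = Y x y u := by
      simp only [mul_comm (g _ _)]
      exact h.tr_metric_left u (hY₃ x y)
    have e3 : tr G (fun p q => g x q * Y y p u) = Y y x u := by
      simp only [mul_comm (g _ _)]
      exact h.tr_metric_right' x (hY₂ y u)
    have e4 : tr G (fun p q => g y q * Y p x u) = Y y x u := by
      simp only [mul_comm (g _ _)]
      exact h.tr_metric_right' y (hY₁ x u)
    have e5 : tr G (fun p q => Y p x q) = -tr G (fun p q => Y x p q) := by
      rw [← tr_neg]; congr 1; funext p q; exact hY _ _ _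
    rw [e1, e2, e3, e4, e5] at e
    linear_combination e - 2 * hY x y u
  have ht : ∀ x, tr G (fun y u => Y x y u) = 0 := by
    intro x
    -- A second contraction kills the left side, leaving `2n - 4` times the trace of `Y`.
    have e := congrArg (tr G) (funext fun p => funext fun q => key x p q)
    simp only [tr_add, tr_sub, tr_mul_left, tr_mul_right, h.traceless₂₃, h.tr_metric] at e
    have e1 : tr G (fun p q => g x q * tr G (fun p' q' => Y p p' q'))
        = tr G (fun p' q' => Y x p' q') := by
      simp only [mul_comm (g _ _)]
      refine h.tr_metric_right' x (f := fun p => tr G (fun p' q' => Y p p' q')) ⟨?_, ?_⟩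
      · intro p p'
        simp only [(hY₁ _ _).map_add, tr_add]
      · intro c p
        simp only [(hY₁ _ _).map_smul, smul_eq_mul, tr_mul_left]
    rw [e1] at e
    have : (2 * (n : ℝ) - 4) * tr G (fun y u => Y x y u) = 0 := by
      have h0 : tr G (Y x) = tr G (fun y u => Y x y u) := rfl
      linear_combination e + (3 - (n : ℝ)) * h0
    rcases mul_eq_zero.1 this with h0 | h0
    · linarith
    · exact h0
  refine ⟨ht, fun x y u => ?_⟩
  have := key x y u
  rw [ht, ht] at this
  linear_combination this

end IsWeylAt

/-- The algebraic identity satisfied by a recurrent Weyl tensor `C` with recurrence covector `a`,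
as a consequence of the second Bianchi identity. -/
def BianchiC (g : Form2 n) (G : Matrix (Fin n) (Fin n) ℝ) (C : Form4 n) (a : Form1 n) : Prop :=
  ∀ x y z u v, ((n : ℝ) - 3) * (a x * C y z u v + a y * C z x u v + a z * C x y u v)
    = (g z v * C x y u (sharp G a) - g z u * C x y v (sharp G a))
      + (g x v * C y z u (sharp G a) - g x u * C y z v (sharp G a))
      + (g y v * C z x u (sharp G a) - g y u * C z x v (sharp G a))

/-- The identity is linear in the covector. This allows ∇_wα to be replaced by its component
orthogonal to α. -/
theorem BianchiC.sub_smul {a b : Form1 n} (ha : BianchiC g G C a) (hb : BianchiC g G C b) (c : ℝ) :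
    BianchiC g G C (b - c • a) := by
  intro x y z u v
  have h1 := ha x y z u v
  have h2 := hb x y z u v
  simp only [sharp_sub, sharp_smul, map_sub, map_smul, sub_apply,
    smul_apply, smul_eq_mul] at h1 h2 ⊢
  linear_combination h2 - c * h1

/-- The electric part of `C` relative to the vector `s`. -/
def elec (C : Form4 n) (s x u : Coord n) : ℝ := C x s u s

namespace IsWeylAt

variable (h : IsWeylAt g G C) {a : Form1 n} (ha : BianchiC g G C a)

include h

theorem elec_symm (s x u : Coord n) : elec C s x u = elec C s u x := h.pair _ _ _ _

theorem apply_self₁₂ (s u v : Coord n) : C s s u v = 0 := by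
  have := h.skew₁₂ s s u v; linarith

theorem apply_self₃₄ (s u v : Coord n) : C u v s s = 0 := by
  have := h.skew₃₄ u v s s; linarith

include ha

/-- A recurrent Weyl tensor is purely electric relative to its recurrence covector. -/
theorem magnetic_eq (hn : 5 ≤ n) (hN : a (sharp G a) ≠ 0) (x y u : Coord n) :
    C x y u (sharp G a) = (a y * elec C (sharp G a) x u - a x * elec C (sharp G a) y u)
      / a (sharp G a) := by
  have hn' : (5 : ℝ) ≤ n := by exact_mod_cast hn
  -- With both slots set to `sharp G a` each metric factor becomes a value of `a`. One copy of the
  -- unknown comes back from the right, so its coefficient is `n - 4` and dimension four is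
  -- excluded.
  have e := ha x y (sharp G a) u (sharp G a)
  simp only [h.apply_sharp', h.apply_sharp, h.apply_self₃₄] at e
  rw [h.skew₁₂ (sharp G a) x] at e
  rw [eq_div_iff hN]
  have : ((n : ℝ) - 4) * (C x y u (sharp G a) * a (sharp G a)
    - (a y * elec C (sharp G a) x u - a x * elec C (sharp G a) y u)) = 0 := by
    simp only [elec]
    linear_combination e
  rcases mul_eq_zero.1 this with h0 | h0
  · linarith
  · linarith

/-- A recurrent Weyl tensor in terms of its electric part. -/
theorem weyl_eq (hn : 5 ≤ n) (hN : a (sharp G a) ≠ 0) (x y u v : Coord n) :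
    C x y u v = ((g x v * elec C (sharp G a) y u - g x u * elec C (sharp G a) y v
      - g y v * elec C (sharp G a) x u + g y u * elec C (sharp G a) x v)
      - ((n : ℝ) - 2) * (a x * a v * elec C (sharp G a) y u - a x * a u * elec C (sharp G a) y v
      - a y * a v * elec C (sharp G a) x u + a y * a u * elec C (sharp G a) x v) / a (sharp G a))
      / (a (sharp G a) * ((n : ℝ) - 3)) := by
  have hn' : (5 : ℝ) ≤ n := by exact_mod_cast hn
  have hn3 : (n : ℝ) - 3 ≠ 0 := by linarith
  -- Now `C x y u v` is multiplied by `a (sharp G a)`, and every other Weyl term has a slot equal to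
  -- `sharp G a`, hence reduces to the electric part.
  have e := ha x y (sharp G a) u v
  have e1 : C y (sharp G a) u v = C u v y (sharp G a) := h.pair _ _ _ _
  have e2 : C (sharp G a) x u v = -C u v x (sharp G a) := by rw [h.skew₁₂, h.pair]
  have e3 : ∀ w, C (sharp G a) x w (sharp G a) = -elec C (sharp G a) x w := fun w => h.skew₁₂ _ _ _ _
  simp only [h.apply_sharp, e1, e2, e3] at e
  rw [h.magnetic_eq ha hn hN x y u, h.magnetic_eq ha hn hN x y v, h.magnetic_eq ha hn hN u v y,
    h.magnetic_eq ha hn hN u v x, h.elec_symm _ u, h.elec_symm _ u, h.elec_symm _ v,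
    h.elec_symm _ v] at e
  rw [eq_div_iff (mul_ne_zero hN hn3)]
  simp only [elec] at e ⊢
  field_simp at e ⊢
  linear_combination e

end IsWeylAt

end WeylAlgebra

/-! ### The triple contraction of C, which is C² times h. -/

section WeylContraction

set_option maxSynthPendingDepth 5

variable {n : ℕ} {g : Form2 n} {G : Matrix (Fin n) (Fin n) ℝ} {C : Form4 n}

/-- The triple contraction of `C` with itself. -/
def contr (G : Matrix (Fin n) (Fin n) ℝ) (C : Form4 n) (x y : Coord n) : ℝ :=
  tr G fun k p => tr G fun l q => tr G fun m r => C x p q r * C y k l m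

theorem isLinearMap_tr {B : Coord n → Coord n → Coord n → ℝ}
    (hB : ∀ u v, IsLinearMap ℝ fun x => B x u v) : IsLinearMap ℝ fun x => tr G (B x) := by
  constructor
  · intro x y
    rw [← tr_add]; congr 1; funext u v; exact (hB u v).map_add x y
  · intro c x
    rw [smul_eq_mul, ← tr_mul_left]; congr 1; funext u v; exact (hB u v).map_smul c x

namespace IsWeylAt

variable (h : IsWeylAt g G C) {a b : Form1 n} (ha : BianchiC g G C a)

include h

theorem apply_sharp_self_elec (s x : Coord n) : elec C s x s = 0 := h.apply_self₃₄ _ _ _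

theorem apply_sharp_self_elec' (s x : Coord n) : elec C s s x = 0 := h.apply_self₁₂ _ _ _

include ha

/-- Only the second factor is expanded by `weyl_eq`. The metric terms that contract two slots of the
remaining `C` vanish, and the others pair up by skewness, whence the factors 2. -/
theorem contr_eq (hn : 5 ≤ n) (hN : a (sharp G a) ≠ 0) (x y : Coord n) :
    contr G C x y = (2 * tr G (fun k p => tr G fun l q => C x p q y * elec C (sharp G a) k l)
      - 2 * ((n : ℝ) - 2) / a (sharp G a)
        * (a y * tr G (fun k p => tr G fun l q => C x p q (sharp G a) * elec C (sharp G a) k l)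
          - tr G (fun l q => elec C (sharp G a) x q * elec C (sharp G a) y l)))
      / (a (sharp G a) * ((n : ℝ) - 3)) := by
  set s := sharp G a with hs
  have split : ∀ p q r k l m, C x p q r * C y k l m =
      ((((C x p q r * g y m) * elec C s k l - C x p q r * g y l * elec C s k m)
        - (C x p q r * g k m * elec C s y l - C x p q r * g k l * elec C s y m))
      - ((n : ℝ) - 2) / a s * (a y * (((C x p q r * a m) * elec C s k l
          - (C x p q r * a l) * elec C s k m))
        - ((C x p q r * a m) * a k * elec C s y l - (C x p q r * a l) * elec C s y m * a k)))
      / (a s * ((n : ℝ) - 3)) := by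
    intro p q r k l m
    rw [h.weyl_eq ha hn hN y k l m, ← hs]
    ring
  have l4 : ∀ x y z, IsLinearMap ℝ fun w => C x y z w := fun x y z =>
    ⟨fun _ _ => map_add _ _ _, fun _ _ => map_smul _ _ _⟩
  have l3 : ∀ x y z, IsLinearMap ℝ fun w => C x y w z := fun x y z =>
    ⟨fun _ _ => by simp, fun _ _ => by simp⟩
  have l2 : ∀ x y z, IsLinearMap ℝ fun w => C x w y z := fun x y z =>
    ⟨fun _ _ => by simp, fun _ _ => by simp⟩
  have t1 : ∀ p q, tr G (fun m r => C x p q r * g y m) = C x p q y := fun p q =>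
    h.tr_metric_left' y (l4 x p q)
  have t2 : ∀ p k, tr G (fun l q => tr G fun m r => C x p q r * g y l * elec C s k m)
      = -tr G (fun l q => C x p q y * elec C s k l) := by
    intro p k
    rw [tr_tr_comm, ← tr_neg]
    congr 1; funext m r
    rw [tr_mul_right, h.tr_metric_left' y (l3 x p r), h.skew₃₄]
    ring
  have t3 : tr G (fun k p => tr G fun l q => tr G fun m r => C x p q r * g k m * elec C s y l)
      = 0 := by
    rw [tr_tr_comm, ← tr_zero (G := G)]
    congr 1; funext l q
    simp only [tr_mul_right, h.tr_metric_left' _ (l4 x _ q)]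
    rw [h.tr_comm (fun p k => C x p q k), h.traceless₂₄, zero_mul]
  have t4 : tr G (fun k p => tr G fun l q => tr G fun m r => C x p q r * g k l * elec C s y m)
      = 0 := by
    have : ∀ k p, tr G (fun l q => tr G fun m r => C x p q r * g k l * elec C s y m)
        = tr G (fun m r => C x p k r * elec C s y m) := by
      intro k p
      rw [tr_tr_comm]
      congr 1; funext m r
      rw [tr_mul_right, h.tr_metric_left' k (l3 x p r)]
    simp only [this]
    rw [tr_tr_comm, ← tr_zero (G := G)]
    congr 1; funext m r
    rw [tr_mul_right, h.tr_comm (fun p k => C x p k r), h.traceless₂₃, zero_mul]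
  have t5 : ∀ p q, tr G (fun m r => C x p q r * a m) = C x p q s := fun p q =>
    h.tr_covec_left a (l4 x p q)
  have t6 : ∀ p (f : Coord n → ℝ), tr G (fun l q => tr G fun m r => C x p q r * a l * f m)
      = -tr G (fun l q => C x p q s * f l) := by
    intro p f
    rw [tr_tr_comm, ← tr_neg]
    congr 1; funext m r
    rw [tr_mul_right, h.tr_covec_left a (l3 x p r), h.skew₃₄]
    ring
  have t7 : tr G (fun k p => tr G fun l q => C x p q s * a k * elec C s y l)
      = tr G (fun l q => elec C s x q * elec C s y l) := by
    rw [tr_tr_comm]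
    congr 1; funext l q
    rw [tr_mul_right, h.tr_covec_left a (l2 x q s)]
    rfl
  have t8 : tr G (fun k p => -tr G (fun l q => C x p q s * elec C s y l) * a k)
      = -tr G (fun l q => elec C s x q * elec C s y l) := by
    rw [← t7, ← tr_neg]
    congr 1; funext k p
    rw [neg_mul, ← tr_mul_right]
    congr 2; funext l q; ring
  conv_lhs => simp only [contr, split, tr_div, tr_sub, tr_mul_left]
  have t6' : ∀ p k, tr G (fun l q => tr G (fun m r => C x p q r * a l * elec C s k m))
      = -tr G (fun l q => C x p q s * elec C s k l) := fun p k => t6 p _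
  have t8' : ∀ k p, tr G (fun l q => tr G fun m r => C x p q r * a l * elec C s y m * a k)
      = -tr G (fun l q => C x p q s * elec C s y l) * a k := by
    intro k p
    simp only [tr_mul_right]
    rw [t6']
  have t7' : ∀ k p, tr G (fun l q => tr G fun m r => C x p q r * a m * a k * elec C s y l)
      = tr G (fun l q => C x p q s * a k * elec C s y l) := by
    intro k p
    simp only [tr_mul_right, t5]
  have t1' : ∀ k p, tr G (fun l q => tr G fun m r => C x p q r * g y m * elec C s k l)
      = tr G (fun l q => C x p q y * elec C s k l) := by
    intro k p
    simp only [tr_mul_right, t1]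
  have t5' : ∀ k p, tr G (fun l q => tr G fun m r => C x p q r * a m * elec C s k l)
      = tr G (fun l q => C x p q s * elec C s k l) := by
    intro k p
    simp only [tr_mul_right, t5]
  simp only [t1', t2, t3, t4, t5', t6', t7', t8', t7, t8, tr_neg]
  ring

/-- The double contraction of the electric part with itself, and the eigenvector equation of `a`
for the triple contraction of `C`. -/
theorem contr_sharp (hn : 5 ≤ n) (hN : a (sharp G a) ≠ 0) (x : Coord n) :
    2 * ((n : ℝ) - 2) * contr G C x (sharp G a)
      = ((n : ℝ) - 3) * tr G (contr G C) * a x ∧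
    tr G (contr G C) = 4 * ((n : ℝ) - 2) / (a (sharp G a) ^ 2 * ((n : ℝ) - 3))
      * tr G (fun k p => tr G fun l q =>
        elec C (sharp G a) p q * elec C (sharp G a) k l) := by
  have hn' : (5 : ℝ) ≤ n := by exact_mod_cast hn
  have hn3 : (n : ℝ) - 3 ≠ 0 := by linarith
  obtain ⟨s, hs⟩ : ∃ s, sharp G a = s := ⟨_, rfl⟩
  have hNs : a s ≠ 0 := hs ▸ hN
  have mag := h.magnetic_eq ha hn hN
  have ceq := h.contr_eq ha hn hN
  simp only [hs] at mag ceq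
  rw [hs]
  set W := tr G (fun k p => tr G fun l q => elec C s p q * elec C s k l) with hW
  have lE : ∀ x, IsLinearMap ℝ fun w => elec C s w x := fun x =>
    ⟨fun _ _ => by simp [elec], fun _ _ => by simp [elec]⟩
  -- By `magnetic_eq` this becomes a contraction of two electric parts; one of the two terms
  -- vanishes since `E` annihilates `s`.
  have H : ∀ x, tr G (fun k p => tr G fun l q => C x p q s * elec C s k l) = -a x * W / a s := by
    intro x
    have split : ∀ p q k l, C x p q s * elec C s k l
        = (a p * (elec C s x q * elec C s k l)
            - a x * (elec C s p q * elec C s k l)) / a s := by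
      intro p q k l
      rw [mag x p q]
      ring
    simp only [split, tr_div, tr_sub, tr_mul_left]
    rw [← hW]
    have : tr G (fun k p => a p * tr G fun l q => elec C s x q * elec C s k l) = 0 := by
      simp only [mul_comm (a _)]
      rw [h.tr_covec_right a (isLinearMap_tr fun u v => ?_)]
      · simp only [hs, h.apply_sharp_self_elec', mul_zero, tr_zero]
      · exact ⟨fun _ _ => by simp [elec]; ring, fun _ _ => by simp [elec]; ring⟩
    rw [this]
    ring
  have J0 : ∀ x, tr G (fun l q => elec C s x q * elec C s s l) = 0 := by
    intro x
    simp only [h.apply_sharp_self_elec', mul_zero, tr_zero]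
  have hC2 : tr G (contr G C) = 4 * ((n : ℝ) - 2) / (a s ^ 2 * ((n : ℝ) - 3)) * W := by
    have e : contr G C = fun x y => _ :=
      funext fun x => funext fun y => ceq x y
    rw [e]
    simp only [H, tr_div, tr_sub, tr_mul_left]
    -- The free slots `x`, `y` are the first and last of `C`, whose trace is zero.
    have F0 : tr G (fun x y => tr G fun k p => tr G fun l q => C x p q y * elec C s k l) = 0 := by
      rw [tr_tr_comm, ← tr_zero (G := G)]
      congr 1; funext k p
      rw [tr_tr_comm, ← tr_zero (G := G)]
      congr 1; funext l q
      rw [tr_mul_right, h.traceless, zero_mul]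
    have A : tr G (fun x y => a y * (-a x * W / a s)) = -W := by
      have : (fun x y => a y * (-a x * W / a s)) = fun x y => a y * a x * (-W / a s) := by
        funext x y; ring
      rw [this, tr_mul_right, h.tr_covec_left a ⟨fun _ _ => map_add _ _ _, fun _ _ => map_smul _ _ _⟩]
      rw [hs]; field_simp
    have J : tr G (fun x y => tr G fun l q => elec C s x q * elec C s y l) = W := by
      rw [hW, ← h.tr_comm]
    rw [F0, A, J]
    field_simp
    ring
  refine ⟨?_, hC2⟩
  rw [hC2, ceq x s, J0, H]
  field_simp
  ring

end IsWeylAt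

end WeylContraction

/-! ### A second covector satisfying the Bianchi relation forces type D. -/

section TypeD

set_option maxSynthPendingDepth 5

variable {n : ℕ} {g : Form2 n} {G : Matrix (Fin n) (Fin n) ℝ} {C : Form4 n}

namespace IsWeylAt

variable (h : IsWeylAt g G C) {a b : Form1 n} (ha : BianchiC g G C a) (hb : BianchiC g G C b)

include h ha hb

/-- The relation for `b` is evaluated with two slots equal to `sharp G a`. Terms containing `sharp G
b` are rewritten through `weyl_eq` and `magnetic_eq`, so that everything is expressed by the
electric part; a factor `n - 4` cancels. -/
theorem elec_wedge (hn : 5 ≤ n) (hN : a (sharp G a) ≠ 0) (hab : a (sharp G b) = 0)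
    (x y u : Coord n) :
    ((n : ℝ) - 2) * (b x * elec C (sharp G a) y u - b y * elec C (sharp G a) x u)
      = -((g y u - a y * a u / a (sharp G a)) * elec C (sharp G a) (sharp G b) x
        - (g x u - a x * a u / a (sharp G a)) * elec C (sharp G a) (sharp G b) y) := by
  have hn' : (5 : ℝ) ≤ n := by exact_mod_cast hn
  have hn3 : (n : ℝ) - 3 ≠ 0 := by linarith
  have hba : b (sharp G a) = 0 := by rw [h.sharp_comm, hab]
  have e := hb x y (sharp G a) u (sharp G a)
  have mag := h.magnetic_eq ha hn hN
  have e1 := h.weyl_eq ha hn hN x y u (sharp G b)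
  obtain ⟨s, hs⟩ : ∃ s, sharp G a = s := ⟨_, rfl⟩
  obtain ⟨t, ht⟩ : ∃ s, sharp G b = s := ⟨_, rfl⟩
  have gs : ∀ x, g s x = a x := fun x => by rw [← hs, h.apply_sharp]
  have gs' : ∀ x, g x s = a x := fun x => by rw [← hs, h.apply_sharp']
  have gt : ∀ x, g x t = b x := fun x => by rw [← ht, h.apply_sharp']
  simp only [hs, ht] at *
  have e2 : ∀ x y, C x y s t = -C x y t s := fun x y => h.skew₃₄ _ _ _ _
  have e3 : C y s u t = C u t y s := h.pair _ _ _ _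
  have e4 : C s x u t = -C u t x s := by rw [h.skew₁₂, h.pair]
  have e7 : C s x u s = -elec C s x u := h.skew₁₂ _ _ _ _
  have e8 : C y s u s = elec C s y u := rfl
  simp only [gs, gs', gt, e2, e3, e4, e7, e8, hba, hab, mag, e1] at e
  rw [h.elec_symm s u y, h.elec_symm s u x, h.elec_symm s t x, h.elec_symm s t y] at *
  have hn4 : ((n : ℝ) - 4) ≠ 0 := by linarith
  rw [h.apply_sharp_self_elec'] at e
  field_simp at e ⊢
  have : ((n : ℝ) - 4) * (((n : ℝ) - 2) * a s * (b x * elec C s y u - b y * elec C s x u)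
    + ((g y u * a s - a y * a u) * elec C s x t - (g x u * a s - a x * a u) * elec C s y t)) = 0 := by
    linear_combination e
  rcases mul_eq_zero.1 this with h0 | h0
  · exact absurd h0 hn4
  · linear_combination h0

/-- Inserting `sharp G b` into `elec_wedge` and antisymmetrising shows that `E(sharp b, ·)` is
proportional to `b`. If `b` is not null, this determines `E` up to a scalar. If `b` were null, `E`
would factor through `b`, its square would vanish, and so would C². -/
theorem typeD (hn : 5 ≤ n) (hN : a (sharp G a) ≠ 0) (hab : a (sharp G b) = 0) (hb0 : b ≠ 0)
    (hC2 : tr G (contr G C) ≠ 0) :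
    b (sharp G b) ≠ 0 ∧ ∃ τ : ℝ, ∀ x u, elec C (sharp G a) x u
      = τ * (((n : ℝ) - 1) * (b x * b u) / b (sharp G b) - (g x u - a x * a u / a (sharp G a))) := by
  have hn' : (5 : ℝ) ≤ n := by exact_mod_cast hn
  have wed := h.elec_wedge ha hb hn hN hab
  have cs := (h.contr_sharp ha hn hN 0).2
  obtain ⟨s, hs⟩ : ∃ s, sharp G a = s := ⟨_, rfl⟩
  obtain ⟨t, ht⟩ : ∃ s, sharp G b = s := ⟨_, rfl⟩
  have gt : ∀ x, g t x = b x := fun x => by rw [← ht, h.apply_sharp]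
  rw [hs] at cs
  simp only [hs, ht] at hN hab wed ⊢
  have w1 : ∀ y u, ((n : ℝ) - 2) * (b t * elec C s y u - b y * elec C s t u)
      = -((g y u - a y * a u / a s) * elec C s t t - b u * elec C s t y) := by
    intro y u
    have := wed t y u
    rw [gt, hab] at this
    linear_combination this
  have w2 : ∀ y u, b u * elec C s t y = b y * elec C s t u := by
    intro y u
    have h1 := w1 y u
    have h2 := w1 u y
    rw [h.elec_symm s u y, h.symm u y] at h2
    have : ((n : ℝ) - 3) * (b u * elec C s t y - b y * elec C s t u) = 0 := by
      linear_combination h1 - h2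
    rcases mul_eq_zero.1 this with h0 | h0 <;> linarith
  obtain ⟨i, hi⟩ : ∃ i, b i ≠ 0 := by
    by_contra! hc
    exact hb0 (ContinuousLinearMap.ext hc)
  by_cases hβ : b t = 0
  · exfalso
    have v0 : elec C s t t = 0 := by
      have := w2 t i
      rw [hβ, zero_mul] at this
      exact (mul_eq_zero.1 this).resolve_left hi
    have v1 : ∀ y, elec C s t y = 0 := by
      intro y
      have h1 := w1 i y
      rw [hβ, v0] at h1
      have h2 := w2 i y
      have : ((n : ℝ) - 1) * (b i * elec C s t y) = 0 := by
        linear_combination -h1 - h2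
      rcases mul_eq_zero.1 this with h0 | h0
      · linarith
      · exact (mul_eq_zero.1 h0).resolve_left hi
    -- With `E(t, ·) = 0` the wedge relation says that `E` is `b` tensored with something; its
    -- square then contains the factor `b t = 0`.
    have v2 : ∀ y u, elec C s y u = b y * (elec C s i u / b i) := by
      intro y u
      have h1 := wed i y u
      rw [v1, v1] at h1
      have : ((n : ℝ) - 2) * (b i * elec C s y u - b y * elec C s i u) = 0 := by
        linear_combination h1
      rcases mul_eq_zero.1 this with h0 | h0
      · linarith
      · field_simp; linarith
    apply hC2
    rw [cs]
    have : tr G (fun k p => tr G fun l q => elec C s p q * elec C s k l) = 0 := by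
      have : ∀ p q k l, elec C s p q * elec C s k l
          = b p * b k * (elec C s i q / b i * (elec C s i l / b i)) := by
        intro p q k l
        rw [v2 p q, v2 k l]; ring
      simp only [this, tr_mul_left, tr_mul_right]
      rw [h.tr_covec_left b ⟨fun _ _ => map_add _ _ _, fun _ _ => map_smul _ _ _⟩, ht, hβ,
        zero_mul]
    rw [this, mul_zero]
  -- The scalar is fixed by evaluating the claimed form at `(t, t)`, which gives `τ * (n - 2) * b
  -- t`.
  · refine ⟨hβ, elec C s t t / (((n : ℝ) - 2) * b t), fun x u => ?_⟩
    have hn2 : (n : ℝ) - 2 ≠ 0 := by linarith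
    have h1 := w1 x u
    have h2 := w2 t x
    have h3 := w2 t u
    field_simp at h1 h2 h3 ⊢
    linear_combination (b t) * h1 + (-((n : ℝ) - 2) * a s * b x) * h3 - a s * b u * h2

end IsWeylAt

end TypeD

/-! ### Shape of h and of the Ricci tensor in type D. -/

section GrycakAlgebra

set_option maxSynthPendingDepth 5

variable {n : ℕ} {g : Form2 n} {G : Matrix (Fin n) (Fin n) ℝ} {C Rm : Form4 n} {Ric : Form2 n}

theorem IsMetricAt.tr_covec_covec (h : IsMetricAt g G) (a b : Form1 n) :
    tr G (fun x y => a x * b y) = a (sharp G b) :=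
  h.tr_covec_right b ⟨fun _ _ => map_add _ _ _, fun _ _ => map_smul _ _ _⟩

/-- The trace of a combination of the metric and the squares of two covectors. -/
theorem IsMetricAt.tr_metric_add_sq (h : IsMetricAt g G) {a b : Form1 n}
    (hN : a (sharp G a) ≠ 0) (hβ : b (sharp G b) ≠ 0) (c₁ c₂ : ℝ) :
    tr G (fun x y => c₁ * g x y + c₂ * (a x * a y / a (sharp G a) + b x * b y / b (sharp G b)))
      = n * c₁ + 2 * c₂ := by
  simp only [tr_add, tr_mul_left, tr_div, h.tr_metric, h.tr_covec_covec, div_self hN, div_self hβ]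
  ring

namespace IsWeylAt

variable (h : IsWeylAt g G C) {a b : Form1 n} (ha : BianchiC g G C a)

include h

/-- `E` is a combination of `b ⊗ b`, `a ⊗ a` and `g`; the metric part contributes the trace of `B`,
which is zero, and the other two evaluate `B` on the raised covectors. -/
theorem tr_tr_typeD {s : Coord n} {a b : Form1 n} {N β τ m : ℝ}
    (hE : ∀ x u, elec C s x u = τ * (m * (b x * b u) / β - (g x u - a x * a u / N)))
    {B : Coord n → Coord n → ℝ} (hB₁ : ∀ y, IsLinearMap ℝ fun x => B x y)
    (hB₂ : ∀ x, IsLinearMap ℝ fun y => B x y) (hB : tr G B = 0) :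
    tr G (fun k p => tr G fun l q => B p q * elec C s k l)
      = τ * (m / β * B (sharp G b) (sharp G b) + B (sharp G a) (sharp G a) / N) := by
  have split : ∀ p q k l, B p q * elec C s k l = τ * (m / β * (B p q * b l * b k)
      - (B p q * g k l - B p q * a l * a k / N)) := by
    intro p q k l; rw [hE]; ring
  have i1 : ∀ p k, tr G (fun l q => B p q * g k l) = B p k := fun p k =>
    h.tr_metric_left' k (hB₂ p)
  have i2 : ∀ (c : Form1 n) p, tr G (fun l q => B p q * c l) = B p (sharp G c) := fun c p =>
    h.tr_covec_left c (hB₂ p)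
  have i3 : ∀ (c : Form1 n) y, tr G (fun k p => B p y * c k) = B (sharp G c) y := fun c y =>
    h.tr_covec_left c (hB₁ y)
  simp only [split, tr_mul_left, tr_sub, tr_div, tr_mul_right, i1, i2, i3]
  rw [h.tr_comm B, hB]
  ring

include ha

/-- The triple contraction of a Weyl tensor of type D. -/
theorem contr_typeD (hn : 5 ≤ n) (hN : a (sharp G a) ≠ 0) (hab : a (sharp G b) = 0)
    (hβ : b (sharp G b) ≠ 0) {τ : ℝ} (hE : ∀ x u, elec C (sharp G a) x u
      = τ * (((n : ℝ) - 1) * (b x * b u) / b (sharp G b) - (g x u - a x * a u / a (sharp G a)))) :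
    ∃ c₁ c₂ : ℝ, ∀ x y, contr G C x y
      = c₁ * g x y + c₂ * (a x * a y / a (sharp G a) + b x * b y / b (sharp G b)) := by
  have hn' : (5 : ℝ) ≤ n := by exact_mod_cast hn
  have hn3 : (n : ℝ) - 3 ≠ 0 := by linarith
  have hba : b (sharp G a) = 0 := by rw [h.sharp_comm, hab]
  have ceq := h.contr_eq ha hn hN
  have weq := h.weyl_eq ha hn hN
  have mag := h.magnetic_eq ha hn hN
  have tt := @h.tr_tr_typeD _ _ _ _ _ _ _ _ _ _ _ hE
  obtain ⟨s, hs⟩ : ∃ s, sharp G a = s := ⟨_, rfl⟩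
  obtain ⟨t, ht⟩ : ∃ s, sharp G b = s := ⟨_, rfl⟩
  have gs : ∀ x, g x s = a x := fun x => by rw [← hs, h.apply_sharp']
  have gt : ∀ x, g x t = b x := fun x => by rw [← ht, h.apply_sharp']
  have gt' : ∀ x, g t x = b x := fun x => by rw [← ht, h.apply_sharp]
  simp only [hs, ht] at hN hab hβ hE hba ceq weq mag tt ⊢
  have Et : ∀ x, elec C s x t = τ * ((n : ℝ) - 2) * b x := by
    intro x; rw [hE, gt, hab]; field_simp; ring
  have Et' : ∀ x, elec C s t x = τ * ((n : ℝ) - 2) * b x := by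
    intro x; rw [h.elec_symm, Et]
  have F : ∀ x y, tr G (fun k p => tr G fun l q => C x p q y * elec C s k l)
      = τ * (((n : ℝ) - 1) / b t * C x t t y + C x s s y / a s) := fun x y =>
    tt (B := fun p q => C x p q y) (fun _ => ⟨fun _ _ => by simp, fun _ _ => by simp⟩)
      (fun _ => ⟨fun _ _ => by simp, fun _ _ => by simp⟩) (h.traceless₂₃ _ _)
  have J : ∀ x y, tr G (fun l q => elec C s x q * elec C s y l)
      = τ * (((n : ℝ) - 1) / b t * b y * elec C s x t - elec C s x y
        + a y * elec C s x s / a s) := by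
    intro x y
    have split : ∀ l q, elec C s x q * elec C s y l = τ * (((n : ℝ) - 1) / b t * b y *
        (elec C s x q * b l) - elec C s x q * g y l + a y * (elec C s x q * a l) / a s) := by
      intro l q; rw [hE y l]; ring
    have lE : IsLinearMap ℝ fun w => elec C s x w :=
      ⟨fun _ _ => by simp [elec], fun _ _ => by simp [elec]⟩
    have i1 := h.tr_metric_left' y lE
    have i2 := h.tr_covec_left a lE
    have i3 := h.tr_covec_left b lE
    rw [hs] at i2
    rw [ht] at i3
    have : tr G (fun l q => elec C s x q * elec C s y l) = tr G (fun l q => τ * (((n : ℝ) - 1)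
        / b t * b y * (elec C s x q * b l) - elec C s x q * g y l
        + a y * (elec C s x q * a l) / a s)) := by
      congr 1; funext l q; exact split l q
    rw [this]
    simp only [tr_mul_left, tr_add, tr_sub, tr_div, i1, i2, i3]
  have Ctt : ∀ x y, C x t t y = b t * τ * (g x y - b x * b y / b t
      - ((n : ℝ) - 1) * (a x * a y) / a s) / a s := by
    intro x y
    rw [weq, Et, Et, Et', hE, gt, gt', gt', hab]
    field_simp
    ring
  have Css : ∀ x y, C x s s y = -elec C s x y := fun x y => h.skew₃₄ _ _ _ _
  have Ctts : ∀ x, C x t t s = -a x * τ * ((n : ℝ) - 2) * b t / a s := by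
    intro x
    rw [mag, hab, Et, Et]
    ring
  have Csss : ∀ x, C x s s s = 0 := fun x => h.apply_self₃₄ _ _ _
  -- `c₁` is read off on the complement of the plane of `a` and `b`, and `c₁ + c₂` on the plane
  -- itself.
  refine ⟨2 * τ ^ 2 * (2 * n - 2) / (a s ^ 2 * ((n : ℝ) - 3)),
    2 * τ ^ 2 * ((n : ℝ) - 1) ^ 2 * ((n : ℝ) - 4) / (a s ^ 2 * ((n : ℝ) - 3)), fun x y => ?_⟩
  rw [ceq, F, F, J, Css, Ctt, Ctts, Csss, h.apply_sharp_self_elec, hE, Et]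
  field_simp
  ring

end IsWeylAt

/-- The algebraic relations between the Riemann, Ricci, scalar and Weyl curvatures. -/
structure IsCurvatureAt (g : Form2 n) (G : Matrix (Fin n) (Fin n) ℝ) (Rm : Form4 n)
    (Ric : Form2 n) (C : Form4 n) : Prop extends IsMetricAt g G where
  skew₁₂ : ∀ x y u v, Rm x y u v = -Rm y x u v
  skew₃₄ : ∀ x y u v, Rm x y u v = -Rm x y v u
  pair : ∀ x y u v, Rm x y u v = Rm u v x y
  ricci : ∀ x y, Ric x y = -tr G (fun u v => Rm u x y v)
  weyl : ∀ x y u v, C x y u v = Rm x y u v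
    + (g x v * Ric y u - g y v * Ric x u + Ric x v * g y u - Ric y v * g x u) / ((n : ℝ) - 2)
    - tr G (fun p q => Ric p q) * (g x v * g y u - g y v * g x u)
      / (((n : ℝ) - 1) * ((n : ℝ) - 2))

namespace IsCurvatureAt

variable (h : IsCurvatureAt g G Rm Ric C)
include h

theorem ricci_symm (x y : Coord n) : Ric x y = Ric y x := by
  rw [h.ricci, h.ricci, ← h.tr_comm]
  congr 2; funext u v
  rw [h.pair, h.skew₁₂, h.skew₃₄, neg_neg]

theorem isWeylAt (hn : 5 ≤ n) : IsWeylAt g G C := by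
  have hn' : (5 : ℝ) ≤ n := by exact_mod_cast hn
  have hn1 : (n : ℝ) - 1 ≠ 0 := by linarith
  have hn2 : (n : ℝ) - 2 ≠ 0 := by linarith
  refine { h.toIsMetricAt with skew₁₂ := ?_, skew₃₄ := ?_, pair := ?_, traceless := ?_ }
  · intro x y u v
    rw [h.weyl, h.weyl, h.skew₁₂]
    ring
  · intro x y u v
    rw [h.weyl, h.weyl, h.skew₃₄]
    ring
  · intro x y u v
    rw [h.weyl, h.weyl, h.pair, h.ricci_symm y u, h.ricci_symm x u, h.ricci_symm x v,
      h.ricci_symm y v, h.symm x v, h.symm y v, h.symm y u, h.symm x u]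
    ring
  · intro x y
    have lR : ∀ x, IsLinearMap ℝ fun w => Ric w x := fun x =>
      ⟨fun _ _ => by simp, fun _ _ => by simp⟩
    have lR' : ∀ x, IsLinearMap ℝ fun w => Ric x w := fun x =>
      ⟨fun _ _ => by simp, fun _ _ => by simp⟩
    have lg : ∀ x, IsLinearMap ℝ fun w => g x w := fun x =>
      ⟨fun _ _ => by simp, fun _ _ => by simp⟩
    simp only [h.weyl, tr_add, tr_sub, tr_div, tr_mul_left, tr_mul_right, h.tr_metric]
    have i1 : tr G (fun u v => g x v * Ric u y) = Ric x y := by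
      simp only [mul_comm (g _ _)]; exact h.tr_metric_right' x (lR y)
    have i2 : tr G (fun u v => Ric x v * g u y) = Ric x y := h.tr_metric_left y (lR' x)
    have i3 : tr G (fun u v => g x v * g u y) = g x y := h.tr_metric_left y (lg x)
    have i4 : tr G (fun u v => Rm u x y v) = -Ric x y := by rw [h.ricci, neg_neg]
    rw [i1, i2, i3, i4]
    field_simp
    ring

/-- If the curvature preserves the plane spanned by `a` and `b`, and the Weyl tensor is of
type D relative to this plane, then the Ricci tensor is a multiple of the metric on the plane and
on its complement. -/
theorem ricci_typeD (hn : 5 ≤ n) {a b : Form1 n} (hN : a (sharp G a) ≠ 0)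
    (hab : a (sharp G b) = 0) (hβ : b (sharp G b) ≠ 0) {τ : ℝ}
    (hE : ∀ x u, elec C (sharp G a) x u = τ * (((n : ℝ) - 1) * (b x * b u) / b (sharp G b)
      - (g x u - a x * a u / a (sharp G a))))
    (hV : ∀ x y u v, Rm x y u (sharp G a) * a v / a (sharp G a)
      + Rm x y u (sharp G b) * b v / b (sharp G b) + Rm x y v (sharp G a) * a u / a (sharp G a)
      + Rm x y v (sharp G b) * b u / b (sharp G b) = 0) :
    ∃ c₁ c₂ : ℝ, ∀ x y, Ric x y
      = c₁ * g x y + c₂ * (a x * a y / a (sharp G a) + b x * b y / b (sharp G b)) := by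
  have hn' : (5 : ℝ) ≤ n := by exact_mod_cast hn
  have hn1 : (n : ℝ) - 1 ≠ 0 := by linarith
  have hn2 : (n : ℝ) - 2 ≠ 0 := by linarith
  have hba : b (sharp G a) = 0 := by rw [h.sharp_comm, hab]
  have ta := fun (f : Coord n → ℝ) (hf : IsLinearMap ℝ f) => h.tr_covec_right a hf
  have tb := fun (f : Coord n → ℝ) (hf : IsLinearMap ℝ f) => h.tr_covec_right b hf
  obtain ⟨s, hs⟩ : ∃ s, sharp G a = s := ⟨_, rfl⟩
  obtain ⟨t, ht⟩ : ∃ s, sharp G b = s := ⟨_, rfl⟩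
  have gs : ∀ x, g x s = a x := fun x => by rw [← hs, h.apply_sharp']
  have gs' : ∀ x, g s x = a x := fun x => by rw [← hs, h.apply_sharp]
  have gt : ∀ x, g x t = b x := fun x => by rw [← ht, h.apply_sharp']
  simp only [hs, ht] at hN hab hβ hE hba hV ta tb ⊢
  have z : ∀ x y u, Rm x y u u = 0 := fun x y u => by have := h.skew₃₄ x y u u; linarith
  -- Taking `u = s` in `hV` shows that the curvature moves `s` only along `t`; `k2` is the same with
  -- the roles exchanged.
  have k1 : ∀ x y v, Rm x y v s = -Rm x y s t * b v / b t := by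
    intro x y v
    have := hV x y s v
    rw [z, hba, mul_div_cancel_right₀ _ hN] at this
    linear_combination this
  have k2 : ∀ x y v, Rm x y v t = Rm x y s t * a v / a s := by
    intro x y v
    have := hV x y t v
    rw [z, hab, h.skew₃₄ x y t s, mul_div_cancel_right₀ _ hβ] at this
    linear_combination this
  -- Pair symmetry compares `k1` with `k2`, so all curvature components involving the plane reduce
  -- to the single number `Rm s t s t`.
  have k3 : ∀ x v, -Rm x t s t * b v / b t = Rm v s s t * a x / a s := by
    intro x v
    rw [← k1, ← k2, h.pair]
  have k4 : ∀ x, Rm x t s t = Rm s t s t * a x / a s := by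
    intro x
    have := k3 x t
    rw [h.skew₁₂ t s] at this
    field_simp at this ⊢
    linear_combination -this
  have k5 : ∀ x, Rm x s s t = -Rm s t s t * b x / b t := by
    intro x
    have := k3 s x
    field_simp at this ⊢
    linear_combination -this
  have r1 : ∀ x, Ric x s = Rm s t s t * a x / (a s * b t) := by
    intro x
    have : tr G (fun u v => Rm u x s v) = tr G (fun u v => Rm u x s t * b v / b t) := by
      congr 1; funext u v; rw [h.skew₃₄, k1]; ring
    rw [h.ricci, this, tr_div, tb (fun u => Rm u x s t) ⟨fun _ _ => by simp, fun _ _ => by simp⟩, h.skew₁₂, k4]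
    field_simp
  have r2 : ∀ x, Ric x t = Rm s t s t * b x / (a s * b t) := by
    intro x
    have : tr G (fun u v => Rm u x t v) = tr G (fun u v => -Rm u x s t * a v / a s) := by
      congr 1; funext u v; rw [h.skew₃₄, k2]; ring
    rw [h.ricci, this, tr_div, ta (fun u => -Rm u x s t) ⟨fun _ _ => by simp; ring, fun _ _ => by simp⟩, h.skew₁₂, k5]
    field_simp
  obtain ⟨κ, hκ⟩ : ∃ κ, Rm s t s t = κ := ⟨_, rfl⟩
  obtain ⟨S, hS⟩ : ∃ S, tr G (fun p q => Ric p q) = S := ⟨_, rfl⟩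
  simp only [hκ] at k4 k5 r1 r2
  -- The decomposition of `C x s y s` is solved for `Ric x y`: the left side is the known electric
  -- part, and the Riemann and Ricci terms with an `s` are known from `k1`, `k5` and `r1`.
  obtain ⟨c₁, c₂, c₃, hc⟩ : ∃ c₁ c₂ c₃ : ℝ, ∀ x y, Ric x y
      = c₁ * g x y + c₂ * (a x * a y / a s) + c₃ * (b x * b y / b t) := by
    refine ⟨(-κ / b t / ((n : ℝ) - 2) + S * a s / (((n : ℝ) - 1) * ((n : ℝ) - 2)) + τ)
        * ((n : ℝ) - 2) / a s,
      (2 * κ / b t / ((n : ℝ) - 2) - S * a s / (((n : ℝ) - 1) * ((n : ℝ) - 2)) - τ)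
        * ((n : ℝ) - 2) / a s,
      (κ / b t - τ * ((n : ℝ) - 1)) * ((n : ℝ) - 2) / a s, fun x y => ?_⟩
    have e := h.weyl x s y s
    rw [hS, k1, k5, show C x s y s = elec C s x y from rfl, hE, gs, gs, gs', h.ricci_symm s y,
      r1, r1, r1] at e
    field_simp at e ⊢
    linear_combination e
  have e1 := hc s s
  have e2 := hc t t
  rw [r1, gs, hba] at e1
  rw [r2, gt, hab] at e2
  refine ⟨c₁, c₂, fun x y => ?_⟩
  -- By `r1` and `r2` the vectors `s` and `t` are Ricci eigenvectors with the same eigenvalue, `c₁ +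
  -- c₂` on one side and `c₁ + c₃` on the other.
  have : c₃ = c₂ := by
    field_simp at e1 e2
    have : a s * b t * (c₃ - c₂) = 0 := by linear_combination e1 - e2
    rcases mul_eq_zero.1 this with h0 | h0
    · exact absurd h0 (mul_ne_zero hN hβ)
    · linarith
  rw [hc, this]
  ring

end IsCurvatureAt

end GrycakAlgebra

/-! ### Tensor fields in coordinates, smoothness and the Levi-Civita connection. -/

section Fields

set_option maxSynthPendingDepth 5

variable {n : ℕ}

theorem contDiffOn_det {U : Set (Coord n)} {A : Coord n → Matrix (Fin n) (Fin n) ℝ}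
    (hA : ∀ i j, ContDiffOn ℝ ∞ (fun z => A z i j) U) :
    ContDiffOn ℝ ∞ (fun z => (A z).det) U := by
  simp only [Matrix.det_apply]
  refine ContDiffOn.sum fun σ _ => ?_
  exact ContDiffOn.const_smul _ (contDiffOn_prod fun i _ => hA _ _)

theorem contDiffOn_matrix_inv {U : Set (Coord n)} {A : Coord n → Matrix (Fin n) (Fin n) ℝ}
    (hA : ∀ i j, ContDiffOn ℝ ∞ (fun z => A z i j) U) (hd : ∀ z ∈ U, (A z).det ≠ 0)
    (i j : Fin n) : ContDiffOn ℝ ∞ (fun z => (A z)⁻¹ i j) U := by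
  simp only [Matrix.inv_def, Matrix.smul_apply, Ring.inverse_eq_inv', smul_eq_mul,
    Matrix.adjugate_apply]
  refine ((contDiffOn_det hA).inv hd).mul (contDiffOn_det fun k l => ?_)
  by_cases hk : k = j
  · subst hk
    simp only [Matrix.updateRow_self]
    exact contDiffOn_const
  · simp only [Matrix.updateRow_ne hk]
    exact hA _ _

theorem contDiffOn_pd {U : Set (Coord n)} (hU : IsOpen U) {f : Coord n → ℝ}
    (hf : ContDiffOn ℝ ∞ f U) (i : Fin n) : ContDiffOn ℝ ∞ (CRn.pd i f) U := by
  unfold CRn.pd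
  exact (hf.fderiv_of_isOpen hU (m := ∞) (by simp)).clm_apply contDiffOn_const

theorem fderiv_apply_const {E F : Type*} [NormedAddCommGroup E] [NormedSpace ℝ E]
    [NormedAddCommGroup F] [NormedSpace ℝ F] {T : Coord n → E →L[ℝ] F} {z : Coord n}
    (hT : DifferentiableAt ℝ T z) (w : Coord n) (x : E) :
    fderiv ℝ (fun z => T z x) z w = fderiv ℝ T z w x := by
  have := (hT.hasFDerivAt.clm_apply (hasFDerivAt_const x z)).fderiv
  rw [this]
  simp

/-- The metric as a field of bilinear forms. -/
def metricF (γ : Coord n → Matrix (Fin n) (Fin n) ℝ) (z : Coord n) : Form2 n :=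
  lin fun i => lin fun j => γ z i j

/-- The Christoffel symbols as a field of bilinear maps. -/
def connF (γ : Coord n → Matrix (Fin n) (Fin n) ℝ) (z : Coord n) :
    Coord n →L[ℝ] Coord n →L[ℝ] Coord n :=
  lin fun i => lin fun j => ∑ k, christoffel γ k i j z • bv k

/-- The Riemann tensor as a field of quadrilinear forms. -/
def riemannF (γ : Coord n → Matrix (Fin n) (Fin n) ℝ) (z : Coord n) : Form4 n :=
  lin fun i => lin fun j => lin fun k => lin fun l => riemann γ i j k l z

/-- The Ricci tensor as a field of bilinear forms. -/
def ricciF (γ : Coord n → Matrix (Fin n) (Fin n) ℝ) (z : Coord n) : Form2 n :=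
  lin fun i => lin fun j => ricci γ i j z

/-- The Weyl tensor as a field of quadrilinear forms. -/
def weylF (γ : Coord n → Matrix (Fin n) (Fin n) ℝ) (z : Coord n) : Form4 n :=
  lin fun i => lin fun j => lin fun k => lin fun l => weyl γ i j k l z

/-- The curvature endomorphism of a field of connection coefficients. -/
def curvEnd (Γ : Coord n → Coord n →L[ℝ] Coord n →L[ℝ] Coord n) (z x y u : Coord n) : Coord n :=
  fderiv ℝ Γ z y x u - fderiv ℝ Γ z x y u + Γ z y (Γ z x u) - Γ z x (Γ z y u)

/-- A smooth field of nondegenerate symmetric matrices on an open set. -/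
structure SmoothMetric (γ : Coord n → Matrix (Fin n) (Fin n) ℝ) (U : Set (Coord n)) : Prop where
  isOpen : IsOpen U
  smooth : ∀ i j, ContDiffOn ℝ ∞ (fun z => γ z i j) U
  symm : ∀ z ∈ U, ∀ i j, γ z i j = γ z j i
  det_ne_zero : ∀ z ∈ U, (γ z).det ≠ 0

namespace SmoothMetric

variable {γ : Coord n → Matrix (Fin n) (Fin n) ℝ} {U : Set (Coord n)} (h : SmoothMetric γ U)
include h

theorem smooth_inv (i j : Fin n) : ContDiffOn ℝ ∞ (fun z => (γ z)⁻¹ i j) U :=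
  contDiffOn_matrix_inv h.smooth h.det_ne_zero i j

theorem smooth_christoffel (k i j : Fin n) : ContDiffOn ℝ ∞ (christoffel γ k i j) U := by
  unfold christoffel
  refine contDiffOn_const.mul (ContDiffOn.sum fun l _ => (h.smooth_inv _ _).mul ?_)
  have hp := fun i j k => contDiffOn_pd h.isOpen (h.smooth j k) i
  exact ((hp _ _ _).add (hp _ _ _)).sub (hp _ _ _)

theorem smooth_riemannUp (j k l m : Fin n) : ContDiffOn ℝ ∞ (riemannUp γ j k l m) U := by
  unfold riemannUp
  have hp := fun l i j k => contDiffOn_pd h.isOpen (h.smooth_christoffel i j k) l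
  refine ((hp _ _ _ _).sub (hp _ _ _ _)).add (ContDiffOn.sum fun p _ => ?_)
  exact ((h.smooth_christoffel _ _ _).mul (h.smooth_christoffel _ _ _)).sub
    ((h.smooth_christoffel _ _ _).mul (h.smooth_christoffel _ _ _))

theorem smooth_riemann (j k l m : Fin n) : ContDiffOn ℝ ∞ (riemann γ j k l m) U := by
  unfold riemann
  exact ContDiffOn.sum fun p _ => (h.smooth_riemannUp _ _ _ _).mul (h.smooth _ _)

theorem smooth_ricci (k l : Fin n) : ContDiffOn ℝ ∞ (ricci γ k l) U := by
  unfold ricci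
  exact (ContDiffOn.sum fun p _ => h.smooth_riemannUp _ _ _ _).neg

theorem smooth_scalar : ContDiffOn ℝ ∞ (scalar γ) U := by
  unfold scalar
  exact ContDiffOn.sum fun i _ => ContDiffOn.sum fun j _ => (h.smooth_inv _ _).mul
    (h.smooth_ricci _ _)

theorem smooth_weyl (j k l m : Fin n) : ContDiffOn ℝ ∞ (weyl γ j k l m) U := by
  unfold weyl
  have hg := h.smooth
  have hr := h.smooth_ricci
  exact ((h.smooth_riemann _ _ _ _).add (((((hg _ _).mul (hr _ _)).sub ((hg _ _).mul (hr _ _))).add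
    ((hr _ _).mul (hg _ _))).sub ((hr _ _).mul (hg _ _)) |>.div_const _)).sub
    ((h.smooth_scalar.mul (((hg _ _).mul (hg _ _)).sub ((hg _ _).mul (hg _ _)))).div_const _)

theorem smooth_metricF : ContDiffOn ℝ ∞ (metricF γ) U :=
  contDiffOn_lin fun _ => contDiffOn_lin fun _ => h.smooth _ _

theorem smooth_connF : ContDiffOn ℝ ∞ (connF γ) U :=
  contDiffOn_lin fun _ => contDiffOn_lin fun _ => ContDiffOn.sum fun _ _ =>
    (h.smooth_christoffel _ _ _).smul contDiffOn_const

theorem smooth_riemannF : ContDiffOn ℝ ∞ (riemannF γ) U :=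
  contDiffOn_lin fun _ => contDiffOn_lin fun _ => contDiffOn_lin fun _ => contDiffOn_lin fun _ =>
    h.smooth_riemann _ _ _ _

theorem smooth_ricciF : ContDiffOn ℝ ∞ (ricciF γ) U :=
  contDiffOn_lin fun _ => contDiffOn_lin fun _ => h.smooth_ricci _ _

theorem smooth_weylF : ContDiffOn ℝ ∞ (weylF γ) U :=
  contDiffOn_lin fun _ => contDiffOn_lin fun _ => contDiffOn_lin fun _ => contDiffOn_lin fun _ =>
    h.smooth_weyl _ _ _ _

theorem inv_mul_cancel {z : Coord n} (hz : z ∈ U) : (γ z)⁻¹ * γ z = 1 :=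
  Matrix.nonsing_inv_mul _ (isUnit_iff_ne_zero.2 (h.det_ne_zero z hz))

theorem mul_inv_cancel {z : Coord n} (hz : z ∈ U) : γ z * (γ z)⁻¹ = 1 :=
  Matrix.mul_nonsing_inv _ (isUnit_iff_ne_zero.2 (h.det_ne_zero z hz))

theorem inv_symm {z : Coord n} (hz : z ∈ U) (i j : Fin n) : (γ z)⁻¹ i j = (γ z)⁻¹ j i := by
  have : (γ z).transpose = γ z := by ext i j; exact h.symm z hz j i
  have h2 : ((γ z)⁻¹).transpose = (γ z)⁻¹ := by rw [Matrix.transpose_nonsing_inv, this]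
  conv_lhs => rw [← h2]
  rfl

omit h in
theorem metricF_bv (z : Coord n) (i j : Fin n) : metricF γ z (bv i) (bv j) = γ z i j := by
  simp [metricF]

theorem isMetricAt {z : Coord n} (hz : z ∈ U) : IsMetricAt (metricF γ z) (γ z)⁻¹ where
  symm x y := by
    refine isLinearMap_ext (f := fun x => metricF γ z x y) (g := fun x => metricF γ z y x)
      ⟨fun _ _ => by simp, fun _ _ => by simp⟩ ⟨fun _ _ => by simp, fun _ _ => by simp⟩ (fun i => ?_) x
    refine isLinearMap_ext (f := fun y => metricF γ z (bv i) y)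
      (g := fun y => metricF γ z y (bv i))
      ⟨fun _ _ => by simp, fun _ _ => by simp⟩ ⟨fun _ _ => by simp, fun _ _ => by simp⟩ (fun j => ?_) y
    simp only [metricF_bv]
    exact h.symm z hz i j
  inv_symm := h.inv_symm hz
  inv i k := by
    have := congrFun (congrFun (h.inv_mul_cancel hz) i) k
    rw [Matrix.mul_apply, Matrix.one_apply] at this
    simpa only [metricF_bv] using this

theorem connF_symm {z : Coord n} (hz : z ∈ U) (x y : Coord n) :
    connF γ z x y = connF γ z y x := by
  have hs : ∀ i j l, pd i (fun z => γ z j l) z = pd i (fun z => γ z l j) z := by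
    intro i j l
    unfold pd
    have : (fun z => γ z j l) =ᶠ[nhds z] fun z => γ z l j := by
      filter_upwards [h.isOpen.mem_nhds hz] with z' hz' using h.symm z' hz' j l
    rw [this.fderiv_eq]
  have hc : ∀ k i j, christoffel γ k i j z = christoffel γ k j i z := by
    intro k i j
    unfold christoffel
    congr 1
    refine Finset.sum_congr rfl fun l _ => ?_
    rw [hs l i j]
    ring
  simp only [connF, lin_apply, Finset.smul_sum, sum_apply,
    smul_apply]
  rw [Finset.sum_comm]
  simp only [hc, smul_smul, mul_comm, mul_left_comm, mul_assoc]

/-- The Koszul formula. -/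
theorem koszul_index {z : Coord n} (hz : z ∈ U) (i j k : Fin n) :
    ∑ l, christoffel γ l i j z * γ z l k
      = (1 / 2) * (pd i (fun z => γ z j k) z + pd j (fun z => γ z i k) z
        - pd k (fun z => γ z i j) z) := by
  unfold christoffel
  simp only [mul_assoc, Finset.sum_mul, ← Finset.mul_sum]
  congr 1
  rw [Finset.sum_comm]
  have : ∀ m, ∑ l, (γ z)⁻¹ l m * ((pd i (fun z => γ z j m) z + pd j (fun z => γ z i m) z
        - pd m (fun z => γ z i j) z) * γ z l k)
      = (pd i (fun z => γ z j m) z + pd j (fun z => γ z i m) z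
        - pd m (fun z => γ z i j) z) * if m = k then 1 else 0 := by
    intro m
    have h1 := congrFun (congrFun (h.inv_mul_cancel hz) m) k
    rw [Matrix.mul_apply, Matrix.one_apply] at h1
    rw [← h1, Finset.mul_sum]
    refine Finset.sum_congr rfl fun l _ => ?_
    rw [h.inv_symm hz l m]
    ring
  simp [this]

theorem differentiableAt_metricF {z : Coord n} (hz : z ∈ U) :
    DifferentiableAt ℝ (metricF γ) z :=
  (h.smooth_metricF.contDiffAt (h.isOpen.mem_nhds hz)).differentiableAt (by simp)

theorem fderiv_metricF_bv {z : Coord n} (hz : z ∈ U) (i j k : Fin n) :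
    fderiv ℝ (metricF γ) z (bv i) (bv j) (bv k) = pd i (fun z => γ z j k) z := by
  rw [← fderiv_apply_const (h.differentiableAt_metricF hz),
    ← fderiv_apply_const (T := fun z => metricF γ z (bv j))
      ((h.differentiableAt_metricF hz).clm_apply (differentiableAt_const _))]
  simp only [metricF_bv]
  rfl

theorem koszul {z : Coord n} (hz : z ∈ U) (x y w : Coord n) :
    metricF γ z (connF γ z x y) w = (1 / 2) * (fderiv ℝ (metricF γ) z x y w
      + fderiv ℝ (metricF γ) z y x w - fderiv ℝ (metricF γ) z w x y) := by
  refine isLinearMap_ext (f := fun x => metricF γ z (connF γ z x y) w)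
    (g := fun x => (1 / 2) * (fderiv ℝ (metricF γ) z x y w
      + fderiv ℝ (metricF γ) z y x w - fderiv ℝ (metricF γ) z w x y))
    ⟨fun _ _ => by simp, fun _ _ => by simp⟩
    ⟨fun _ _ => by simp; ring, fun _ _ => by simp; ring⟩ (fun i => ?_) x
  refine isLinearMap_ext (f := fun y => metricF γ z (connF γ z (bv i) y) w)
    (g := fun y => (1 / 2) * (fderiv ℝ (metricF γ) z (bv i) y w
      + fderiv ℝ (metricF γ) z y (bv i) w - fderiv ℝ (metricF γ) z w (bv i) y))
    ⟨fun _ _ => by simp, fun _ _ => by simp⟩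
    ⟨fun _ _ => by simp; ring, fun _ _ => by simp; ring⟩ (fun j => ?_) y
  refine isLinearMap_ext (f := fun w => metricF γ z (connF γ z (bv i) (bv j)) w)
    (g := fun w => (1 / 2) * (fderiv ℝ (metricF γ) z (bv i) (bv j) w
      + fderiv ℝ (metricF γ) z (bv j) (bv i) w - fderiv ℝ (metricF γ) z w (bv i) (bv j)))
    ⟨fun _ _ => by simp, fun _ _ => by simp⟩
    ⟨fun _ _ => by simp; ring, fun _ _ => by simp; ring⟩ (fun k => ?_) w
  simp only [h.fderiv_metricF_bv hz]
  rw [← h.koszul_index hz]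
  simp [connF, map_sum, metricF_bv]

theorem fderiv_metricF_symm {z : Coord n} (hz : z ∈ U) (w x y : Coord n) :
    fderiv ℝ (metricF γ) z w x y = fderiv ℝ (metricF γ) z w y x := by
  have hd := h.differentiableAt_metricF hz
  have hd' : ∀ x, DifferentiableAt ℝ (fun z => metricF γ z x) z := fun x =>
    hd.clm_apply (differentiableAt_const _)
  rw [← fderiv_apply_const hd, ← fderiv_apply_const hd, ← fderiv_apply_const (hd' x),
    ← fderiv_apply_const (hd' y)]
  have : (fun z => metricF γ z x y) =ᶠ[nhds z] fun z => metricF γ z y x := by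
    filter_upwards [h.isOpen.mem_nhds hz] with z' hz' using (h.isMetricAt hz').symm x y
  rw [this.fderiv_eq]

/-- The metric is parallel. -/
theorem metric_parallel {z : Coord n} (hz : z ∈ U) (w x y : Coord n) :
    fderiv ℝ (metricF γ) z w x y
      = metricF γ z (connF γ z w x) y + metricF γ z x (connF γ z w y) := by
  -- Adding two Koszul formulas with exchanged arguments cancels all derivatives except the one in
  -- direction `w`.
  rw [(h.isMetricAt hz).symm x, h.koszul hz, h.koszul hz, h.fderiv_metricF_symm hz w y x,
    h.fderiv_metricF_symm hz y w x, h.fderiv_metricF_symm hz x w y]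
  ring

end SmoothMetric

end Fields

/-! ### Curvature: symmetries and Bianchi identities. -/

section Curvature

set_option maxSynthPendingDepth 5

variable {n : ℕ}

theorem fderiv_apply₂ {E F F' : Type*} [NormedAddCommGroup E] [NormedSpace ℝ E]
    [NormedAddCommGroup F] [NormedSpace ℝ F] [NormedAddCommGroup F'] [NormedSpace ℝ F']
    {T : Coord n → E →L[ℝ] F →L[ℝ] F'} {z : Coord n}
    (hT : DifferentiableAt ℝ T z) (w : Coord n) (x : E) (y : F) :
    fderiv ℝ (fun z => T z x y) z w = fderiv ℝ T z w x y := by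
  rw [fderiv_apply_const (hT.clm_apply (differentiableAt_const x)), fderiv_apply_const hT]

theorem fderiv_apply₄ {T : Coord n → Form4 n} {z : Coord n}
    (hT : DifferentiableAt ℝ T z) (w x y u v : Coord n) :
    fderiv ℝ (fun z => T z x y u v) z w = fderiv ℝ T z w x y u v := by
  rw [fderiv_apply₂ (T := fun z => T z x y)
    ((hT.clm_apply (differentiableAt_const x)).clm_apply (differentiableAt_const y)),
    fderiv_apply₂ hT]

/-- The covariant derivative of a field of bilinear forms. -/
def cov2 (Γ : Coord n → Coord n →L[ℝ] Coord n →L[ℝ] Coord n) (T : Coord n → Form2 n)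
    (z w x y : Coord n) : ℝ := fderiv ℝ T z w x y - T z (Γ z w x) y - T z x (Γ z w y)

/-- The covariant derivative of a field of quadrilinear forms. -/
def cov4 (Γ : Coord n → Coord n →L[ℝ] Coord n →L[ℝ] Coord n) (T : Coord n → Form4 n)
    (z w x y u v : Coord n) : ℝ :=
  fderiv ℝ T z w x y u v - T z (Γ z w x) y u v - T z x (Γ z w y) u v - T z x y (Γ z w u) v
    - T z x y u (Γ z w v)

/-- A parallel bilinear form is annihilated by the curvature. -/
theorem curvEnd_of_parallel {Γ : Coord n → Coord n →L[ℝ] Coord n →L[ℝ] Coord n}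
    {T : Coord n → Form2 n} {z : Coord n} (hΓ : DifferentiableAt ℝ Γ z)
    (hT : ContDiffAt ℝ ∞ T z) (hp : ∀ᶠ z' in nhds z, ∀ w x v, cov2 Γ T z' w x v = 0)
    (x y u v : Coord n) : T z (curvEnd Γ z x y u) v + T z u (curvEnd Γ z x y v) = 0 := by
  have hTd : DifferentiableAt ℝ T z := hT.differentiableAt (by simp)
  have hT' : DifferentiableAt ℝ (fderiv ℝ T) z :=
    (hT.fderiv_right (m := ∞) (by simp)).differentiableAt (by simp)
  have hsym : ∀ w w', fderiv ℝ (fderiv ℝ T) z w w' = fderiv ℝ (fderiv ℝ T) z w' w :=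
    hT.isSymmSndFDerivAt (by simpa using ENat.LEInfty.out)
  have hz := hp.self_of_nhds
  simp only [cov2] at hz
  -- The parallel equation expresses the derivative of `T` by `T` and `Γ`, and is differentiated
  -- once more. Antisymmetrising in the two directions removes the second derivative and leaves the
  -- curvature.
  have key : ∀ w' w u v, fderiv ℝ (fderiv ℝ T) z w' w u v
      = T z (Γ z w' (Γ z w u)) v + T z (Γ z w u) (Γ z w' v) + T z (fderiv ℝ Γ z w' w u) v
        + (T z (Γ z w' u) (Γ z w v) + T z u (Γ z w' (Γ z w v)) + T z u (fderiv ℝ Γ z w' w v)) := by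
    intro w' w u v
    have e : (fun z' => fderiv ℝ T z' w u v) =ᶠ[nhds z]
        fun z' => T z' (Γ z' w u) v + T z' u (Γ z' w v) := by
      filter_upwards [hp] with z' hz'
      have := hz' w u v
      simp only [cov2] at this
      linarith
    have e1 : fderiv ℝ (fun z' => fderiv ℝ T z' w u v) z w'
        = fderiv ℝ (fderiv ℝ T) z w' w u v := by
      rw [fderiv_apply₂ (T := fun z' => fderiv ℝ T z' w)
        (hT'.clm_apply (differentiableAt_const _)), fderiv_apply_const hT']
    have hΓc : ∀ v, HasFDerivAt (fun z' => Γ z' w v) _ z := fun v =>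
      (hΓ.hasFDerivAt.clm_apply (hasFDerivAt_const w z)).clm_apply (hasFDerivAt_const v z)
    have h1 := (hTd.hasFDerivAt.clm_apply (hΓc u)).clm_apply (hasFDerivAt_const v z)
    have h2 := (hTd.hasFDerivAt.clm_apply (hasFDerivAt_const u z)).clm_apply (hΓc v)
    rw [← e1, e.fderiv_eq, (h1.fun_add h2).fderiv]
    simp
    linear_combination hz w' (Γ z w u) v + hz w' u (Γ z w v)
  have k1 := key x y u v
  have k2 := key y x u v
  rw [hsym x y] at k1
  simp only [curvEnd, map_add, map_sub, add_apply, sub_apply]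
  linear_combination k1 - k2

/-- The second Bianchi identity for the curvature of a torsion-free connection. -/
theorem curvEnd_bianchi {Γ : Coord n → Coord n →L[ℝ] Coord n →L[ℝ] Coord n} {z : Coord n}
    (hΓ : ContDiffAt ℝ ∞ Γ z) (w x y u : Coord n) :
    (fderiv ℝ (fun z => curvEnd Γ z x y u) z w + Γ z w (curvEnd Γ z x y u)
        - curvEnd Γ z x y (Γ z w u))
      + (fderiv ℝ (fun z => curvEnd Γ z y w u) z x + Γ z x (curvEnd Γ z y w u)
        - curvEnd Γ z y w (Γ z x u))
      + (fderiv ℝ (fun z => curvEnd Γ z w x u) z y + Γ z y (curvEnd Γ z w x u)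
        - curvEnd Γ z w x (Γ z y u)) = 0 := by
  have hd : DifferentiableAt ℝ Γ z := hΓ.differentiableAt (by simp)
  have hd' : DifferentiableAt ℝ (fderiv ℝ Γ) z :=
    (hΓ.fderiv_right (m := ∞) (by simp)).differentiableAt (by simp)
  have hsym : ∀ w w', fderiv ℝ (fderiv ℝ Γ) z w w' = fderiv ℝ (fderiv ℝ Γ) z w' w :=
    hΓ.isSymmSndFDerivAt (by simpa using ENat.LEInfty.out)
  have key : ∀ w x y, fderiv ℝ (fun z => curvEnd Γ z x y u) z w
      = fderiv ℝ (fderiv ℝ Γ) z w y x u - fderiv ℝ (fderiv ℝ Γ) z w x y u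
        + (fderiv ℝ Γ z w y (Γ z x u) + Γ z y (fderiv ℝ Γ z w x u))
        - (fderiv ℝ Γ z w x (Γ z y u) + Γ z x (fderiv ℝ Γ z w y u)) := by
    intro w x y
    have hc : ∀ (x u), HasFDerivAt (fun z' => Γ z' x u) _ z := fun x u =>
      (hd.hasFDerivAt.clm_apply (hasFDerivAt_const x z)).clm_apply (hasFDerivAt_const u z)
    have hc' : ∀ (x y u), HasFDerivAt (fun z' => fderiv ℝ Γ z' x y u) _ z := fun x y u =>
      ((hd'.hasFDerivAt.clm_apply (hasFDerivAt_const x z)).clm_apply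
        (hasFDerivAt_const y z)).clm_apply (hasFDerivAt_const u z)
    have hcc : ∀ (x y u), HasFDerivAt (fun z' => Γ z' x (Γ z' y u)) _ z := fun x y u =>
      (hd.hasFDerivAt.clm_apply (hasFDerivAt_const x z)).clm_apply (hc y u)
    have := (((hc' y x u).fun_sub (hc' x y u)).fun_add (hcc y x u)).fun_sub (hcc x y u)
    unfold curvEnd
    rw [HasFDerivAt.fderiv this]
    simp
    abel
  -- In the cyclic sum the second derivatives of `Γ` cancel by symmetry, and the quadratic and cubic
  -- terms cancel in pairs.
  rw [key, key, key, hsym w y, hsym w x, hsym x y]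
  simp only [curvEnd, map_add, map_sub]
  abel

namespace SmoothMetric

variable {γ : Coord n → Matrix (Fin n) (Fin n) ℝ} {U : Set (Coord n)} (h : SmoothMetric γ U)
include h

theorem contDiffAt_connF {z : Coord n} (hz : z ∈ U) : ContDiffAt ℝ ∞ (connF γ) z :=
  h.smooth_connF.contDiffAt (h.isOpen.mem_nhds hz)

theorem differentiableAt_connF {z : Coord n} (hz : z ∈ U) : DifferentiableAt ℝ (connF γ) z :=
  (h.contDiffAt_connF hz).differentiableAt (by simp)

/-- Ties the index-free curvature to the coordinate formula. The sign is that of `riemannUp`,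
opposite to the commutator [∇_x, ∇_y] acting on vectors. -/
theorem curvEnd_bv {z : Coord n} (hz : z ∈ U) (j k l : Fin n) :
    curvEnd (connF γ) z (bv j) (bv k) (bv l) = ∑ m, riemannUp γ j k l m z • bv m := by
  have hc : ∀ i j k, fderiv ℝ (connF γ) z (bv i) (bv j) (bv k)
      = ∑ m, pd i (christoffel γ m j k) z • bv m := by
    intro i j k
    rw [← fderiv_apply₂ (h.differentiableAt_connF hz)]
    have : (fun z => connF γ z (bv j) (bv k)) = fun z => ∑ m, christoffel γ m j k z • bv m := by
      funext z; simp [connF]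
    rw [this]
    have hs : HasFDerivAt (fun z => ∑ m, christoffel γ m j k z • bv m) _ z :=
      HasFDerivAt.fun_sum fun m _ => (((h.smooth_christoffel m j k).contDiffAt
        (h.isOpen.mem_nhds hz)).differentiableAt (by simp)).hasFDerivAt.smul_const (bv m)
    rw [hs.fderiv]
    simp [pd]
  have hg : ∀ i j k, connF γ z (bv i) (connF γ z (bv j) (bv k))
      = ∑ m, (∑ p, christoffel γ p j k z * christoffel γ m i p z) • bv m := by
    intro i j k
    simp only [connF, lin_bv, map_sum, map_smul, Finset.smul_sum, Finset.sum_smul, smul_smul]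
    rw [Finset.sum_comm]
  simp only [curvEnd, hc, hg, riemannUp, ← Finset.sum_add_distrib, ← Finset.sum_sub_distrib]
  refine Finset.sum_congr rfl fun m _ => ?_
  simp only [add_smul, sub_smul, Finset.sum_sub_distrib]
  abel

omit h in
theorem isLinearMap_curvEnd₁ (Γ : Coord n → Coord n →L[ℝ] Coord n →L[ℝ] Coord n)
    (z y u : Coord n) : IsLinearMap ℝ fun x => curvEnd Γ z x y u :=
  ⟨fun _ _ => by simp [curvEnd]; abel, fun _ _ => by simp [curvEnd, smul_sub, smul_add]⟩

omit h in
theorem isLinearMap_curvEnd₂ (Γ : Coord n → Coord n →L[ℝ] Coord n →L[ℝ] Coord n)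
    (z x u : Coord n) : IsLinearMap ℝ fun y => curvEnd Γ z x y u :=
  ⟨fun _ _ => by simp [curvEnd]; abel, fun _ _ => by simp [curvEnd, smul_sub, smul_add]⟩

omit h in
theorem isLinearMap_curvEnd₃ (Γ : Coord n → Coord n →L[ℝ] Coord n →L[ℝ] Coord n)
    (z x y : Coord n) : IsLinearMap ℝ fun u => curvEnd Γ z x y u :=
  ⟨fun _ _ => by simp [curvEnd]; abel, fun _ _ => by simp [curvEnd, smul_sub, smul_add]⟩

theorem riemannF_eq {z : Coord n} (hz : z ∈ U) (x y u v : Coord n) :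
    riemannF γ z x y u v = metricF γ z (curvEnd (connF γ) z x y u) v := by
  have l1 := isLinearMap_curvEnd₁ (connF γ) z
  have l2 := isLinearMap_curvEnd₂ (connF γ) z
  have l3 := isLinearMap_curvEnd₃ (connF γ) z
  refine isLinearMap_ext (f := fun x => riemannF γ z x y u v)
    (g := fun x => metricF γ z (curvEnd (connF γ) z x y u) v)
    ⟨fun _ _ => by simp, fun _ _ => by simp⟩
    ⟨fun _ _ => by simp [(l1 _ _).map_add], fun _ _ => by simp [(l1 _ _).map_smul]⟩
    (fun i => ?_) x
  refine isLinearMap_ext (f := fun y => riemannF γ z (bv i) y u v)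
    (g := fun y => metricF γ z (curvEnd (connF γ) z (bv i) y u) v)
    ⟨fun _ _ => by simp, fun _ _ => by simp⟩
    ⟨fun _ _ => by simp [(l2 _ _).map_add], fun _ _ => by simp [(l2 _ _).map_smul]⟩
    (fun j => ?_) y
  refine isLinearMap_ext (f := fun u => riemannF γ z (bv i) (bv j) u v)
    (g := fun u => metricF γ z (curvEnd (connF γ) z (bv i) (bv j) u) v)
    ⟨fun _ _ => by simp, fun _ _ => by simp⟩
    ⟨fun _ _ => by simp [(l3 _ _).map_add], fun _ _ => by simp [(l3 _ _).map_smul]⟩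
    (fun k => ?_) u
  refine isLinearMap_ext (f := fun v => riemannF γ z (bv i) (bv j) (bv k) v)
    (g := fun v => metricF γ z (curvEnd (connF γ) z (bv i) (bv j) (bv k)) v)
    ⟨fun _ _ => by simp, fun _ _ => by simp⟩
    ⟨fun _ _ => by simp, fun _ _ => by simp⟩ (fun l => ?_) v
  simp only [h.curvEnd_bv hz, map_sum, map_smul, sum_apply, smul_apply, metricF_bv, smul_eq_mul]
  simp [riemannF, riemann]

theorem curvEnd_metric {z : Coord n} (hz : z ∈ U) (x y u v : Coord n) :
    metricF γ z (curvEnd (connF γ) z x y u) v + metricF γ z u (curvEnd (connF γ) z x y v) = 0 := by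
  refine curvEnd_of_parallel (h.differentiableAt_connF hz)
    (h.smooth_metricF.contDiffAt (h.isOpen.mem_nhds hz)) ?_ x y u v
  filter_upwards [h.isOpen.mem_nhds hz] with z' hz' w x v
  rw [cov2, h.metric_parallel hz']
  ring

theorem riemannF_skew₁₂ {z : Coord n} (hz : z ∈ U) (x y u v : Coord n) :
    riemannF γ z x y u v = -riemannF γ z y x u v := by
  rw [h.riemannF_eq hz, h.riemannF_eq hz]
  simp only [curvEnd, map_add, map_sub, add_apply, sub_apply]
  ring

/-- The metric is parallel, so the curvature endomorphisms are skew with respect to it. -/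
theorem riemannF_skew₃₄ {z : Coord n} (hz : z ∈ U) (x y u v : Coord n) :
    riemannF γ z x y u v = -riemannF γ z x y v u := by
  rw [h.riemannF_eq hz, h.riemannF_eq hz]
  have := h.curvEnd_metric hz x y u v
  rw [(h.isMetricAt hz).symm u] at this
  linarith

/-- Torsion-freeness: `Γ` and its derivative are symmetric in their two vector arguments, so the
terms cancel in pairs. -/
theorem riemannF_cyclic {z : Coord n} (hz : z ∈ U) (x y u v : Coord n) :
    riemannF γ z x y u v + riemannF γ z y u x v + riemannF γ z u x y v = 0 := by
  have hs : ∀ w x y, fderiv ℝ (connF γ) z w x y = fderiv ℝ (connF γ) z w y x := by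
    intro w x y
    rw [← fderiv_apply₂ (h.differentiableAt_connF hz),
      ← fderiv_apply₂ (h.differentiableAt_connF hz)]
    have : (fun z => connF γ z x y) =ᶠ[nhds z] fun z => connF γ z y x := by
      filter_upwards [h.isOpen.mem_nhds hz] with z' hz' using h.connF_symm hz' x y
    rw [this.fderiv_eq]
  rw [h.riemannF_eq hz, h.riemannF_eq hz, h.riemannF_eq hz]
  simp only [curvEnd, map_add, map_sub, add_apply, sub_apply]
  rw [hs y x u, hs x y u, hs u y x, h.connF_symm hz x u, h.connF_symm hz y u,
    h.connF_symm hz y x]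
  ring

/-- The classical octahedron argument: a signed sum of four cyclic identities, simplified by the two
skew symmetries. -/
theorem riemannF_pair {z : Coord n} (hz : z ∈ U) (x y u v : Coord n) :
    riemannF γ z x y u v = riemannF γ z u v x y := by
  have c := h.riemannF_cyclic hz
  have s1 := h.riemannF_skew₁₂ hz
  have s2 := h.riemannF_skew₃₄ hz
  have a1 := c x y u v
  have a2 := c y u v x
  have a3 := c u v x y
  have a4 := c v x y u
  have b1 := s2 y u x v
  have b2 := s2 u x y v
  have b3 := s1 u x v y
  have b4 := s2 u v y x
  have b5 := s1 v y u x
  have b6 := s2 y v u x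
  have b7 := s1 v x u y
  have b8 := s2 v x y u
  have b9 := s1 x y v u
  have b10 := s2 x y v u
  have b11 := s1 y v x u
  have b12 := s2 v y u x
  have b13 := s1 x v u y
  have b14 := s2 x v y u
  linarith

end SmoothMetric

end Curvature

/-! ### The Weyl, Schouten and Cotton tensors. -/

section WeylField

set_option maxSynthPendingDepth 5

variable {n : ℕ}

/-- The Schouten tensor. -/
def schoutenF (γ : Coord n → Matrix (Fin n) (Fin n) ℝ) (z : Coord n) : Form2 n :=
  (1 / ((n : ℝ) - 2)) • ricciF γ z
    - (scalar γ z / (2 * (((n : ℝ) - 1) * ((n : ℝ) - 2)))) • metricF γ z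

/-- The Cotton tensor. -/
def cotton (γ : Coord n → Matrix (Fin n) (Fin n) ℝ) (z x y u : Coord n) : ℝ :=
  cov2 (connF γ) (schoutenF γ) z x y u - cov2 (connF γ) (schoutenF γ) z y x u

theorem isLinearMap_cov2₁ (Γ : Coord n → Coord n →L[ℝ] Coord n →L[ℝ] Coord n)
    (T : Coord n → Form2 n) (z x y : Coord n) : IsLinearMap ℝ fun w => cov2 Γ T z w x y :=
  ⟨fun _ _ => by simp [cov2]; ring, fun _ _ => by simp [cov2]; ring⟩

theorem isLinearMap_cov2₂ (Γ : Coord n → Coord n →L[ℝ] Coord n →L[ℝ] Coord n)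
    (T : Coord n → Form2 n) (z w y : Coord n) : IsLinearMap ℝ fun x => cov2 Γ T z w x y :=
  ⟨fun _ _ => by simp [cov2]; ring, fun _ _ => by simp [cov2]; ring⟩

theorem isLinearMap_cov2₃ (Γ : Coord n → Coord n →L[ℝ] Coord n →L[ℝ] Coord n)
    (T : Coord n → Form2 n) (z w x : Coord n) : IsLinearMap ℝ fun y => cov2 Γ T z w x y :=
  ⟨fun _ _ => by simp [cov2]; ring, fun _ _ => by simp [cov2]; ring⟩

theorem isLinearMap_cotton₁ (γ : Coord n → Matrix (Fin n) (Fin n) ℝ) (z y u : Coord n) :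
    IsLinearMap ℝ fun x => cotton γ z x y u := by
  have l1 := isLinearMap_cov2₁ (connF γ) (schoutenF γ) z
  have l2 := isLinearMap_cov2₂ (connF γ) (schoutenF γ) z
  exact ⟨fun _ _ => by simp only [cotton, (l1 _ _).map_add, (l2 _ _).map_add]; ring,
    fun _ _ => by simp only [cotton, (l1 _ _).map_smul, (l2 _ _).map_smul, smul_eq_mul]; ring⟩

theorem isLinearMap_cotton₃ (γ : Coord n → Matrix (Fin n) (Fin n) ℝ) (z x y : Coord n) :
    IsLinearMap ℝ fun u => cotton γ z x y u := by
  have l3 := isLinearMap_cov2₃ (connF γ) (schoutenF γ) z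
  exact ⟨fun _ _ => by simp only [cotton, (l3 _ _).map_add]; ring,
    fun _ _ => by simp only [cotton, (l3 _ _).map_smul, smul_eq_mul]; ring⟩

theorem isLinearMap_contr₁ (G : Matrix (Fin n) (Fin n) ℝ) (C : Form4 n) (y : Coord n) :
    IsLinearMap ℝ fun x => contr G C x y :=
  isLinearMap_tr fun _ _ => isLinearMap_tr fun _ _ => isLinearMap_tr fun _ _ =>
    ⟨fun _ _ => by simp; ring, fun _ _ => by simp; ring⟩

theorem isLinearMap_contr₂ (G : Matrix (Fin n) (Fin n) ℝ) (C : Form4 n) (x : Coord n) :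
    IsLinearMap ℝ fun y => contr G C x y :=
  isLinearMap_tr fun _ _ => isLinearMap_tr fun _ _ => isLinearMap_tr fun _ _ =>
    ⟨fun _ _ => by simp; ring, fun _ _ => by simp; ring⟩

theorem contr_bv (γ : Coord n → Matrix (Fin n) (Fin n) ℝ) (z : Coord n) (i j : Fin n) :
    contr (γ z)⁻¹ (weylF γ z) (bv i) (bv j) = weylContr γ i j z := by
  simp only [contr, tr, weylContr, weylF, lin_bv, Finset.mul_sum]
  refine Finset.sum_congr rfl fun k _ => ?_
  have h1 : ∀ f : Fin n → Fin n → Fin n → Fin n → Fin n → ℝ,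
      ∑ l, ∑ m, ∑ p, ∑ q, ∑ r, f l m p q r = ∑ p, ∑ l, ∑ q, ∑ m, ∑ r, f l m p q r := by
    intro f
    have e1 : ∀ l, ∑ m, ∑ p, ∑ q, ∑ r, f l m p q r = ∑ p, ∑ q, ∑ m, ∑ r, f l m p q r := by
      intro l
      rw [Finset.sum_comm]
      exact Finset.sum_congr rfl fun p _ => Finset.sum_comm
    simp only [e1]
    exact Finset.sum_comm
  refine Eq.trans ?_ (h1 _).symm
  refine Finset.sum_congr rfl fun p _ => Finset.sum_congr rfl fun l _ =>
    Finset.sum_congr rfl fun q _ => Finset.sum_congr rfl fun m _ =>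
    Finset.sum_congr rfl fun r _ => ?_
  ring

theorem weylSq_eq (γ : Coord n → Matrix (Fin n) (Fin n) ℝ) (z : Coord n) :
    weylSq γ z = tr (γ z)⁻¹ (contr (γ z)⁻¹ (weylF γ z)) := by
  simp only [tr, contr_bv, weylSq]

theorem scalar_eq (γ : Coord n → Matrix (Fin n) (Fin n) ℝ) (z : Coord n) :
    scalar γ z = tr (γ z)⁻¹ (fun p q => ricciF γ z p q) := by
  simp [tr, ricciF, scalar]

namespace SmoothMetric

variable {γ : Coord n → Matrix (Fin n) (Fin n) ℝ} {U : Set (Coord n)} (h : SmoothMetric γ U)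
include h

/-- The contraction with the inverse metric undoes the lowering of the last index in `riemann`. -/
theorem ricciF_eq {z : Coord n} (hz : z ∈ U) (x y : Coord n) :
    ricciF γ z x y = -tr (γ z)⁻¹ (fun u v => riemannF γ z u x y v) := by
  have l1 : ∀ y, IsLinearMap ℝ fun x => tr (γ z)⁻¹ (fun u v => riemannF γ z u x y v) := fun y =>
    isLinearMap_tr fun _ _ => ⟨fun _ _ => by simp, fun _ _ => by simp⟩
  have l2 : ∀ x, IsLinearMap ℝ fun y => tr (γ z)⁻¹ (fun u v => riemannF γ z u x y v) := fun x =>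
    isLinearMap_tr fun _ _ => ⟨fun _ _ => by simp, fun _ _ => by simp⟩
  refine isLinearMap_ext (f := fun x => ricciF γ z x y)
    (g := fun x => -tr (γ z)⁻¹ (fun u v => riemannF γ z u x y v))
    ⟨fun _ _ => by simp, fun _ _ => by simp⟩
    ⟨fun _ _ => by simp only [(l1 _).map_add]; ring,
      fun _ _ => by simp only [(l1 _).map_smul, smul_eq_mul]; ring⟩ (fun i => ?_) x
  refine isLinearMap_ext (f := fun y => ricciF γ z (bv i) y)
    (g := fun y => -tr (γ z)⁻¹ (fun u v => riemannF γ z u (bv i) y v))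
    ⟨fun _ _ => by simp, fun _ _ => by simp⟩
    ⟨fun _ _ => by simp only [(l2 _).map_add]; ring,
      fun _ _ => by simp only [(l2 _).map_smul, smul_eq_mul]; ring⟩ (fun j => ?_) y
  simp only [ricciF, riemannF, lin_bv, tr, ricci, riemann, neg_inj]
  refine Finset.sum_congr rfl fun m _ => ?_
  simp only [Finset.mul_sum]
  rw [Finset.sum_comm]
  have : ∀ p, ∑ l, (γ z)⁻¹ m l * (riemannUp γ m i j p z * γ z p l)
      = riemannUp γ m i j p z * if m = p then 1 else 0 := by
    intro p
    have h1 := congrFun (congrFun (h.inv_mul_cancel hz) m) p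
    rw [Matrix.mul_apply, Matrix.one_apply] at h1
    rw [← h1, Finset.mul_sum]
    refine Finset.sum_congr rfl fun l _ => ?_
    rw [h.symm z hz p l]
    ring
  simp [this]

omit h in
theorem weylF_eq (z : Coord n) (x y u v : Coord n) :
    weylF γ z x y u v = riemannF γ z x y u v
    + (metricF γ z x v * ricciF γ z y u - metricF γ z y v * ricciF γ z x u
      + ricciF γ z x v * metricF γ z y u - ricciF γ z y v * metricF γ z x u) / ((n : ℝ) - 2)
    - scalar γ z * (metricF γ z x v * metricF γ z y u - metricF γ z y v * metricF γ z x u)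
      / (((n : ℝ) - 1) * ((n : ℝ) - 2)) := by
  let g := metricF γ z
  let R := ricciF γ z
  let S := scalar γ z
  let F : Coord n → Coord n → Coord n → Coord n → ℝ := fun x y u v => riemannF γ z x y u v
    + (g x v * R y u - g y v * R x u + R x v * g y u - R y v * g x u) / ((n : ℝ) - 2)
    - S * (g x v * g y u - g y v * g x u) / (((n : ℝ) - 1) * ((n : ℝ) - 2))
  change weylF γ z x y u v = F x y u v
  refine isLinearMap_ext (f := fun x => weylF γ z x y u v) (g := fun x => F x y u v)
    ⟨fun _ _ => by simp, fun _ _ => by simp⟩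
    ⟨fun _ _ => by simp [F]; ring, fun _ _ => by simp [F]; ring⟩ (fun i => ?_) x
  refine isLinearMap_ext (f := fun y => weylF γ z (bv i) y u v) (g := fun y => F (bv i) y u v)
    ⟨fun _ _ => by simp, fun _ _ => by simp⟩
    ⟨fun _ _ => by simp [F]; ring, fun _ _ => by simp [F]; ring⟩ (fun j => ?_) y
  refine isLinearMap_ext (f := fun u => weylF γ z (bv i) (bv j) u v)
    (g := fun u => F (bv i) (bv j) u v)
    ⟨fun _ _ => by simp, fun _ _ => by simp⟩
    ⟨fun _ _ => by simp [F]; ring, fun _ _ => by simp [F]; ring⟩ (fun k => ?_) u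
  refine isLinearMap_ext (f := fun v => weylF γ z (bv i) (bv j) (bv k) v)
    (g := fun v => F (bv i) (bv j) (bv k) v)
    ⟨fun _ _ => by simp, fun _ _ => by simp⟩
    ⟨fun _ _ => by simp [F]; ring, fun _ _ => by simp [F]; ring⟩ (fun l => ?_) v
  simp [F, g, R, S, weylF, riemannF, ricciF, metricF, weyl]

theorem isCurvatureAt {z : Coord n} (hz : z ∈ U) :
    IsCurvatureAt (metricF γ z) (γ z)⁻¹ (riemannF γ z) (ricciF γ z) (weylF γ z) where
  toIsMetricAt := h.isMetricAt hz
  skew₁₂ := h.riemannF_skew₁₂ hz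
  skew₃₄ := h.riemannF_skew₃₄ hz
  pair := h.riemannF_pair hz
  ricci := h.ricciF_eq hz
  weyl x y u v := by rw [← scalar_eq]; exact weylF_eq z x y u v

-- The Schouten tensor absorbs the scalar curvature term, so that a covariant derivative of `C - Rm`
-- involves ∇ of a single tensor.
omit h in
theorem weylF_eq_schouten (z : Coord n) (x y u v : Coord n) :
    weylF γ z x y u v = riemannF γ z x y u v
    + (metricF γ z x v * schoutenF γ z y u - metricF γ z y v * schoutenF γ z x u
      + schoutenF γ z x v * metricF γ z y u - schoutenF γ z y v * metricF γ z x u) := by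
  rw [weylF_eq]
  simp only [schoutenF, sub_apply, smul_apply, smul_eq_mul]
  have : ∀ s t : ℝ, s / (2 * t) = s / t / 2 := fun s t => by rw [div_div, mul_comm]
  simp only [this]
  ring

theorem smooth_schoutenF : ContDiffOn ℝ ∞ (schoutenF γ) U :=
  have h1 : ContDiffOn ℝ ∞ (fun z => (1 / ((n : ℝ) - 2)) • ricciF γ z) U :=
    h.smooth_ricciF.const_smul _
  have h2 : ContDiffOn ℝ ∞ (fun z => (scalar γ z / (2 * (((n : ℝ) - 1) * ((n : ℝ) - 2))))
      • metricF γ z) U := (h.smooth_scalar.div_const _).smul h.smooth_metricF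
  h1.sub h2

/-- This is `curvEnd_bianchi` lowered by the parallel metric. The connection terms in the first two
slots cancel in the cyclic sum, by symmetry of the connection and skewness of the curvature. -/
theorem riemannF_bianchi {z : Coord n} (hz : z ∈ U) (w x y u v : Coord n) :
    cov4 (connF γ) (riemannF γ) z w x y u v + cov4 (connF γ) (riemannF γ) z x y w u v
      + cov4 (connF γ) (riemannF γ) z y w x u v = 0 := by
  have hd : DifferentiableAt ℝ (riemannF γ) z :=
    (h.smooth_riemannF.contDiffAt (h.isOpen.mem_nhds hz)).differentiableAt (by simp)
  have hd' : DifferentiableAt ℝ (fderiv ℝ (connF γ)) z :=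
    ((h.contDiffAt_connF hz).fderiv_right (m := ∞) (by simp)).differentiableAt (by simp)
  have hΓ := h.differentiableAt_connF hz
  have hK : ∀ x y u, DifferentiableAt ℝ (fun z => curvEnd (connF γ) z x y u) z := by
    intro x y u
    have hc : ∀ x u, DifferentiableAt ℝ (fun z' => connF γ z' x u) z := fun x u =>
      (hΓ.clm_apply (differentiableAt_const _)).clm_apply (differentiableAt_const _)
    have hc' : ∀ x y u, DifferentiableAt ℝ (fun z' => fderiv ℝ (connF γ) z' x y u) z :=
      fun x y u => ((hd'.clm_apply (differentiableAt_const _)).clm_apply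
        (differentiableAt_const _)).clm_apply (differentiableAt_const _)
    have hcc : ∀ x y u, DifferentiableAt ℝ (fun z' => connF γ z' x (connF γ z' y u)) z :=
      fun x y u => (hΓ.clm_apply (differentiableAt_const _)).clm_apply (hc y u)
    exact (((hc' y x u).fun_sub (hc' x y u)).fun_add (hcc y x u)).fun_sub (hcc x y u)
  have key : ∀ w x y, fderiv ℝ (riemannF γ) z w x y u v
      = metricF γ z (connF γ z w (curvEnd (connF γ) z x y u)) v
        + metricF γ z (curvEnd (connF γ) z x y u) (connF γ z w v)
        + metricF γ z (fderiv ℝ (fun z => curvEnd (connF γ) z x y u) z w) v := by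
    intro w x y
    rw [← fderiv_apply₄ hd]
    have e : (fun z => riemannF γ z x y u v) =ᶠ[nhds z]
        fun z => metricF γ z (curvEnd (connF γ) z x y u) v := by
      filter_upwards [h.isOpen.mem_nhds hz] with z' hz' using h.riemannF_eq hz' x y u v
    have e1 := ((h.differentiableAt_metricF hz).hasFDerivAt.clm_apply
      (hK x y u).hasFDerivAt).clm_apply (hasFDerivAt_const v z)
    rw [e.fderiv_eq, e1.fderiv]
    simp
    rw [h.metric_parallel hz]
    ring
  have B := congrArg (fun k => metricF γ z k v) (curvEnd_bianchi (h.contDiffAt_connF hz) w x y u)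
  simp only [map_add, map_sub, add_apply, sub_apply, map_zero, zero_apply] at B
  have s := fun x y => h.riemannF_skew₁₂ hz x y u v
  simp only [cov4, key]
  rw [h.connF_symm hz y w, h.connF_symm hz x w, h.connF_symm hz y x, s (connF γ z w x) y,
    s (connF γ z x y) w, s (connF γ z w y) x]
  simp only [h.riemannF_eq hz]
  linear_combination B

theorem cov4_weylF {z : Coord n} (hz : z ∈ U) (w x y u v : Coord n) :
    cov4 (connF γ) (weylF γ) z w x y u v = cov4 (connF γ) (riemannF γ) z w x y u v
      + (metricF γ z x v * cov2 (connF γ) (schoutenF γ) z w y u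
        - metricF γ z y v * cov2 (connF γ) (schoutenF γ) z w x u
        + cov2 (connF γ) (schoutenF γ) z w x v * metricF γ z y u
        - cov2 (connF γ) (schoutenF γ) z w y v * metricF γ z x u) := by
  have nb := h.isOpen.mem_nhds hz
  have hC : DifferentiableAt ℝ (weylF γ) z :=
    (h.smooth_weylF.contDiffAt nb).differentiableAt (by simp)
  have hR : DifferentiableAt ℝ (riemannF γ) z :=
    (h.smooth_riemannF.contDiffAt nb).differentiableAt (by simp)
  have hS : DifferentiableAt ℝ (schoutenF γ) z :=
    (h.smooth_schoutenF.contDiffAt nb).differentiableAt (by simp)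
  have hg := h.differentiableAt_metricF hz
  have ap : ∀ {T : Coord n → Form2 n}, DifferentiableAt ℝ T z → ∀ x y,
      HasFDerivAt (fun z => T z x y) (fderiv ℝ (fun z => T z x y) z) z := fun hT x y =>
    ((hT.clm_apply (differentiableAt_const _)).clm_apply (differentiableAt_const _)).hasFDerivAt
  have ap4 : HasFDerivAt (fun z => riemannF γ z x y u v)
      (fderiv ℝ (fun z => riemannF γ z x y u v) z) z :=
    ((((hR.clm_apply (differentiableAt_const _)).clm_apply (differentiableAt_const _)).clm_apply
      (differentiableAt_const _)).clm_apply (differentiableAt_const _)).hasFDerivAt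
  have e := (ap4.fun_add (((((ap hg x v).fun_mul (ap hS y u)).fun_sub
      ((ap hg y v).fun_mul (ap hS x u))).fun_add ((ap hS x v).fun_mul (ap hg y u))).fun_sub
      ((ap hS y v).fun_mul (ap hg x u)))).fderiv
  simp only [← weylF_eq_schouten] at e
  have e' := congrArg (fun L => L w) e
  simp only [add_apply, sub_apply, smul_apply, smul_eq_mul, fderiv_apply₄ hC,
    fderiv_apply₄ hR, fderiv_apply₂ hg, fderiv_apply₂ hS, h.metric_parallel hz] at e'
  simp only [cov4, cov2, e', weylF_eq_schouten]
  ring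

/-- The differential second Bianchi identity for the Weyl tensor. -/
theorem weylF_bianchi {z : Coord n} (hz : z ∈ U) (x y w u v : Coord n) :
    cov4 (connF γ) (weylF γ) z x y w u v + cov4 (connF γ) (weylF γ) z y w x u v
      + cov4 (connF γ) (weylF γ) z w x y u v
      = (metricF γ z w u * cotton γ z x y v - metricF γ z w v * cotton γ z x y u)
        + (metricF γ z x u * cotton γ z y w v - metricF γ z x v * cotton γ z y w u)
        + (metricF γ z y u * cotton γ z w x v - metricF γ z y v * cotton γ z w x u) := by
  -- The Riemann part drops out of the cyclic sum, and the remaining Schouten derivatives combine in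
  -- pairs into Cotton tensors.
  rw [h.cov4_weylF hz, h.cov4_weylF hz, h.cov4_weylF hz]
  have := h.riemannF_bianchi hz x y w u v
  simp only [cotton]
  linear_combination this

end SmoothMetric

end WeylField

/-! ### Directional derivatives, contraction, and the recurrence of C. -/

section Recurrent

set_option maxSynthPendingDepth 5

variable {n : ℕ}

/-- `f` is differentiable at `z`, and `f'` is its derivative in the direction `w`. -/
def HasDirDeriv {E : Type*} [NormedAddCommGroup E] [NormedSpace ℝ E]
    (f : Coord n → E) (f' : E) (z w : Coord n) : Prop :=
  DifferentiableAt ℝ f z ∧ fderiv ℝ f z w = f'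

namespace HasDirDeriv

variable {f f₁ : Coord n → ℝ} {f' f₁' : ℝ} {z w : Coord n}

theorem of_differentiableAt (h : DifferentiableAt ℝ f z) :
    HasDirDeriv f (fderiv ℝ f z w) z w := ⟨h, rfl⟩

theorem add (h : HasDirDeriv f f' z w) (h₁ : HasDirDeriv f₁ f₁' z w) :
    HasDirDeriv (fun z => f z + f₁ z) (f' + f₁') z w :=
  ⟨h.1.fun_add h₁.1, by rw [fderiv_fun_add h.1 h₁.1, add_apply, h.2, h₁.2]⟩

theorem sub (h : HasDirDeriv f f' z w) (h₁ : HasDirDeriv f₁ f₁' z w) :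
    HasDirDeriv (fun z => f z - f₁ z) (f' - f₁') z w :=
  ⟨h.1.fun_sub h₁.1, by rw [fderiv_fun_sub h.1 h₁.1, sub_apply, h.2, h₁.2]⟩

theorem mul (h : HasDirDeriv f f' z w) (h₁ : HasDirDeriv f₁ f₁' z w) :
    HasDirDeriv (fun z => f z * f₁ z) (f' * f₁ z + f z * f₁') z w :=
  ⟨h.1.fun_mul h₁.1, by
    rw [fderiv_fun_mul h.1 h₁.1, add_apply, smul_apply, smul_apply, h.2, h₁.2, smul_eq_mul,
      smul_eq_mul]
    ring⟩

theorem sum {ι : Type*} {s : Finset ι} {f : ι → Coord n → ℝ} {f' : ι → ℝ}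
    (h : ∀ i ∈ s, HasDirDeriv (f i) (f' i) z w) :
    HasDirDeriv (fun z => ∑ i ∈ s, f i z) (∑ i ∈ s, f' i) z w :=
  ⟨DifferentiableAt.fun_sum fun i hi => (h i hi).1, by
    rw [fderiv_fun_sum fun i hi => (h i hi).1, sum_apply]
    exact Finset.sum_congr rfl fun i hi => (h i hi).2⟩

theorem const (c : ℝ) : HasDirDeriv (fun _ => c) 0 z w :=
  ⟨differentiableAt_const c, by simp⟩

theorem const_mul (c : ℝ) (h : HasDirDeriv f f' z w) :
    HasDirDeriv (fun z => c * f z) (c * f') z w := by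
  have := (const (z := z) (w := w) c).mul h
  rwa [zero_mul, zero_add] at this

theorem congr_of_eventuallyEq (h : HasDirDeriv f f' z w) (e : f₁ =ᶠ[nhds z] f) :
    HasDirDeriv f₁ f' z w :=
  ⟨h.1.congr_of_eventuallyEq e, by rw [e.fderiv_eq, h.2]⟩

theorem unique (h : HasDirDeriv f f' z w) (h₁ : HasDirDeriv f f₁' z w) : f' = f₁' := by
  rw [← h.2, h₁.2]

end HasDirDeriv

namespace SmoothMetric

variable {γ : Coord n → Matrix (Fin n) (Fin n) ℝ} {U : Set (Coord n)} (h : SmoothMetric γ U)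
include h

theorem hasDirDeriv_metricF {z : Coord n} (hz : z ∈ U) (w x y : Coord n) :
    HasDirDeriv (fun z => metricF γ z x y)
      (metricF γ z (connF γ z w x) y + metricF γ z x (connF γ z w y)) z w := by
  have hg := h.differentiableAt_metricF hz
  exact ⟨(hg.clm_apply (differentiableAt_const _)).clm_apply (differentiableAt_const _),
    by rw [fderiv_apply₂ hg, h.metric_parallel hz]⟩

theorem differentiableAt_inv {z : Coord n} (hz : z ∈ U) (i j : Fin n) :
    DifferentiableAt ℝ (fun z => (γ z)⁻¹ i j) z :=
  ((h.smooth_inv i j).contDiffAt (h.isOpen.mem_nhds hz)).differentiableAt (by simp)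

/-- Differentiate the identity "inverse times metric is constant", insert ∇g = 0, and multiply by
the inverse again. -/
theorem fderiv_inv {z : Coord n} (hz : z ∈ U) (w : Coord n) (i l : Fin n) :
    fderiv ℝ (fun z => (γ z)⁻¹ i l) z w
      = -∑ j, ∑ k, (γ z)⁻¹ i j * (γ z)⁻¹ k l
        * (metricF γ z (connF γ z w (bv j)) (bv k) + metricF γ z (bv j) (connF γ z w (bv k))) := by
  have key : ∀ k, ∑ j, (fderiv ℝ (fun z => (γ z)⁻¹ i j) z w * γ z j k + (γ z)⁻¹ i j *
      (metricF γ z (connF γ z w (bv j)) (bv k) + metricF γ z (bv j) (connF γ z w (bv k)))) = 0 := by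
    intro k
    have h1 : HasDirDeriv (fun z => ∑ j, (γ z)⁻¹ i j * metricF γ z (bv j) (bv k)) _ z w :=
      HasDirDeriv.sum fun j _ => (HasDirDeriv.of_differentiableAt
        (h.differentiableAt_inv hz i j)).mul (h.hasDirDeriv_metricF hz w (bv j) (bv k))
    have h2 := (HasDirDeriv.const (z := z) (w := w) (if i = k then (1 : ℝ) else 0)).congr_of_eventuallyEq
      (f₁ := fun z => ∑ j, (γ z)⁻¹ i j * metricF γ z (bv j) (bv k)) (by
        filter_upwards [h.isOpen.mem_nhds hz] with z' hz' using (h.isMetricAt hz').inv i k)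
    simpa only [metricF_bv] using h1.unique h2
  have e : ∑ k, (∑ j, (fderiv ℝ (fun z => (γ z)⁻¹ i j) z w * γ z j k + (γ z)⁻¹ i j *
      (metricF γ z (connF γ z w (bv j)) (bv k) + metricF γ z (bv j) (connF γ z w (bv k)))))
        * (γ z)⁻¹ k l = 0 := by
    simp only [key, zero_mul, Finset.sum_const_zero]
  simp only [Finset.sum_add_distrib, add_mul, Finset.sum_mul] at e
  have e1 : ∑ k, ∑ j, fderiv ℝ (fun z => (γ z)⁻¹ i j) z w * γ z j k * (γ z)⁻¹ k l
      = fderiv ℝ (fun z => (γ z)⁻¹ i l) z w := by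
    rw [Finset.sum_comm]
    have : ∀ j, ∑ k, fderiv ℝ (fun z => (γ z)⁻¹ i j) z w * γ z j k * (γ z)⁻¹ k l
        = fderiv ℝ (fun z => (γ z)⁻¹ i j) z w * if j = l then 1 else 0 := by
      intro j
      have h1 := congrFun (congrFun (h.mul_inv_cancel hz) j) l
      rw [Matrix.mul_apply, Matrix.one_apply] at h1
      rw [← h1, Finset.mul_sum]
      exact Finset.sum_congr rfl fun _ _ => by ring
    simp [this]
  rw [e1, Finset.sum_comm] at e
  rw [eq_neg_of_add_eq_zero_left e]
  congr 1
  exact Finset.sum_congr rfl fun j _ => Finset.sum_congr rfl fun k _ => by ring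

/-- Contraction with the metric commutes with covariant differentiation. -/
theorem hasDirDeriv_tr {z : Coord n} (hz : z ∈ U) {w : Coord n}
    {B : Coord n → Coord n → Coord n → ℝ} {B' : Coord n → Coord n → ℝ}
    (hB : ∀ u v, HasDirDeriv (fun z => B z u v) (B' u v) z w)
    (l₁ : ∀ v, IsLinearMap ℝ fun u => B z u v) (l₂ : ∀ u, IsLinearMap ℝ fun v => B z u v) :
    HasDirDeriv (fun z => tr (γ z)⁻¹ (B z))
      (tr (γ z)⁻¹ fun u v => B' u v - B z (connF γ z w u) v - B z u (connF γ z w v)) z w := by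
  have h1 : HasDirDeriv (fun z => tr (γ z)⁻¹ (B z)) _ z w :=
    HasDirDeriv.sum fun i _ => HasDirDeriv.sum fun j _ => (HasDirDeriv.of_differentiableAt
      (h.differentiableAt_inv hz i j)).mul (hB (bv i) (bv j))
  convert h1 using 1
  have hm := h.isMetricAt hz
  simp only [Finset.sum_add_distrib, tr_sub]
  -- The derivative of the inverse metric supplies exactly the two connection terms that turn `B'`
  -- into a covariant derivative.
  have e : ∑ i, ∑ l, fderiv ℝ (fun z => (γ z)⁻¹ i l) z w * B z (bv i) (bv l)
      = -tr (γ z)⁻¹ fun u v => tr (γ z)⁻¹ fun p q => B z u q * (metricF γ z (connF γ z w v) p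
        + metricF γ z v (connF γ z w p)) := by
    simp only [h.fderiv_inv hz, tr, neg_mul, Finset.sum_neg_distrib, neg_inj, Finset.sum_mul,
      Finset.mul_sum]
    refine Finset.sum_congr rfl fun i _ => ?_
    rw [Finset.sum_comm]
    refine Finset.sum_congr rfl fun j _ => ?_
    rw [Finset.sum_comm]
    exact Finset.sum_congr rfl fun k _ => Finset.sum_congr rfl fun l _ => by ring
  have e1 : tr (γ z)⁻¹ (fun u v => tr (γ z)⁻¹ fun p q => B z u q * metricF γ z (connF γ z w v) p)
      = tr (γ z)⁻¹ fun u v => B z u (connF γ z w v) := by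
    congr 1; funext u v
    exact hm.tr_metric_left' _ (l₂ u)
  have e2 : tr (γ z)⁻¹ (fun u v => tr (γ z)⁻¹ fun p q => B z u q * metricF γ z v (connF γ z w p))
      = tr (γ z)⁻¹ fun u v => B z (connF γ z w u) v := by
    rw [tr_tr_comm]
    congr 1; funext p q
    exact hm.tr_metric_right _ (l₁ q)
  simp only [mul_add, tr_add, e1, e2] at e
  rw [e]
  simp only [tr]
  ring

end SmoothMetric

/-- The covector field with given components. -/
def covecF (α : Coord n → Fin n → ℝ) (z : Coord n) : Form1 n := lin (α z)

/-- A conformally recurrent metric in a coordinate domain. -/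
structure Recurrent (γ : Coord n → Matrix (Fin n) (Fin n) ℝ) (α : Coord n → Fin n → ℝ)
    (U : Set (Coord n)) : Prop extends SmoothMetric γ U where
  five_le : 5 ≤ n
  covWeyl_eq : ∀ z ∈ U, ∀ i j k l m, covWeyl γ i j k l m z = α z i * weyl γ j k l m z
  weylSq_ne_zero : ∀ z ∈ U, weylSq γ z ≠ 0

namespace Recurrent

variable {γ : Coord n → Matrix (Fin n) (Fin n) ℝ} {α : Coord n → Fin n → ℝ}
  {U : Set (Coord n)} (h : Recurrent γ α U)
include h

theorem differentiableAt_weylF {z : Coord n} (hz : z ∈ U) : DifferentiableAt ℝ (weylF γ) z :=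
  (h.smooth_weylF.contDiffAt (h.isOpen.mem_nhds hz)).differentiableAt (by simp)

theorem isWeylAt {z : Coord n} (hz : z ∈ U) :
    IsWeylAt (metricF γ z) (γ z)⁻¹ (weylF γ z) := (h.isCurvatureAt hz).isWeylAt h.five_le

theorem cov4_weylF_eq {z : Coord n} (hz : z ∈ U) (w x y u v : Coord n) :
    cov4 (connF γ) (weylF γ) z w x y u v = covecF α z w * weylF γ z x y u v := by
  refine isLinearMap_ext (f := fun w => cov4 (connF γ) (weylF γ) z w x y u v)
    (g := fun w => covecF α z w * weylF γ z x y u v)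
    ⟨fun _ _ => by simp [cov4]; ring, fun _ _ => by simp [cov4]; ring⟩
    ⟨fun _ _ => by simp; ring, fun _ _ => by simp; ring⟩ (fun i => ?_) w
  refine isLinearMap_ext (f := fun x => cov4 (connF γ) (weylF γ) z (bv i) x y u v)
    (g := fun x => covecF α z (bv i) * weylF γ z x y u v)
    ⟨fun _ _ => by simp [cov4]; ring, fun _ _ => by simp [cov4]; ring⟩
    ⟨fun _ _ => by simp; ring, fun _ _ => by simp; ring⟩ (fun j => ?_) x
  refine isLinearMap_ext (f := fun y => cov4 (connF γ) (weylF γ) z (bv i) (bv j) y u v)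
    (g := fun y => covecF α z (bv i) * weylF γ z (bv j) y u v)
    ⟨fun _ _ => by simp [cov4]; ring, fun _ _ => by simp [cov4]; ring⟩
    ⟨fun _ _ => by simp; ring, fun _ _ => by simp; ring⟩ (fun k => ?_) y
  refine isLinearMap_ext (f := fun u => cov4 (connF γ) (weylF γ) z (bv i) (bv j) (bv k) u v)
    (g := fun u => covecF α z (bv i) * weylF γ z (bv j) (bv k) u v)
    ⟨fun _ _ => by simp [cov4]; ring, fun _ _ => by simp [cov4]; ring⟩
    ⟨fun _ _ => by simp; ring, fun _ _ => by simp; ring⟩ (fun l => ?_) u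
  refine isLinearMap_ext (f := fun v => cov4 (connF γ) (weylF γ) z (bv i) (bv j) (bv k) (bv l) v)
    (g := fun v => covecF α z (bv i) * weylF γ z (bv j) (bv k) (bv l) v)
    ⟨fun _ _ => by simp [cov4]; ring, fun _ _ => by simp [cov4]; ring⟩
    ⟨fun _ _ => by simp; ring, fun _ _ => by simp; ring⟩ (fun m => ?_) v
  have := h.covWeyl_eq z hz i j k l m
  unfold covWeyl pd at this
  have e : (fun z => weylF γ z (bv j) (bv k) (bv l) (bv m)) = weyl γ j k l m := by
    funext z'; simp [weylF]
  rw [cov4, ← fderiv_apply₄ (h.differentiableAt_weylF hz), e]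
  simp only [connF, lin_bv, map_sum, map_smul, sum_apply, smul_apply, smul_eq_mul, weylF, covecF]
  rw [← this]
  simp only [Finset.sum_add_distrib]
  ring

theorem hasDirDeriv_weylF {z : Coord n} (hz : z ∈ U) (w x y u v : Coord n) :
    HasDirDeriv (fun z => weylF γ z x y u v)
      (covecF α z w * weylF γ z x y u v + weylF γ z (connF γ z w x) y u v
        + weylF γ z x (connF γ z w y) u v + weylF γ z x y (connF γ z w u) v
        + weylF γ z x y u (connF γ z w v)) z w := by
  have hC := h.differentiableAt_weylF hz
  refine ⟨(((hC.clm_apply (differentiableAt_const _)).clm_apply (differentiableAt_const _)).clm_apply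
    (differentiableAt_const _)).clm_apply (differentiableAt_const _), ?_⟩
  rw [fderiv_apply₄ hC, ← h.cov4_weylF_eq hz, cov4]
  ring

/-- Each of the two factors `C` contributes one `α`, whence the 2. The connection terms in the
contracted slots are absorbed by `hasDirDeriv_tr`, and only those in the free slots `x`, `y` remain.
-/
theorem hasDirDeriv_contr {z : Coord n} (hz : z ∈ U) (w x y : Coord n) :
    HasDirDeriv (fun z => contr (γ z)⁻¹ (weylF γ z) x y)
      (2 * covecF α z w * contr (γ z)⁻¹ (weylF γ z) x y
        + contr (γ z)⁻¹ (weylF γ z) (connF γ z w x) y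
        + contr (γ z)⁻¹ (weylF γ z) x (connF γ z w y)) z w := by
  have d1 : ∀ k p l q, HasDirDeriv (fun z => tr (γ z)⁻¹ fun m r =>
      weylF γ z x p q r * weylF γ z y k l m) _ z w := fun k p l q =>
    h.hasDirDeriv_tr hz (B := fun z m r => weylF γ z x p q r * weylF γ z y k l m)
      (fun m r => (h.hasDirDeriv_weylF hz w x p q r).mul (h.hasDirDeriv_weylF hz w y k l m))
      (fun _ => ⟨fun _ _ => by simp; ring, fun _ _ => by simp; ring⟩)
      (fun _ => ⟨fun _ _ => by simp; ring, fun _ _ => by simp; ring⟩)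
  have d2 : ∀ k p, HasDirDeriv (fun z => tr (γ z)⁻¹ fun l q => tr (γ z)⁻¹ fun m r =>
      weylF γ z x p q r * weylF γ z y k l m) _ z w := fun k p =>
    h.hasDirDeriv_tr hz (B := fun z l q => tr (γ z)⁻¹ fun m r =>
      weylF γ z x p q r * weylF γ z y k l m) (fun l q => d1 k p l q)
      (fun _ => isLinearMap_tr fun _ _ => ⟨fun _ _ => by simp; ring, fun _ _ => by simp; ring⟩)
      (fun _ => isLinearMap_tr fun _ _ => ⟨fun _ _ => by simp; ring, fun _ _ => by simp; ring⟩)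
  have d3 : HasDirDeriv (fun z => tr (γ z)⁻¹ fun k p => tr (γ z)⁻¹ fun l q => tr (γ z)⁻¹ fun m r =>
      weylF γ z x p q r * weylF γ z y k l m) _ z w :=
    h.hasDirDeriv_tr hz (B := fun z k p => tr (γ z)⁻¹ fun l q => tr (γ z)⁻¹ fun m r =>
      weylF γ z x p q r * weylF γ z y k l m) (fun k p => d2 k p)
      (fun _ => isLinearMap_tr fun _ _ => isLinearMap_tr fun _ _ =>
        ⟨fun _ _ => by simp; ring, fun _ _ => by simp; ring⟩)
      (fun _ => isLinearMap_tr fun _ _ => isLinearMap_tr fun _ _ =>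
        ⟨fun _ _ => by simp; ring, fun _ _ => by simp; ring⟩)
  unfold contr
  convert d3 using 1
  rw [← tr_mul_left, ← tr_add, ← tr_add]
  congr 1; funext k p
  rw [← tr_mul_left, ← tr_add, ← tr_add, ← tr_sub, ← tr_sub]
  congr 1; funext l q
  rw [← tr_mul_left, ← tr_add, ← tr_add, ← tr_sub, ← tr_sub, ← tr_sub, ← tr_sub]
  congr 1; funext m r
  ring

end Recurrent

end Recurrent

/-! ### Consequences of recurrence: α is smooth, h is parallel, ∇α satisfies the Bianchi relation.
-/

section RecurrentCalculus

set_option maxSynthPendingDepth 5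

variable {n : ℕ}

/-- The triple contraction of the Weyl tensor as a field of bilinear forms. -/
def contrF (γ : Coord n → Matrix (Fin n) (Fin n) ℝ) (z : Coord n) : Form2 n :=
  lin fun i => lin fun j => weylContr γ i j z

theorem contrF_eq (γ : Coord n → Matrix (Fin n) (Fin n) ℝ) (z x y : Coord n) :
    contrF γ z x y = contr (γ z)⁻¹ (weylF γ z) x y := by
  refine isLinearMap_ext (f := fun x => contrF γ z x y)
    (g := fun x => contr (γ z)⁻¹ (weylF γ z) x y)
    ⟨fun _ _ => by simp, fun _ _ => by simp⟩ (isLinearMap_contr₁ _ _ _) (fun i => ?_) x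
  refine isLinearMap_ext (f := fun y => contrF γ z (bv i) y)
    (g := fun y => contr (γ z)⁻¹ (weylF γ z) (bv i) y)
    ⟨fun _ _ => by simp, fun _ _ => by simp⟩ (isLinearMap_contr₂ _ _ _) (fun j => ?_) y
  rw [contr_bv]
  simp [contrF]

/-- The covariant derivative of a covector field, as a covector. -/
def nabla (γ : Coord n → Matrix (Fin n) (Fin n) ℝ) (α : Coord n → Fin n → ℝ) (z w : Coord n) :
    Form1 n := fderiv ℝ (covecF α) z w - (covecF α z).comp (connF γ z w)

/-- The vector field obtained by raising the index of a covector field. -/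
def sharpF (γ : Coord n → Matrix (Fin n) (Fin n) ℝ) (α : Coord n → Fin n → ℝ) (z : Coord n) :
    Coord n := sharp (γ z)⁻¹ (covecF α z)

namespace SmoothMetric

variable {γ : Coord n → Matrix (Fin n) (Fin n) ℝ} {U : Set (Coord n)} (h : SmoothMetric γ U)
include h

theorem smooth_weylContr (i j : Fin n) : ContDiffOn ℝ ∞ (weylContr γ i j) U := by
  unfold weylContr
  have hi := h.smooth_inv
  have hw := h.smooth_weyl
  exact ContDiffOn.sum fun k _ => ContDiffOn.sum fun l _ => ContDiffOn.sum fun m _ =>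
    ContDiffOn.sum fun p _ => ContDiffOn.sum fun q _ => ContDiffOn.sum fun r _ =>
    ((((hi _ _).mul (hi _ _)).mul (hi _ _)).mul (hw _ _ _ _)).mul (hw _ _ _ _)

theorem smooth_weylSq : ContDiffOn ℝ ∞ (weylSq γ) U := by
  unfold weylSq
  exact ContDiffOn.sum fun k _ => ContDiffOn.sum fun l _ =>
    (h.smooth_inv _ _).mul (h.smooth_weylContr _ _)

theorem smooth_contrF : ContDiffOn ℝ ∞ (contrF γ) U :=
  contDiffOn_lin fun _ => contDiffOn_lin fun _ => h.smooth_weylContr _ _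

end SmoothMetric

namespace Recurrent

variable {γ : Coord n → Matrix (Fin n) (Fin n) ℝ} {α : Coord n → Fin n → ℝ}
  {U : Set (Coord n)} (h : Recurrent γ α U)
include h

theorem hasDirDeriv_weylSq {z : Coord n} (hz : z ∈ U) (w : Coord n) :
    HasDirDeriv (weylSq γ) (2 * covecF α z w * weylSq γ z) z w := by
  have e : weylSq γ = fun z => tr (γ z)⁻¹ (contr (γ z)⁻¹ (weylF γ z)) := funext (weylSq_eq γ)
  rw [e]
  convert h.hasDirDeriv_tr hz (B := fun z => contr (γ z)⁻¹ (weylF γ z))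
    (fun u v => h.hasDirDeriv_contr hz w u v) (isLinearMap_contr₁ _ _) (isLinearMap_contr₂ _ _)
    using 1
  rw [← tr_mul_left]
  congr 1; funext u v
  ring

/-- No regularity of `α` is assumed. It is recovered as half the logarithmic differential of C²,
which is smooth and nowhere zero. -/
theorem smooth_covecF : ContDiffOn ℝ ∞ (covecF α) U := by
  have h1 : ContDiffOn ℝ ∞ (fun z => (2 * weylSq γ z)⁻¹ • fderiv ℝ (weylSq γ) z) U :=
    ((contDiffOn_const.mul h.smooth_weylSq).inv fun z hz =>
      mul_ne_zero two_ne_zero (h.weylSq_ne_zero z hz)).smul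
      (h.smooth_weylSq.fderiv_of_isOpen h.isOpen (m := ∞) (by simp))
  refine h1.congr fun z hz => ContinuousLinearMap.ext fun w => ?_
  have hne := h.weylSq_ne_zero z hz
  rw [smul_apply, (h.hasDirDeriv_weylSq hz w).2, smul_eq_mul]
  field_simp

theorem cotton_tr_and_eq {z : Coord n} (hz : z ∈ U) :
    (∀ x, tr (γ z)⁻¹ (fun y u => cotton γ z x y u) = 0) ∧
      ∀ x y u, ((n : ℝ) - 3) * cotton γ z x y u = -weylF γ z x y u (sharpF γ α z) := by
  refine (h.isWeylAt hz).cotton_eq h.five_le (a := covecF α z) (Y := cotton γ z)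
    (isLinearMap_cotton₁ γ z) (isLinearMap_cotton₃ γ z) (fun x y u => ?_) fun x y w u v => ?_
  · simp only [cotton]; ring
  · simp only [← h.cov4_weylF_eq hz]
    exact h.weylF_bianchi hz x y w u v

/-- The Cotton tensor found by `cotton_tr_and_eq` is put back into the Bianchi identity from which
it came. -/
theorem bianchiC {z : Coord n} (hz : z ∈ U) :
    BianchiC (metricF γ z) (γ z)⁻¹ (weylF γ z) (covecF α z) := by
  intro x y w u v
  have hY := (h.cotton_tr_and_eq hz).2
  have hB := h.weylF_bianchi hz x y w u v
  simp only [h.cov4_weylF_eq hz] at hB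
  simp only [sharpF] at hY
  rw [hB]
  linear_combination metricF γ z w u * hY x y v - metricF γ z w v * hY x y u
    + metricF γ z x u * hY y w v - metricF γ z x v * hY y w u
    + metricF γ z y u * hY w x v - metricF γ z y v * hY w x u

/-- Numerator and denominator of h are both recurrent with covector 2α, so the quotient has zero
covariant derivative. -/
theorem contr_parallel {z : Coord n} (hz : z ∈ U) (w x y : Coord n) :
    cov2 (connF γ) (fun z => (weylSq γ z)⁻¹ • contrF γ z) z w x y = 0 := by
  have nb := h.isOpen.mem_nhds hz
  have hne := h.weylSq_ne_zero z hz
  have hd : DifferentiableAt ℝ (fun z => (weylSq γ z)⁻¹ • contrF γ z) z :=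
    (((h.smooth_weylSq.contDiffAt nb).inv hne).smul
      (h.smooth_contrF.contDiffAt nb)).differentiableAt (by simp)
  have h1 : HasDirDeriv (fun z => weylSq γ z * (((weylSq γ z)⁻¹ • contrF γ z) x y)) _ z w :=
    (h.hasDirDeriv_weylSq hz w).mul (HasDirDeriv.of_differentiableAt
      ((hd.clm_apply (differentiableAt_const _)).clm_apply (differentiableAt_const _)))
  have h2 := (h.hasDirDeriv_contr hz w x y).congr_of_eventuallyEq
    (f₁ := fun z => weylSq γ z * (((weylSq γ z)⁻¹ • contrF γ z) x y)) (by
      filter_upwards [nb] with z' hz'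
      have := h.weylSq_ne_zero z' hz'
      rw [smul_apply, smul_apply, smul_eq_mul, contrF_eq]
      field_simp)
  have e := h1.unique h2
  rw [fderiv_apply₂ hd] at e
  simp only [cov2, smul_apply, smul_eq_mul, contrF_eq] at e ⊢
  refine mul_left_cancel₀ hne ?_
  field_simp at e ⊢
  linear_combination e

/-- The Ricci identity for the parallel tensor h, multiplied by C². -/
theorem contr_curvEnd {z : Coord n} (hz : z ∈ U) (x y u v : Coord n) :
    contr (γ z)⁻¹ (weylF γ z) (curvEnd (connF γ) z x y u) v
      + contr (γ z)⁻¹ (weylF γ z) u (curvEnd (connF γ) z x y v) = 0 := by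
  have nb := h.isOpen.mem_nhds hz
  have hne := h.weylSq_ne_zero z hz
  have := curvEnd_of_parallel (T := fun z => (weylSq γ z)⁻¹ • contrF γ z)
    (h.differentiableAt_connF hz) (((h.smooth_weylSq.contDiffAt nb).inv hne).smul
      (h.smooth_contrF.contDiffAt nb)) (by
        filter_upwards [nb] with z' hz' using h.contr_parallel hz') x y u v
  simp only [smul_apply, smul_eq_mul, contrF_eq] at this
  field_simp at this
  linarith

theorem differentiableAt_covecF {z : Coord n} (hz : z ∈ U) : DifferentiableAt ℝ (covecF α) z :=
  (h.smooth_covecF.contDiffAt (h.isOpen.mem_nhds hz)).differentiableAt (by simp)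

theorem smooth_sharpF : ContDiffOn ℝ ∞ (sharpF γ α) U := by
  unfold sharpF sharp
  exact ContDiffOn.sum fun i _ => ContDiffOn.sum fun j _ => ((h.smooth_inv i j).mul
    (h.smooth_covecF.clm_apply contDiffOn_const)).smul contDiffOn_const

theorem differentiableAt_sharpF {z : Coord n} (hz : z ∈ U) : DifferentiableAt ℝ (sharpF γ α) z :=
  (h.smooth_sharpF.contDiffAt (h.isOpen.mem_nhds hz)).differentiableAt (by simp)

theorem metric_sharpF {z : Coord n} (hz : z ∈ U) (x : Coord n) :
    metricF γ z (sharpF γ α z) x = covecF α z x := (h.isMetricAt hz).apply_sharp _ _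

theorem fderiv_sharpF {z : Coord n} (hz : z ∈ U) (w : Coord n) :
    fderiv ℝ (sharpF γ α) z w
      = sharp (γ z)⁻¹ (nabla γ α z w) - connF γ z w (sharpF γ α z) := by
  have hm := h.isMetricAt hz
  refine hm.eq_of_forall fun x => ?_
  have e : (fun z => metricF γ z (sharpF γ α z) x) =ᶠ[nhds z] fun z => covecF α z x := by
    filter_upwards [h.isOpen.mem_nhds hz] with z' hz' using h.metric_sharpF hz' x
  have h1 := ((h.differentiableAt_metricF hz).hasFDerivAt.clm_apply
    (h.differentiableAt_sharpF hz).hasFDerivAt).clm_apply (hasFDerivAt_const x z)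
  have h2 := e.fderiv_eq (𝕜 := ℝ)
  rw [h1.fderiv] at h2
  have h3 := congrArg (fun L => L w) h2
  simp only [fderiv_apply_const (h.differentiableAt_covecF hz)] at h3
  simp at h3
  rw [h.metric_parallel hz, h.metric_sharpF hz] at h3
  rw [map_sub, sub_apply, hm.apply_sharp]
  simp only [nabla, sub_apply, ContinuousLinearMap.comp_apply]
  linarith

theorem hasDirDeriv_covecF {z : Coord n} (hz : z ∈ U) (w x : Coord n) :
    HasDirDeriv (fun z => covecF α z x) (nabla γ α z w x + covecF α z (connF γ z w x)) z w := by
  have hd := h.differentiableAt_covecF hz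
  refine ⟨hd.clm_apply (differentiableAt_const _), ?_⟩
  rw [fderiv_apply_const hd]
  simp [nabla]

theorem hasDirDeriv_weylF_sharpF {z : Coord n} (hz : z ∈ U) (w x y u : Coord n) :
    HasDirDeriv (fun z => weylF γ z x y u (sharpF γ α z))
      (covecF α z w * weylF γ z x y u (sharpF γ α z)
        + weylF γ z (connF γ z w x) y u (sharpF γ α z)
        + weylF γ z x (connF γ z w y) u (sharpF γ α z)
        + weylF γ z x y (connF γ z w u) (sharpF γ α z)
        + weylF γ z x y u (sharp (γ z)⁻¹ (nabla γ α z w))) z w := by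
  have hC := h.differentiableAt_weylF hz
  have hc : DifferentiableAt ℝ (fun z => weylF γ z x y u) z :=
    ((hC.clm_apply (differentiableAt_const _)).clm_apply (differentiableAt_const _)).clm_apply
      (differentiableAt_const _)
  have hs := h.differentiableAt_sharpF hz
  refine ⟨hc.clm_apply hs, ?_⟩
  rw [(hc.hasFDerivAt.clm_apply hs.hasFDerivAt).fderiv]
  simp only [add_apply, ContinuousLinearMap.comp_apply, ContinuousLinearMap.flip_apply,
    h.fderiv_sharpF hz, map_sub]
  rw [← fderiv_apply_const hc, (h.hasDirDeriv_weylF hz w x y u (sharpF γ α z)).2]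
  ring

set_option maxHeartbeats 2000000 in
/-- Every covariant derivative of the recurrence covector satisfies the same algebraic identity
as the recurrence covector itself. -/
theorem bianchiC_nabla {z : Coord n} (hz : z ∈ U) (w : Coord n) :
    BianchiC (metricF γ z) (γ z)⁻¹ (weylF γ z) (nabla γ α z w) := by
  intro x y t u v
  have dg := fun x y => h.hasDirDeriv_metricF hz w x y
  have da := fun x => h.hasDirDeriv_covecF hz w x
  have dC := fun x y u v => h.hasDirDeriv_weylF hz w x y u v
  have dD := fun x y u => h.hasDirDeriv_weylF_sharpF hz w x y u
  have L := ((((da x).mul (dC y t u v)).add ((da y).mul (dC t x u v))).add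
    ((da t).mul (dC x y u v))).const_mul ((n : ℝ) - 3)
  have R := ((((dg t v).mul (dD x y u)).sub ((dg t u).mul (dD x y v))).add
    (((dg x v).mul (dD y t u)).sub ((dg x u).mul (dD y t v)))).add
    (((dg y v).mul (dD t x u)).sub ((dg y u).mul (dD t x v)))
  have B := fun (z' : Coord n) (hz' : z' ∈ U) => h.bianchiC hz'
  simp only [BianchiC] at B
  -- Differentiate `bianchiC` along `w`. The connection terms reproduce the identity with one
  -- argument replaced (`b1` to `b5`), the recurrence of `C` reproduces it times `α w` (`b0`), and
  -- the derivative of `α` is what remains.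
  have e := L.unique (R.congr_of_eventuallyEq (by
    filter_upwards [h.isOpen.mem_nhds hz] with z' hz' using B z' hz' x y t u v))
  have b0 := B z hz x y t u v
  have b1 := B z hz (connF γ z w x) y t u v
  have b2 := B z hz x (connF γ z w y) t u v
  have b3 := B z hz x y (connF γ z w t) u v
  have b4 := B z hz x y t (connF γ z w u) v
  have b5 := B z hz x y t u (connF γ z w v)
  simp only [sharpF] at e
  linear_combination e - covecF α z w * b0 - b1 - b2 - b3 - b4 - b5

end Recurrent

end RecurrentCalculus

/-! ### The direction of α is not parallel on any open set where α² ≠ 0. -/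

section ParallelDirection

set_option maxSynthPendingDepth 5

variable {n : ℕ}

namespace Recurrent

variable {γ : Coord n → Matrix (Fin n) (Fin n) ℝ} {α : Coord n → Fin n → ℝ}
  {U : Set (Coord n)} (h : Recurrent γ α U)
include h

theorem covecF_sharp_comm {z : Coord n} (hz : z ∈ U) (b : Form1 n) :
    covecF α z (sharp (γ z)⁻¹ b) = b (sharpF γ α z) :=
  (h.isMetricAt hz).sharp_comm _ _

theorem hasDirDeriv_covecF_sharpF {z : Coord n} (hz : z ∈ U) (w : Coord n) :
    HasDirDeriv (fun z => covecF α z (sharpF γ α z)) (2 * nabla γ α z w (sharpF γ α z)) z w := by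
  have ha := h.differentiableAt_covecF hz
  have hs := h.differentiableAt_sharpF hz
  refine ⟨ha.clm_apply hs, ?_⟩
  rw [(ha.hasFDerivAt.clm_apply hs.hasFDerivAt).fderiv]
  simp only [add_apply, ContinuousLinearMap.comp_apply, ContinuousLinearMap.flip_apply,
    h.fderiv_sharpF hz, map_sub, h.covecF_sharp_comm hz, nabla, sub_apply]
  ring

theorem hasDirDeriv_elec {z : Coord n} (hz : z ∈ U) (w x u : Coord n) :
    HasDirDeriv (fun z => elec (weylF γ z) (sharpF γ α z) x u)
      (covecF α z w * elec (weylF γ z) (sharpF γ α z) x u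
        + elec (weylF γ z) (sharpF γ α z) (connF γ z w x) u
        + elec (weylF γ z) (sharpF γ α z) x (connF γ z w u)
        + weylF γ z x (sharp (γ z)⁻¹ (nabla γ α z w)) u (sharpF γ α z)
        + weylF γ z x (sharpF γ α z) u (sharp (γ z)⁻¹ (nabla γ α z w))) z w := by
  have hC := h.differentiableAt_weylF hz
  have hs := h.differentiableAt_sharpF hz
  have hc : DifferentiableAt ℝ (fun z => weylF γ z x) z := hC.clm_apply (differentiableAt_const _)
  refine ⟨((hc.clm_apply hs).clm_apply (differentiableAt_const _)).clm_apply hs, ?_⟩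
  have e := (((hC.hasFDerivAt.clm_apply (hasFDerivAt_const x z)).clm_apply hs.hasFDerivAt).clm_apply
    (hasFDerivAt_const u z)).clm_apply hs.hasFDerivAt
  unfold elec
  rw [e.fderiv]
  have e4 := h.cov4_weylF_eq hz w x (sharpF γ α z) u (sharpF γ α z)
  rw [cov4] at e4
  simp only [add_apply, ContinuousLinearMap.comp_apply, ContinuousLinearMap.flip_apply,
    h.fderiv_sharpF hz, map_sub, sub_apply, zero_apply, map_zero]
  linear_combination e4

/-- If the covariant derivative of the recurrence covector is proportional to the recurrence
covector, so that its direction is parallel, then it is annihilated by the Riemann tensor. -/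
theorem riemannF_sharpF_of_parallel {z : Coord n} (hz : z ∈ U)
    (hN : covecF α z (sharpF γ α z) ≠ 0)
    (hp : ∀ᶠ z' in nhds z, ∀ w, ∃ θ : ℝ, nabla γ α z' w = θ • covecF α z') (x y u : Coord n) :
    riemannF γ z x y u (sharpF γ α z) = 0 := by
  let N := fun z => covecF α z (sharpF γ α z)
  -- The projection α⊗α/N does not see the scale of α, so it is parallel when only the direction of
  -- α is.
  let T : Coord n → Form2 n := fun z => (N z)⁻¹ • (covecF α z).smulRight (covecF α z)
  have hNs : ContDiffOn ℝ ∞ N U := h.smooth_covecF.clm_apply h.smooth_sharpF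
  have hTs : ∀ z ∈ U, N z ≠ 0 → ContDiffAt ℝ ∞ T z := fun z hz hN =>
    have nb := h.isOpen.mem_nhds hz
    ((hNs.contDiffAt nb).inv hN).smul
      ((h.smooth_covecF.contDiffAt nb).smulRight (h.smooth_covecF.contDiffAt nb))
  have nb := h.isOpen.mem_nhds hz
  have evN : ∀ᶠ z' in nhds z, N z' ≠ 0 := (hNs.contDiffAt nb).continuousAt.eventually_ne hN
  have par : ∀ᶠ z' in nhds z, ∀ w x v, cov2 (connF γ) T z' w x v = 0 := by
    filter_upwards [nb, evN, hp] with z hz hN hp w x v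
    obtain ⟨θ, hθ⟩ := hp w
    have hd : DifferentiableAt ℝ T z := (hTs z hz hN).differentiableAt (by simp)
    have h1 : HasDirDeriv (fun z => N z * T z x v) _ z w :=
      (h.hasDirDeriv_covecF_sharpF hz w).mul (HasDirDeriv.of_differentiableAt
        ((hd.clm_apply (differentiableAt_const _)).clm_apply (differentiableAt_const _)))
    have h2 := ((h.hasDirDeriv_covecF hz w x).mul (h.hasDirDeriv_covecF hz w v)).congr_of_eventuallyEq
      (f₁ := fun z => N z * T z x v) (by
        filter_upwards [(hNs.contDiffAt (h.isOpen.mem_nhds hz)).continuousAt.eventually_ne hN]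
          with z' hz'
        simp only [T, smul_apply, ContinuousLinearMap.smulRight_apply, smul_eq_mul]
        field_simp)
    have e := h1.unique h2
    rw [fderiv_apply₂ hd, hθ] at e
    have hN' : covecF α z (sharpF γ α z) ≠ 0 := hN
    simp only [cov2, T, N, smul_apply, ContinuousLinearMap.smulRight_apply, smul_eq_mul] at e ⊢
    refine mul_left_cancel₀ hN' ?_
    field_simp at e ⊢
    linear_combination e
  have key := curvEnd_of_parallel (h.differentiableAt_connF hz) (hTs z hz hN) par
  rw [h.riemannF_eq hz, (h.isMetricAt hz).symm, h.metric_sharpF hz]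
  have k1 := key x y u (sharpF γ α z)
  have k2 := key x y (sharpF γ α z) (sharpF γ α z)
  simp only [T, N, smul_apply, ContinuousLinearMap.smulRight_apply, smul_eq_mul] at k1 k2
  field_simp at k1 k2
  -- Annihilation of `T` on a pair of copies of α♯ gives this; substituted into `k1` it leaves α
  -- composed with the curvature equal to zero.
  have k3 : covecF α z (curvEnd (connF γ) z x y (sharpF γ α z)) = 0 := by linarith
  rw [k3, mul_zero, add_zero] at k1
  simpa [hN] using k1

/-- When the curvature kills α♯, so does the Ricci tensor. The Weyl decomposition on `(x, α♯, u,
α♯)` can then be solved for the Schouten tensor. -/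
theorem schouten_of_riemannF_sharpF {z : Coord n} (hz : z ∈ U)
    (hR : ∀ x y u, riemannF γ z x y u (sharpF γ α z) = 0) (x u : Coord n) :
    covecF α z (sharpF γ α z) * schoutenF γ z x u = -elec (weylF γ z) (sharpF γ α z) x u
      - scalar γ z / (((n : ℝ) - 1) * ((n : ℝ) - 2)) * (covecF α z x * covecF α z u)
      + scalar γ z / (((n : ℝ) - 1) * ((n : ℝ) - 2)) / 2
        * (covecF α z (sharpF γ α z) * metricF γ z x u) := by
  have hc := h.isCurvatureAt hz
  have ric : ∀ x, ricciF γ z x (sharpF γ α z) = 0 := by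
    intro x
    rw [hc.ricci]
    have : (fun u v => riemannF γ z u x (sharpF γ α z) v) = fun _ _ => 0 := by
      funext u v; rw [hc.skew₃₄, hR, neg_zero]
    rw [this, tr_zero, neg_zero]
  have ms := h.metric_sharpF hz
  have ms' : ∀ x, metricF γ z x (sharpF γ α z) = covecF α z x := fun x => by
    rw [hc.symm, ms]
  have ric' : ∀ x, ricciF γ z (sharpF γ α z) x = 0 := fun x => by rw [hc.ricci_symm, ric]
  unfold elec
  rw [SmoothMetric.weylF_eq_schouten, hR]
  simp only [schoutenF, sub_apply, smul_apply, smul_eq_mul, ric, ric', ms, ms']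
  have : ∀ s t : ℝ, s / (2 * t) = s / t / 2 := fun s t => by rw [div_div, mul_comm]
  simp only [this]
  ring

/-- The covariant derivative of the recurrence covector is not proportional to the recurrence
covector on any open set. -/
theorem not_eventually_parallel {z : Coord n} (hz : z ∈ U)
    (hN : covecF α z (sharpF γ α z) ≠ 0) :
    ¬ ∀ᶠ z' in nhds z, ∀ w, ∃ θ : ℝ, nabla γ α z' w = θ • covecF α z' := by
  intro hp
  have hn' : (5 : ℝ) ≤ n := by exact_mod_cast h.five_le
  have nb := h.isOpen.mem_nhds hz
  have evN : ∀ᶠ z' in nhds z, covecF α z' (sharpF γ α z') ≠ 0 :=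
    ((h.smooth_covecF.clm_apply h.smooth_sharpF).contDiffAt nb).continuousAt.eventually_ne hN
  have hW := h.isWeylAt hz
  have hB := h.bianchiC hz
  have ms := h.metric_sharpF hz
  have ms' : ∀ x, metricF γ z x (sharpF γ α z) = covecF α z x := fun x => by
    rw [hW.symm, ms]
  have hS : ∀ᶠ z' in nhds z, ∀ x u, covecF α z' (sharpF γ α z') * schoutenF γ z' x u
      = -elec (weylF γ z') (sharpF γ α z') x u
      - scalar γ z' / (((n : ℝ) - 1) * ((n : ℝ) - 2)) * (covecF α z' x * covecF α z' u)
      + scalar γ z' / (((n : ℝ) - 1) * ((n : ℝ) - 2)) / 2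
        * (covecF α z' (sharpF γ α z') * metricF γ z' x u) := by
    filter_upwards [nb, evN, hp.eventually_nhds] with z' hz' hN' hp'
    exact h.schouten_of_riemannF_sharpF hz' (h.riemannF_sharpF_of_parallel hz' hN' hp')
  have hS0 := hS.self_of_nhds
  have hSd : DifferentiableAt ℝ (schoutenF γ) z :=
    (h.smooth_schoutenF.contDiffAt nb).differentiableAt (by simp)
  have hrd : DifferentiableAt ℝ (fun z => scalar γ z / (((n : ℝ) - 1) * ((n : ℝ) - 2))) z :=
    ((h.smooth_scalar.div_const _).contDiffAt nb).differentiableAt (by simp)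
  obtain ⟨dr, hdr⟩ : ∃ dr : Form1 n,
    fderiv ℝ (fun z => scalar γ z / (((n : ℝ) - 1) * ((n : ℝ) - 2))) z = dr := ⟨_, rfl⟩
  have dr' : ∀ w, HasDirDeriv (fun z => scalar γ z / (((n : ℝ) - 1) * ((n : ℝ) - 2))) (dr w) z w :=
    fun w => ⟨hrd, by rw [hdr]⟩
  -- Differentiate the formula `hS`. All its terms but the scalar curvature scale with α twice, so
  -- the factors `2 * θ` cancel against `hS` itself.
  have cov : ∀ w x u, covecF α z (sharpF γ α z) * cov2 (connF γ) (schoutenF γ) z w x u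
      = -(covecF α z w * elec (weylF γ z) (sharpF γ α z) x u)
        - dr w * (covecF α z x * covecF α z u)
        + dr w / 2 * (covecF α z (sharpF γ α z) * metricF γ z x u) := by
    intro w x u
    obtain ⟨θ, hθ⟩ := hp.self_of_nhds w
    have L := (h.hasDirDeriv_covecF_sharpF hz w).mul (HasDirDeriv.of_differentiableAt (w := w)
      ((hSd.clm_apply (differentiableAt_const x)).clm_apply (differentiableAt_const u)))
    have dN := h.hasDirDeriv_covecF_sharpF hz w
    have R := (((h.hasDirDeriv_elec hz w x u).const_mul (-1)).sub ((dr' w).mul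
      ((h.hasDirDeriv_covecF hz w x).mul (h.hasDirDeriv_covecF hz w u)))).add
      (((dr' w).const_mul (1 / 2)).mul (dN.mul (h.hasDirDeriv_metricF hz w x u)))
    have e := L.unique (R.congr_of_eventuallyEq (by
      filter_upwards [hS] with z' hz'
      rw [hz' x u]
      ring))
    rw [fderiv_apply₂ hSd, hθ, sharp_smul] at e
    have s1 := hS0 (connF γ z w x) u
    have s2 := hS0 x (connF γ z w u)
    have s3 := hS0 x u
    have es : sharp (γ z)⁻¹ (covecF α z) = sharpF γ α z := rfl
    simp only [map_smul, smul_apply, smul_eq_mul, es] at e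
    have e1 : weylF γ z x (sharpF γ α z) u (sharpF γ α z)
      = elec (weylF γ z) (sharpF γ α z) x u := rfl
    rw [e1] at e
    rw [cov2]
    linear_combination e - s1 - s2 - 2 * θ * s3
  -- Two expressions of the Cotton tensor are equated: the antisymmetrised `cov`, and the recurrent
  -- one rewritten through `magnetic_eq`.
  have hcot : ∀ x y u, ((n : ℝ) - 2) * (covecF α z x * elec (weylF γ z) (sharpF γ α z) y u
      - covecF α z y * elec (weylF γ z) (sharpF γ α z) x u) = ((n : ℝ) - 3) *
      (-(dr x * (covecF α z y * covecF α z u)) + dr y * (covecF α z x * covecF α z u)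
        + covecF α z (sharpF γ α z) / 2 * (dr x * metricF γ z y u - dr y * metricF γ z x u)) := by
    intro x y u
    have e := (h.cotton_tr_and_eq hz).2 x y u
    have m := hW.magnetic_eq hB h.five_le hN x y u
    have es : sharp (γ z)⁻¹ (covecF α z) = sharpF γ α z := rfl
    rw [es, eq_div_iff hN] at m
    have c1 := cov x y u
    have c2 := cov y x u
    simp only [cotton] at e
    linear_combination ((n : ℝ) - 3) * c1 - ((n : ℝ) - 3) * c2 + m
      - covecF α z (sharpF γ α z) * e
  obtain ⟨s, hs⟩ : ∃ s, sharpF γ α z = s := ⟨_, rfl⟩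
  have hs' : sharp (γ z)⁻¹ (covecF α z) = s := hs
  simp only [hs] at *
  have Es : ∀ x, elec (weylF γ z) s x s = 0 := fun x => hW.apply_self₃₄ _ _ _
  have Es' : ∀ x, elec (weylF γ z) s s x = 0 := fun x => hW.apply_self₁₂ _ _ _
  have hn3 : (n : ℝ) - 3 ≠ 0 := by linarith
  have hn2 : (n : ℝ) - 2 ≠ 0 := by linarith
  -- Both free slots equal to `s` annihilate `E` and show that the scalar curvature varies only
  -- along α.
  have hdrs : ∀ x, dr x * covecF α z s = dr s * covecF α z x := by
    intro x
    have := hcot x s s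
    simp only [Es, mul_zero, sub_zero, ms, ms'] at this
    have h1 := (mul_eq_zero.1 this.symm).resolve_left hn3
    refine mul_left_cancel₀ hN ?_
    linear_combination -2 * h1
  -- With one slot equal to `s`, `E` becomes a multiple of the projection orthogonal to α. Its trace
  -- is zero, so the multiple vanishes, hence `E = 0` and C² = 0.
  have hE : ∀ x u, elec (weylF γ z) s x u * (2 * ((n : ℝ) - 2) * covecF α z s) = (((n : ℝ) - 3) * dr s)
      * (covecF α z s * metricF γ z x u - covecF α z x * covecF α z u) := by
    intro x u
    have := hcot x s u
    simp only [Es', mul_zero, zero_sub, ms] at this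
    have h1 := hdrs x
    linear_combination (-2) * this + ((n : ℝ) - 3) * covecF α z u * h1
  have trE : tr (γ z)⁻¹ (elec (weylF γ z) s) = 0 := by
    have := hW.traceless₁₃ s s
    exact this
  have t := congrArg (tr (γ z)⁻¹) (funext fun x => funext fun u => hE x u)
  have t1 := hW.tr_covec_covec (covecF α z) (covecF α z)
  rw [hs'] at t1
  simp only [tr_mul_left, tr_mul_right, tr_sub, hW.tr_metric, trE, t1, zero_mul] at t
  have hdr0 : dr s = 0 := by
    have : (((n : ℝ) - 3) * ((n : ℝ) - 1) * covecF α z s) * dr s = 0 := by linear_combination -t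
    refine (mul_eq_zero.1 this).resolve_left (mul_ne_zero (mul_ne_zero hn3 ?_) hN)
    linarith
  have hE0 : ∀ x u, elec (weylF γ z) s x u = 0 := by
    intro x u
    have := hE x u
    rw [hdr0, mul_zero, zero_mul] at this
    exact (mul_eq_zero.1 this).resolve_right (mul_ne_zero (mul_ne_zero two_ne_zero hn2) hN)
  have := (hW.contr_sharp hB h.five_le (by rw [hs']; exact hN) s).2
  rw [hs'] at this
  simp only [hE0, mul_zero, tr_zero, ← weylSq_eq] at this
  exact h.weylSq_ne_zero z hz this

end Recurrent

end ParallelDirection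

/-! ### Grycak's relation and the gradient of its scalar. -/

section GrycakScalar

set_option maxSynthPendingDepth 5

variable {n : ℕ}

/-- The scalar of Grycak's relation, computed from the component of the Ricci tensor along the
recurrence covector. -/
def grycakScalar (γ : Coord n → Matrix (Fin n) (Fin n) ℝ) (α : Coord n → Fin n → ℝ)
    (z : Coord n) : ℝ :=
  (ricciF γ z (sharpF γ α z) (sharpF γ α z) / covecF α z (sharpF γ α z) - scalar γ z / n)
    * (2 * n * ((n : ℝ) - 2) / (((n : ℝ) - 1) * ((n : ℝ) - 4)))

theorem IsMetricAt.contr_symm {g : Form2 n} {G : Matrix (Fin n) (Fin n) ℝ} (h : IsMetricAt g G)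
    (C : Form4 n) (x y : Coord n) : contr G C x y = contr G C y x := by
  unfold contr
  rw [← h.tr_comm]
  congr 1; funext k p
  rw [← h.tr_comm]
  congr 1; funext l q
  rw [← h.tr_comm]
  congr 1; funext m r
  ring

namespace Recurrent

variable {γ : Coord n → Matrix (Fin n) (Fin n) ℝ} {α : Coord n → Fin n → ℝ}
  {U : Set (Coord n)} (h : Recurrent γ α U)
include h

theorem contDiffAt_grycakScalar {z : Coord n} (hz : z ∈ U)
    (hN : covecF α z (sharpF γ α z) ≠ 0) : ContDiffAt ℝ ∞ (grycakScalar γ α) z := by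
  have nb := h.isOpen.mem_nhds hz
  have hs := h.smooth_sharpF.contDiffAt nb
  exact (((((h.smooth_ricciF.contDiffAt nb).clm_apply hs).clm_apply hs).div
    ((h.smooth_covecF.contDiffAt nb).clm_apply hs) hN).sub
    ((h.smooth_scalar.contDiffAt nb).div_const _)).mul contDiffAt_const

theorem contr_sharpF {z : Coord n} (hz : z ∈ U) (hN : covecF α z (sharpF γ α z) ≠ 0) (x : Coord n) :
    2 * ((n : ℝ) - 2) * contr (γ z)⁻¹ (weylF γ z) x (sharpF γ α z)
      = ((n : ℝ) - 3) * weylSq γ z * covecF α z x := by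
  rw [weylSq_eq]
  exact ((h.isWeylAt hz).contr_sharp (h.bianchiC hz) h.five_le hN x).1

/-- ∇_wα provides the second covector of the type D algebra. Both h and Ric are then combinations of
g and of one projection of rank two, so their trace-free parts are proportional. -/
theorem grycak_of_not_parallel {z : Coord n} (hz : z ∈ U) (hN : covecF α z (sharpF γ α z) ≠ 0)
    {w : Coord n} (hw : ∀ θ : ℝ, nabla γ α z w ≠ θ • covecF α z) (x y : Coord n) :
    ricciF γ z x y - scalar γ z / n * metricF γ z x y = grycakScalar γ α z
      * (contr (γ z)⁻¹ (weylF γ z) x y / weylSq γ z - 1 / n * metricF γ z x y) := by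
  have hn' : (5 : ℝ) ≤ n := by exact_mod_cast h.five_le
  have hn0 : (n : ℝ) ≠ 0 := by linarith
  have hn1 : (n : ℝ) - 1 ≠ 0 := by linarith
  have hn2 : (n : ℝ) - 2 ≠ 0 := by linarith
  have hn4 : (n : ℝ) - 4 ≠ 0 := by linarith
  have hW := h.isWeylAt hz
  have hc := h.isCurvatureAt hz
  have hm := h.isMetricAt hz
  have ha := h.bianchiC hz
  have hne := h.weylSq_ne_zero z hz
  have es : sharp (γ z)⁻¹ (covecF α z) = sharpF γ α z := rfl
  have cs := h.contr_sharpF hz hN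
  -- The component of ∇_wα orthogonal to α; it is non-zero exactly because ∇_wα is not a multiple of
  -- α.
  obtain ⟨b, hb⟩ : ∃ b : Form1 n, nabla γ α z w
    - (nabla γ α z w (sharpF γ α z) / covecF α z (sharpF γ α z)) • covecF α z = b := ⟨_, rfl⟩
  have hb0 : b ≠ 0 := fun h0 => hw _ (sub_eq_zero.1 (hb.trans h0))
  have hbC : BianchiC (metricF γ z) (γ z)⁻¹ (weylF γ z) b := by
    rw [← hb]; exact ha.sub_smul (h.bianchiC_nabla hz w) _
  have hab : covecF α z (sharp (γ z)⁻¹ b) = 0 := by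
    rw [h.covecF_sharp_comm hz, ← hb]
    simp only [sub_apply, smul_apply, smul_eq_mul]
    field_simp
    ring
  have hba : b (sharpF γ α z) = 0 := by rw [← h.covecF_sharp_comm hz, hab]
  obtain ⟨hβ, τ, hE⟩ := hW.typeD ha hbC h.five_le hN hab hb0 (by rw [← weylSq_eq]; exact hne)
  obtain ⟨c₁, c₂, hQ⟩ := hW.contr_typeD ha h.five_le hN hab hβ hE
  have sq : weylSq γ z = n * c₁ + 2 * c₂ := by
    rw [weylSq_eq, ← hm.tr_metric_add_sq hN hβ c₁ c₂]
    congr 1; funext x y; exact hQ x y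
  have ms := h.metric_sharpF hz
  have hQs := cs (sharpF γ α z)
  rw [hQ, ms, hba, es] at hQs
  -- Otherwise h would be g/n, whose eigenvalue 1/n differs from the eigenvalue (n-3)/(2(n-2)) along
  -- α for n ≥ 5.
  have hc₂ : c₂ ≠ 0 := by
    intro h0
    rw [h0, sq, h0] at hQs
    have : (((n : ℝ) - 1) * ((n : ℝ) - 4) * covecF α z (sharpF γ α z)) * c₁ = 0 := by
      linear_combination -hQs
    have h1 := (mul_eq_zero.1 this).resolve_left (mul_ne_zero (mul_ne_zero hn1 hn4) hN)
    rw [h0, h1] at sq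
    exact hne (by rw [sq]; ring)
  have hKa : ∀ (b : Form1 n) v, b v = metricF γ z v (sharp (γ z)⁻¹ b) := fun b v => by
    rw [hm.symm, hm.apply_sharp]
  have hV : ∀ x y u v, riemannF γ z x y u (sharp (γ z)⁻¹ (covecF α z)) * covecF α z v
        / covecF α z (sharp (γ z)⁻¹ (covecF α z))
      + riemannF γ z x y u (sharp (γ z)⁻¹ b) * b v / b (sharp (γ z)⁻¹ b)
      + riemannF γ z x y v (sharp (γ z)⁻¹ (covecF α z)) * covecF α z u
        / covecF α z (sharp (γ z)⁻¹ (covecF α z))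
      + riemannF γ z x y v (sharp (γ z)⁻¹ b) * b u / b (sharp (γ z)⁻¹ b) = 0 := by
    -- The curvature annihilates h. It annihilates the metric part by skewness, hence also the
    -- projection, as `c₂ ≠ 0`.
    intro x y u v
    have e := h.contr_curvEnd hz x y u v
    have sk := hc.skew₃₄ x y u v
    rw [hQ, hQ, hKa (covecF α z) (curvEnd _ _ _ _ _), hKa b (curvEnd _ _ _ _ _),
      hKa (covecF α z) (curvEnd _ _ _ _ v), hKa b (curvEnd _ _ _ _ v),
      hm.symm u (curvEnd _ _ _ _ _)] at e
    simp only [← h.riemannF_eq hz] at e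
    refine mul_left_cancel₀ hc₂ ?_
    linear_combination e - c₁ * sk
  obtain ⟨d₁, d₂, hR⟩ := hc.ricci_typeD h.five_le hN hab hβ hE hV
  have sc : scalar γ z = n * d₁ + 2 * d₂ := by
    rw [scalar_eq, ← hm.tr_metric_add_sq hN hβ d₁ d₂]
    congr 1; funext x y; exact hR x y
  -- With P the projection, the trace-free parts are `d₂` and `c₂ / C²` times P - (2/n)g, so the
  -- ratio of these coefficients must be the scalar.
  have hG : grycakScalar γ α z * c₂ = d₂ * weylSq γ z := by
    have hRs : ricciF γ z (sharpF γ α z) (sharpF γ α z) / covecF α z (sharpF γ α z) = d₁ + d₂ := by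
      rw [hR, ms, hba, es]
      field_simp
      ring
    rw [grycakScalar, hRs, sc]
    have hQ2 : 2 * ((n : ℝ) - 2) * (c₁ + c₂) = ((n : ℝ) - 3) * weylSq γ z := by
      refine mul_right_cancel₀ hN ?_
      rw [← hQs]
      field_simp
      ring
    have : (weylSq γ z) * (((n : ℝ) - 1) * ((n : ℝ) - 4)) = 2 * ((n : ℝ) - 2) ^ 2 * c₂ := by
      rw [sq] at hQ2 ⊢
      linear_combination (-(n : ℝ)) * hQ2
    field_simp
    linear_combination -d₂ * this
  obtain ⟨Q, hQQ⟩ : ∃ Q, covecF α z x * covecF α z y / covecF α z (sharp (γ z)⁻¹ (covecF α z)) +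
    b x * b y / b (sharp (γ z)⁻¹ b) = Q := ⟨_, rfl⟩
  rw [hR, hQ, sc, hQQ]
  have e : grycakScalar γ α z = d₂ * weylSq γ z / c₂ := by rw [← hG]; field_simp
  rw [e]
  field_simp
  rw [sq]
  ring

/-- Continuity argument: if the relation failed at `z` it would fail nearby, so ∇α would be
proportional to α on a neighbourhood, against `not_eventually_parallel`. -/
theorem grycak {z : Coord n} (hz : z ∈ U) (hN : covecF α z (sharpF γ α z) ≠ 0) (x y : Coord n) :
    ricciF γ z x y - scalar γ z / n * metricF γ z x y = grycakScalar γ α z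
      * (contr (γ z)⁻¹ (weylF γ z) x y / weylSq γ z - 1 / n * metricF γ z x y) := by
  have nb := h.isOpen.mem_nhds hz
  have cN : ContDiffAt ℝ ∞ (fun z => covecF α z (sharpF γ α z)) z :=
    (h.smooth_covecF.clm_apply h.smooth_sharpF).contDiffAt nb
  have ap : ∀ {T : Coord n → Form2 n}, ContDiffOn ℝ ∞ T U → ContinuousAt (fun z => T z x y) z :=
    fun hT => (((hT.contDiffAt nb).clm_apply contDiffAt_const).clm_apply
      contDiffAt_const).continuousAt
  have cS : ContinuousAt (scalar γ) z := (h.smooth_scalar.contDiffAt nb).continuousAt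
  have cW : ContinuousAt (weylSq γ) z := (h.smooth_weylSq.contDiffAt nb).continuousAt
  have cL : ContinuousAt (fun z => ricciF γ z x y - scalar γ z / n * metricF γ z x y
      - grycakScalar γ α z * (contrF γ z x y / weylSq γ z - 1 / n * metricF γ z x y)) z :=
    ((ap h.smooth_ricciF).sub ((cS.div_const _).mul (ap h.smooth_metricF))).sub
      ((h.contDiffAt_grycakScalar hz hN).continuousAt.mul
        (((ap h.smooth_contrF).div cW (h.weylSq_ne_zero z hz)).sub
          (continuousAt_const.mul (ap h.smooth_metricF))))
  by_contra hne
  refine h.not_eventually_parallel hz hN ?_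
  have ne : ricciF γ z x y - scalar γ z / n * metricF γ z x y
      - grycakScalar γ α z * (contrF γ z x y / weylSq γ z - 1 / n * metricF γ z x y) ≠ 0 := by
    rw [contrF_eq]; exact sub_ne_zero.2 hne
  filter_upwards [nb, cN.continuousAt.eventually_ne hN, cL.eventually_ne ne]
    with z' hz' hN' hne' w
  by_contra! hw
  refine hne' ?_
  rw [contrF_eq, sub_eq_zero]
  exact h.grycak_of_not_parallel hz' hN' hw x y

/-- On (α♯, α♯) the factor of `c` is N(n-1)(n-4)/(2n(n-2)), non-zero for n ≥ 5. So this one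
component determines `c`; its reciprocal is the constant in `grycakScalar`. -/
theorem grycakRelation_iff {z : Coord n} (hz : z ∈ U) (hN : covecF α z (sharpF γ α z) ≠ 0)
    (c : ℝ) : GrycakRelation γ c z ↔ c = grycakScalar γ α z := by
  have hn' : (5 : ℝ) ≤ n := by exact_mod_cast h.five_le
  have hn0 : (n : ℝ) ≠ 0 := by linarith
  have hn1 : (n : ℝ) - 1 ≠ 0 := by linarith
  have hn2 : (n : ℝ) - 2 ≠ 0 := by linarith
  have hn4 : (n : ℝ) - 4 ≠ 0 := by linarith
  have hne := h.weylSq_ne_zero z hz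
  constructor
  · intro hc
    have key : ∀ x y, ricciF γ z x y - scalar γ z / n * metricF γ z x y
        = c * (contrF γ z x y / weylSq γ z - 1 / n * metricF γ z x y) := by
      intro x y
      refine isLinearMap_ext
        (f := fun x => ricciF γ z x y - scalar γ z / n * metricF γ z x y)
        (g := fun x => c * (contrF γ z x y / weylSq γ z - 1 / n * metricF γ z x y))
        ⟨fun _ _ => by simp; ring, fun _ _ => by simp; ring⟩
        ⟨fun _ _ => by simp; ring, fun _ _ => by simp; ring⟩ (fun i => ?_) x
      refine isLinearMap_ext
        (f := fun y => ricciF γ z (bv i) y - scalar γ z / n * metricF γ z (bv i) y)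
        (g := fun y => c * (contrF γ z (bv i) y / weylSq γ z - 1 / n * metricF γ z (bv i) y))
        ⟨fun _ _ => by simp; ring, fun _ _ => by simp; ring⟩
        ⟨fun _ _ => by simp; ring, fun _ _ => by simp; ring⟩ (fun j => ?_) y
      simpa [ricciF, metricF, contrF, hTensor] using hc i j
    have k := key (sharpF γ α z) (sharpF γ α z)
    have cs := h.contr_sharpF hz hN (sharpF γ α z)
    rw [h.metric_sharpF hz, contrF_eq] at k
    rw [grycakScalar]
    have cs' : contr (γ z)⁻¹ (weylF γ z) (sharpF γ α z) (sharpF γ α z)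
        = ((n : ℝ) - 3) * weylSq γ z * covecF α z (sharpF γ α z) / (2 * ((n : ℝ) - 2)) := by
      rw [← cs]; field_simp
    rw [cs'] at k
    field_simp at k ⊢
    linear_combination -k
  · rintro rfl i j
    have := h.grycak hz hN (bv i) (bv j)
    rw [contr_bv] at this
    simpa [ricciF, metricF, hTensor] using this

/-- Grycak's relation writes the Schouten tensor through the parallel tensors h and g, so the Cotton
tensor is linear in dG and dR. Its trace and its value on (x, α♯, α♯) vanish, giving two equations
for dG. -/
theorem fderiv_grycakScalar {z : Coord n} (hz : z ∈ U) (hN : covecF α z (sharpF γ α z) ≠ 0)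
    (x : Coord n) : fderiv ℝ (grycakScalar γ α) z x
      = (n * ((n : ℝ) - 2) ^ 2) / (((n : ℝ) - 1) ^ 2 * ((n : ℝ) - 4))
        * (covecF α z x * fderiv ℝ (scalar γ) z (sharpF γ α z) / covecF α z (sharpF γ α z)
          - fderiv ℝ (scalar γ) z x / n) := by
  have hn' : (5 : ℝ) ≤ n := by exact_mod_cast h.five_le
  have hn0 : (n : ℝ) ≠ 0 := by linarith
  have hn1 : (n : ℝ) - 1 ≠ 0 := by linarith
  have hn2 : (n : ℝ) - 2 ≠ 0 := by linarith
  have hn4 : (n : ℝ) - 4 ≠ 0 := by linarith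
  have hne := h.weylSq_ne_zero z hz
  have nb := h.isOpen.mem_nhds hz
  have hm := h.isMetricAt hz
  have es : sharp (γ z)⁻¹ (covecF α z) = sharpF γ α z := rfl
  have evN : ∀ᶠ z' in nhds z, covecF α z' (sharpF γ α z') ≠ 0 :=
    ((h.smooth_covecF.clm_apply h.smooth_sharpF).contDiffAt nb).continuousAt.eventually_ne hN
  obtain ⟨T, hT⟩ : ∃ T : Coord n → Form2 n, (fun z => (weylSq γ z)⁻¹ • contrF γ z) = T := ⟨_, rfl⟩
  have hT' : ∀ z x y, T z x y = contr (γ z)⁻¹ (weylF γ z) x y / weylSq γ z := by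
    intro z x y
    rw [← hT, ← contrF_eq]
    simp only [smul_apply, smul_eq_mul]
    ring
  have hTd : DifferentiableAt ℝ T z := by
    rw [← hT]
    exact (((h.smooth_weylSq.contDiffAt nb).inv hne).smul
      (h.smooth_contrF.contDiffAt nb)).differentiableAt (by simp)
  have hTp := h.contr_parallel hz
  rw [hT] at hTp
  have hSd : DifferentiableAt ℝ (schoutenF γ) z :=
    (h.smooth_schoutenF.contDiffAt nb).differentiableAt (by simp)
  obtain ⟨dG, hdG⟩ : ∃ d : Form1 n, fderiv ℝ (grycakScalar γ α) z = d := ⟨_, rfl⟩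
  obtain ⟨dR, hdR⟩ : ∃ d : Form1 n, fderiv ℝ (scalar γ) z = d := ⟨_, rfl⟩
  have dG' : ∀ w, HasDirDeriv (grycakScalar γ α) (dG w) z w :=
    fun w => ⟨(h.contDiffAt_grycakScalar hz hN).differentiableAt (by simp), by rw [hdG]⟩
  have dR' : ∀ w, HasDirDeriv (scalar γ) (dR w) z w :=
    fun w => ⟨(h.smooth_scalar.contDiffAt nb).differentiableAt (by simp), by rw [hdR]⟩
  -- Coefficient of `R g` in `(n - 2)` times the Schouten tensor: 1/n from the trace part of Ric,
  -- and -1/(2(n-1)) from the definition.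
  obtain ⟨κ, hκ⟩ : ∃ κ : ℝ, 1 / (n : ℝ) - 1 / (2 * ((n : ℝ) - 1)) = κ := ⟨_, rfl⟩
  have hS : ∀ᶠ z' in nhds z, ∀ x y, schoutenF γ z' x y * ((n : ℝ) - 2)
      = grycakScalar γ α z' * T z' x y + (κ * scalar γ z' - grycakScalar γ α z' * (1 / n))
        * metricF γ z' x y := by
    filter_upwards [nb, evN] with z' hz' hN' x y
    have e := h.grycak hz' hN' x y
    rw [← hT'] at e
    simp only [schoutenF, sub_apply, smul_apply, smul_eq_mul, sub_eq_iff_eq_add.1 e, ← hκ]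
    field_simp
    ring
  have hS0 := hS.self_of_nhds
  have cov : ∀ w x u, cov2 (connF γ) (schoutenF γ) z w x u * ((n : ℝ) - 2)
      = dG w * (T z x u - 1 / n * metricF γ z x u) + κ * dR w * metricF γ z x u := by
    intro w x u
    have L := (HasDirDeriv.of_differentiableAt (w := w) ((hSd.clm_apply
      (differentiableAt_const x)).clm_apply (differentiableAt_const u))).mul
      (HasDirDeriv.const ((n : ℝ) - 2))
    have dT := HasDirDeriv.of_differentiableAt (w := w) ((hTd.clm_apply
      (differentiableAt_const x)).clm_apply (differentiableAt_const u))
    have R := ((dG' w).mul dT).add ((((dR' w).const_mul κ).sub ((dG' w).mul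
      (HasDirDeriv.const (1 / (n : ℝ))))).mul (h.hasDirDeriv_metricF hz w x u))
    have e := L.unique (R.congr_of_eventuallyEq (by
      filter_upwards [hS] with z' hz' using hz' x u))
    have tp := hTp w x u
    rw [fderiv_apply₂ hSd, fderiv_apply₂ hTd] at e
    have s1 := hS0 (connF γ z w x) u
    have s2 := hS0 x (connF γ z w u)
    rw [cov2] at tp ⊢
    linear_combination e - s1 - s2 + grycakScalar γ α z * tp
  have Ts : ∀ x, T z x (sharpF γ α z) - 1 / n * metricF γ z x (sharpF γ α z)
      = ((n : ℝ) - 1) * ((n : ℝ) - 4) / (2 * n * ((n : ℝ) - 2)) * covecF α z x := by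
    intro x
    have cs := h.contr_sharpF hz hN x
    rw [hT', hm.symm x, h.metric_sharpF hz]
    field_simp
    linear_combination (n : ℝ) * cs
  have cot : ∀ x y u, cotton γ z x y u * ((n : ℝ) - 2)
      = (dG x * (T z y u - 1 / n * metricF γ z y u) + κ * dR x * metricF γ z y u)
        - (dG y * (T z x u - 1 / n * metricF γ z x u) + κ * dR y * metricF γ z x u) := by
    intro x y u
    rw [cotton, sub_mul, cov, cov]
  obtain ⟨q, hq⟩ : ∃ q : ℝ, ((n : ℝ) - 1) * ((n : ℝ) - 4) / (2 * n * ((n : ℝ) - 2)) = q := ⟨_, rfl⟩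
  rw [hq] at Ts
  obtain ⟨cot1, cot2⟩ := h.cotton_tr_and_eq hz
  have ms : ∀ x, metricF γ z x (sharpF γ α z) = covecF α z x := fun x => by
    rw [hm.symm, h.metric_sharpF hz]
  obtain ⟨s, hs⟩ : ∃ s, sharpF γ α z = s := ⟨_, rfl⟩
  simp only [hs] at *
  have Ts' : ∀ x, T z s x - 1 / n * metricF γ z s x = q * covecF α z x := by
    intro x
    rw [hT', hm.symm s x, hm.contr_symm, ← hT', Ts]
  have trT : tr (γ z)⁻¹ (fun x y => T z x y) = 1 := by
    simp only [hT', tr_div]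
    rw [← weylSq_eq, div_self hne]
  -- Trace of the Cotton tensor with first slot `s`; h - g/n is trace-free, so its own trace drops
  -- out.
  have E1 : q * dG s = ((n : ℝ) - 1) * κ * dR s := by
    have e := congrArg (tr (γ z)⁻¹) (funext fun y => funext fun u => cot s y u)
    have t1 : ∀ d : Form1 n, tr (γ z)⁻¹ (fun y u => d y * covecF α z u) = d s := fun d => by
      rw [← es]; exact hm.tr_covec_covec d (covecF α z)
    simp only [Ts'] at e
    simp only [hm.symm s, ms, mul_left_comm _ q, mul_assoc κ] at e
    simp only [tr_mul_right, cot1, tr_sub, tr_add, tr_mul_left, hm.tr_metric, trT, t1] at e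
    field_simp at e
    linear_combination e
  -- The Cotton tensor at `(x, s, s)` is a multiple of `C x s s s = 0`.
  have E2 : q * (dG x * covecF α z s - dG s * covecF α z x)
      + κ * (dR x * covecF α z s - dR s * covecF α z x) = 0 := by
    have hn3 : (n : ℝ) - 3 ≠ 0 := by linarith
    have e := cot2 x s s
    rw [(h.isWeylAt hz).apply_self₃₄, neg_zero] at e
    have e' := cot x s s
    rw [(mul_eq_zero.1 e).resolve_left hn3, Ts, Ts, ms, ms] at e'
    linear_combination -e'
  have hq0 : q ≠ 0 := by
    rw [← hq]; exact div_ne_zero (mul_ne_zero hn1 hn4) (by positivity)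
  rw [hdG, hdR]
  have E3 : q * dG x = n * κ * (covecF α z x * dR s / covecF α z s - dR x / n) := by
    field_simp
    linear_combination E2 + covecF α z x * E1
  refine mul_left_cancel₀ hq0 ?_
  rw [E3, ← hq, ← hκ]
  field_simp
  ring

end Recurrent

end GrycakScalar

/-! ### Covariance of the curvature under changes of coordinates. -/

section CoordinateChange

set_option maxSynthPendingDepth 5

variable {n : ℕ}

/-- The trace of a bilinear function does not depend on the coordinates. -/
theorem tr_pullback {g g' : Form2 n} {G G' : Matrix (Fin n) (Fin n) ℝ} (h : IsMetricAt g G)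
    (h' : IsMetricAt g' G') {J : Coord n →L[ℝ] Coord n} (hJ : Function.Surjective J)
    (hg : ∀ x y, g x y = g' (J x) (J y)) {B : Coord n → Coord n → ℝ}
    (hB₁ : ∀ v, IsLinearMap ℝ fun u => B u v) (hB₂ : ∀ u, IsLinearMap ℝ fun v => B u v) :
    tr G (fun u v => B (J u) (J v)) = tr G' B := by
  -- A contraction with `g'` is inserted so that the order of traces can be exchanged; the inner
  -- trace over `G` then meets a metric factor and disappears.
  have e : ∀ u v, B (J u) (J v) = tr G' fun p q => B p (J v) * g' (J u) q := fun u v =>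
    (h'.tr_metric_right' (J u) (hB₁ (J v))).symm
  simp only [e]
  rw [tr_tr_comm]
  congr 1; funext p q
  obtain ⟨r, rfl⟩ := hJ q
  simp only [← hg]
  exact h.tr_metric_left r (f := fun v => B p (J v))
    ⟨fun _ _ => by rw [map_add, (hB₂ p).map_add], fun _ _ => by rw [map_smul, (hB₂ p).map_smul]⟩

/-- `ψ` is a smooth change of coordinates under which the metric `γ` is the pullback of `γ'`. -/
structure IsometricChange (γ γ' : Coord n → Matrix (Fin n) (Fin n) ℝ) (U U' : Set (Coord n))
    (ψ : Coord n → Coord n) : Prop where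
  left : SmoothMetric γ U
  right : SmoothMetric γ' U'
  mapsTo : ∀ z ∈ U, ψ z ∈ U'
  smooth : ContDiffOn ℝ ∞ ψ U
  metric : ∀ z ∈ U, ∀ x y, metricF γ z x y = metricF γ' (ψ z) (fderiv ℝ ψ z x) (fderiv ℝ ψ z y)

namespace IsometricChange

variable {γ γ' : Coord n → Matrix (Fin n) (Fin n) ℝ} {U U' : Set (Coord n)}
  {ψ : Coord n → Coord n} (h : IsometricChange γ γ' U U' ψ)
include h

theorem contDiffAt {z : Coord n} (hz : z ∈ U) : ContDiffAt ℝ ∞ ψ z :=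
  h.smooth.contDiffAt (h.left.isOpen.mem_nhds hz)

theorem differentiableAt {z : Coord n} (hz : z ∈ U) : DifferentiableAt ℝ ψ z :=
  (h.contDiffAt hz).differentiableAt (by simp)

theorem differentiableAt_fderiv {z : Coord n} (hz : z ∈ U) :
    DifferentiableAt ℝ (fderiv ℝ ψ) z :=
  ((h.contDiffAt hz).fderiv_right (m := ∞) (by simp)).differentiableAt (by simp)

/-- The pulled-back metric is nondegenerate, so the derivative is injective, and the dimensions
agree. -/
theorem surjective {z : Coord n} (hz : z ∈ U) : Function.Surjective (fderiv ℝ ψ z) := by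
  have hi : Function.Injective (fderiv ℝ ψ z).toLinearMap := by
    refine (injective_iff_map_eq_zero _).2 fun x hx => ?_
    refine (h.left.isMetricAt hz).eq_of_forall fun v => ?_
    have hx' : fderiv ℝ ψ z x = 0 := hx
    rw [h.metric z hz, hx']
    simp
  exact LinearMap.injective_iff_surjective.1 hi

theorem fderiv_fderiv_symm {z : Coord n} (hz : z ∈ U) (x y : Coord n) :
    fderiv ℝ (fderiv ℝ ψ) z x y = fderiv ℝ (fderiv ℝ ψ) z y x :=
  (h.contDiffAt hz).isSymmSndFDerivAt (by simpa using ENat.LEInfty.out) x y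

theorem fderiv_metricF {z : Coord n} (hz : z ∈ U) (w x y : Coord n) :
    fderiv ℝ (metricF γ) z w x y
      = fderiv ℝ (metricF γ') (ψ z) (fderiv ℝ ψ z w) (fderiv ℝ ψ z x) (fderiv ℝ ψ z y)
        + metricF γ' (ψ z) (fderiv ℝ (fderiv ℝ ψ) z w x) (fderiv ℝ ψ z y)
        + metricF γ' (ψ z) (fderiv ℝ ψ z x) (fderiv ℝ (fderiv ℝ ψ) z w y) := by
  rw [← fderiv_apply₂ (h.left.differentiableAt_metricF hz)]
  have e : (fun z => metricF γ z x y) =ᶠ[nhds z]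
      fun z => metricF γ' (ψ z) (fderiv ℝ ψ z x) (fderiv ℝ ψ z y) := by
    filter_upwards [h.left.isOpen.mem_nhds hz] with z' hz' using h.metric z' hz' x y
  have hJ := (h.differentiableAt_fderiv hz).hasFDerivAt
  have d := (((h.right.differentiableAt_metricF (h.mapsTo z hz)).hasFDerivAt.comp z
    (h.differentiableAt hz).hasFDerivAt).clm_apply
    (hJ.clm_apply (hasFDerivAt_const x z))).clm_apply (hJ.clm_apply (hasFDerivAt_const y z))
  rw [e.fderiv_eq]
  refine (congrArg (fun L => L w) d.fderiv).trans ?_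
  simp
  ring

/-- The transformation law of the Christoffel symbols. -/
theorem fderiv_connF {z : Coord n} (hz : z ∈ U) (x y : Coord n) :
    fderiv ℝ ψ z (connF γ z x y) = connF γ' (ψ z) (fderiv ℝ ψ z x) (fderiv ℝ ψ z y)
      + fderiv ℝ (fderiv ℝ ψ) z x y := by
  have hm' := h.right.isMetricAt (h.mapsTo z hz)
  refine hm'.eq_of_forall fun v => ?_
  obtain ⟨w, rfl⟩ := h.surjective hz v
  rw [← h.metric z hz, h.left.koszul hz, h.fderiv_metricF hz, h.fderiv_metricF hz,
    h.fderiv_metricF hz, map_add, add_apply, h.right.koszul (h.mapsTo z hz),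
    h.fderiv_fderiv_symm hz y x, h.fderiv_fderiv_symm hz w x, h.fderiv_fderiv_symm hz w y,
    hm'.symm (fderiv ℝ ψ z x), hm'.symm (fderiv ℝ ψ z y)]
  ring

/-- The curvature endomorphism is a tensor. -/
theorem fderiv_curvEnd {z : Coord n} (hz : z ∈ U) (x y u : Coord n) :
    fderiv ℝ ψ z (curvEnd (connF γ) z x y u)
      = curvEnd (connF γ') (ψ z) (fderiv ℝ ψ z x) (fderiv ℝ ψ z y) (fderiv ℝ ψ z u) := by
  have hJ := (h.differentiableAt_fderiv hz).hasFDerivAt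
  have hJ2 : ContDiffAt ℝ ∞ (fderiv ℝ ψ) z := (h.contDiffAt hz).fderiv_right (m := ∞) (by simp)
  have hH : HasFDerivAt (fderiv ℝ (fderiv ℝ ψ)) _ z :=
    ((hJ2.fderiv_right (m := ∞) (by simp)).differentiableAt (by simp)).hasFDerivAt
  have sym3 : ∀ x y, fderiv ℝ (fderiv ℝ (fderiv ℝ ψ)) z x y
      = fderiv ℝ (fderiv ℝ (fderiv ℝ ψ)) z y x := fun x y =>
    hJ2.isSymmSndFDerivAt (by simpa using ENat.LEInfty.out) x y
  have hΓ := (h.left.differentiableAt_connF hz).hasFDerivAt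
  have hΓ' := (h.right.differentiableAt_connF (h.mapsTo z hz)).hasFDerivAt.comp z
    (h.differentiableAt hz).hasFDerivAt
  -- The transformation law of the Christoffel symbols, differentiated. The third derivatives of `ψ`
  -- are symmetric and vanish on antisymmetrising.
  have key : ∀ w x y, fderiv ℝ (fderiv ℝ ψ) z w (connF γ z x y)
      + fderiv ℝ ψ z (fderiv ℝ (connF γ) z w x y)
      = fderiv ℝ (connF γ') (ψ z) (fderiv ℝ ψ z w) (fderiv ℝ ψ z x) (fderiv ℝ ψ z y)
        + connF γ' (ψ z) (fderiv ℝ (fderiv ℝ ψ) z w x) (fderiv ℝ ψ z y)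
        + connF γ' (ψ z) (fderiv ℝ ψ z x) (fderiv ℝ (fderiv ℝ ψ) z w y)
        + fderiv ℝ (fderiv ℝ (fderiv ℝ ψ)) z w x y := by
    intro w x y
    have L := hJ.clm_apply ((hΓ.clm_apply (hasFDerivAt_const x z)).clm_apply
      (hasFDerivAt_const y z))
    have R := ((hΓ'.clm_apply (hJ.clm_apply (hasFDerivAt_const x z))).clm_apply
      (hJ.clm_apply (hasFDerivAt_const y z))).add
      ((hH.clm_apply (hasFDerivAt_const x z)).clm_apply (hasFDerivAt_const y z))
    have e : (fun z => fderiv ℝ ψ z (connF γ z x y)) =ᶠ[nhds z] fun z =>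
        connF γ' (ψ z) (fderiv ℝ ψ z x) (fderiv ℝ ψ z y) + fderiv ℝ (fderiv ℝ ψ) z x y := by
      filter_upwards [h.left.isOpen.mem_nhds hz] with z' hz' using h.fderiv_connF hz' x y
    have := congrArg (fun L => L w) (L.unique (R.congr_of_eventuallyEq e))
    simp at this
    rw [add_comm, this]
    abel
  have k1 := key y x u
  have k2 := key x y u
  rw [← eq_sub_iff_add_eq'] at k1 k2
  simp only [curvEnd, map_sub, map_add, k1, k2, h.fderiv_connF hz]
  rw [sym3 y x, h.fderiv_fderiv_symm hz y x]
  abel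

theorem riemannF_eq {z : Coord n} (hz : z ∈ U) (x y u v : Coord n) :
    riemannF γ z x y u v = riemannF γ' (ψ z) (fderiv ℝ ψ z x) (fderiv ℝ ψ z y)
      (fderiv ℝ ψ z u) (fderiv ℝ ψ z v) := by
  rw [h.left.riemannF_eq hz, h.right.riemannF_eq (h.mapsTo z hz), h.metric z hz,
    h.fderiv_curvEnd hz]

theorem tr_eq {z : Coord n} (hz : z ∈ U) {B : Coord n → Coord n → ℝ}
    (hB₁ : ∀ v, IsLinearMap ℝ fun u => B u v) (hB₂ : ∀ u, IsLinearMap ℝ fun v => B u v) :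
    tr (γ z)⁻¹ (fun u v => B (fderiv ℝ ψ z u) (fderiv ℝ ψ z v)) = tr (γ' (ψ z))⁻¹ B :=
  tr_pullback (h.left.isMetricAt hz) (h.right.isMetricAt (h.mapsTo z hz)) (h.surjective hz)
    (h.metric z hz) hB₁ hB₂

theorem ricciF_eq {z : Coord n} (hz : z ∈ U) (x y : Coord n) :
    ricciF γ z x y = ricciF γ' (ψ z) (fderiv ℝ ψ z x) (fderiv ℝ ψ z y) := by
  rw [h.left.ricciF_eq hz, h.right.ricciF_eq (h.mapsTo z hz)]
  simp only [h.riemannF_eq hz]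
  rw [h.tr_eq hz (B := fun u v => riemannF γ' (ψ z) u (fderiv ℝ ψ z x) (fderiv ℝ ψ z y) v)
    (fun _ => ⟨fun _ _ => by simp, fun _ _ => by simp⟩)
    (fun _ => ⟨fun _ _ => by simp, fun _ _ => by simp⟩)]

theorem scalar_eq {z : Coord n} (hz : z ∈ U) : scalar γ z = scalar γ' (ψ z) := by
  rw [CRn.scalar_eq, CRn.scalar_eq, ← h.tr_eq hz (B := fun u v => ricciF γ' (ψ z) u v)
    (fun _ => ⟨fun _ _ => by simp, fun _ _ => by simp⟩)
    (fun _ => ⟨fun _ _ => by simp, fun _ _ => by simp⟩)]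
  simp only [h.ricciF_eq hz]

/-- The scalar is formed from the Ricci tensor, the scalar curvature, α and α♯, each of which
transforms as a tensor. -/
theorem grycakScalar_eq {α α' : Coord n → Fin n → ℝ} {z : Coord n} (hz : z ∈ U)
    (hα : ∀ x, covecF α z x = covecF α' (ψ z) (fderiv ℝ ψ z x)) :
    grycakScalar γ α z = grycakScalar γ' α' (ψ z) := by
  have hm := h.left.isMetricAt hz
  have hm' := h.right.isMetricAt (h.mapsTo z hz)
  have hs : fderiv ℝ ψ z (sharpF γ α z) = sharpF γ' α' (ψ z) := by
    refine hm'.eq_of_forall fun v => ?_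
    obtain ⟨w, rfl⟩ := h.surjective hz v
    rw [← h.metric z hz, sharpF, sharpF, hm.apply_sharp, hm'.apply_sharp, hα]
  rw [grycakScalar, grycakScalar, h.ricciF_eq hz, hα, hs, h.scalar_eq hz]

end IsometricChange

end CoordinateChange

/-! ### From coordinate domains to the manifold. -/

section Charts

variable {n : ℕ}

theorem lin_lin_comp (B : Form2 n) (L : Coord n →L[ℝ] Coord n) (x y : Coord n) :
    (lin fun i => lin fun j => B (L (bv i)) (L (bv j)) : Form2 n) x y = B (L x) (L y) := by
  refine isLinearMap_ext
    (f := fun x => (lin fun i => lin fun j => B (L (bv i)) (L (bv j)) : Form2 n) x y)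
    (g := fun x => B (L x) (L y))
    ⟨fun _ _ => by simp, fun _ _ => by simp⟩ ⟨fun _ _ => by simp, fun _ _ => by simp⟩ (fun i => ?_) x
  refine isLinearMap_ext
    (f := fun y => (lin fun i => lin fun j => B (L (bv i)) (L (bv j)) : Form2 n) (bv i) y)
    (g := fun y => B (L (bv i)) (L y))
    ⟨fun _ _ => by simp, fun _ _ => by simp⟩ ⟨fun _ _ => by simp, fun _ _ => by simp⟩ (fun j => ?_) y
  simp

theorem lin_comp (a : Form1 n) (L : Coord n →L[ℝ] Coord n) (x : Coord n) :
    (lin fun i => a (L (bv i)) : Form1 n) x = a (L x) := by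
  refine isLinearMap_ext
    (f := fun x => (lin fun i => a (L (bv i)) : Form1 n) x) (g := fun x => a (L x))
    ⟨fun _ _ => by simp, fun _ _ => by simp⟩ ⟨fun _ _ => by simp, fun _ _ => by simp⟩ (fun i => ?_) x
  simp

theorem SmoothMetric.mono {γ : Coord n → Matrix (Fin n) (Fin n) ℝ} {U V : Set (Coord n)}
    (h : SmoothMetric γ U) (hV : IsOpen V) (hVU : V ⊆ U) : SmoothMetric γ V where
  isOpen := hV
  smooth i j := (h.smooth i j).mono hVU
  symm z hz := h.symm z (hVU hz)
  det_ne_zero z hz := h.det_ne_zero z (hVU hz)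

variable {M : Type*} [TopologicalSpace M] [ChartedSpace (Coord n) M]

/-- The coordinate frame of a chart, as a linear map from the coordinate space. -/
def frame (φ : OpenPartialHomeomorph M (Coord n)) (z : Coord n) : Coord n →L[ℝ] Coord n :=
  mfderiv (𝓡 n) (𝓡 n) φ.symm z

theorem metricF_bilinComp (g : (x : M) → TangentSpace (𝓡 n) x →L[ℝ] TangentSpace (𝓡 n) x →L[ℝ] ℝ)
    (φ : OpenPartialHomeomorph M (Coord n)) (z x y : Coord n) :
    metricF (bilinComp g φ) z x y = g (φ.symm z) (frame φ z x) (frame φ z y) :=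
  lin_lin_comp (g (φ.symm z)) (frame φ z) x y

theorem covecF_covecComp (α : (x : M) → TangentSpace (𝓡 n) x →L[ℝ] ℝ)
    (φ : OpenPartialHomeomorph M (Coord n)) (z x : Coord n) :
    covecF (covecComp α φ) z x = α (φ.symm z) (frame φ z x) :=
  lin_comp (α (φ.symm z)) (frame φ z) x

variable {φ φ' : OpenPartialHomeomorph M (Coord n)}

theorem mdifferentiableAt_symm (hφ : φ ∈ IsManifold.maximalAtlas (𝓡 n) ∞ M) {z : Coord n}
    (hz : z ∈ φ.target) : MDifferentiableAt (𝓡 n) (𝓡 n) φ.symm z :=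
  (contMDiffAt_symm_of_mem_maximalAtlas hφ hz).mdifferentiableAt (by simp)

theorem contDiffOn_transition (hφ : φ ∈ IsManifold.maximalAtlas (𝓡 n) ∞ M)
    (hφ' : φ' ∈ IsManifold.maximalAtlas (𝓡 n) ∞ M) :
    ContDiffOn ℝ ∞ (φ' ∘ φ.symm) (φ.target ∩ φ.symm ⁻¹' φ'.source) := by
  refine ContMDiffOn.contDiffOn ?_
  exact (contMDiffOn_of_mem_maximalAtlas hφ').comp
    ((contMDiffOn_symm_of_mem_maximalAtlas hφ).mono Set.inter_subset_left) fun z hz => hz.2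

/-- Chain rule for φ'⁻¹ ∘ (φ' ∘ φ⁻¹), which is φ⁻¹ near `z`. -/
theorem frame_transition (hφ : φ ∈ IsManifold.maximalAtlas (𝓡 n) ∞ M)
    (hφ' : φ' ∈ IsManifold.maximalAtlas (𝓡 n) ∞ M) {z : Coord n}
    (hz : z ∈ φ.target ∩ φ.symm ⁻¹' φ'.source) (x : Coord n) :
    frame φ' ((φ' ∘ φ.symm) z) (fderiv ℝ (φ' ∘ φ.symm) z x) = frame φ z x := by
  have ho : IsOpen (φ.target ∩ φ.symm ⁻¹' φ'.source) :=
    φ.symm.isOpen_inter_preimage φ'.open_source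
  have hd : DifferentiableAt ℝ (φ' ∘ φ.symm) z :=
    ((contDiffOn_transition hφ hφ').contDiffAt (ho.mem_nhds hz)).differentiableAt (by simp)
  have ht : (φ' ∘ φ.symm) z ∈ φ'.target := φ'.map_source hz.2
  have e : φ'.symm ∘ (φ' ∘ φ.symm) =ᶠ[nhds z] φ.symm := by
    filter_upwards [ho.mem_nhds hz] with z' hz' using φ'.left_inv hz'.2
  have d := (mdifferentiableAt_symm hφ' ht).hasMFDerivAt.comp z hd.hasFDerivAt.hasMFDerivAt
  have d' := (mdifferentiableAt_symm hφ hz.1).hasMFDerivAt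
  have u := hasMFDerivAt_unique d' (d.congr_of_eventuallyEq e.symm)
  exact (congrArg (fun L : Coord n →L[ℝ] Coord n => L x) u).symm

theorem frame_bijective (hφ : φ ∈ IsManifold.maximalAtlas (𝓡 n) ∞ M) {z : Coord n}
    (hz : z ∈ φ.target) : Function.Bijective (frame φ z) := by
  have hs : φ.symm z ∈ φ.source := φ.map_target hz
  have d := ((contMDiffAt_of_mem_maximalAtlas hφ hs).mdifferentiableAt
    (by simp)).hasMFDerivAt.comp z (mdifferentiableAt_symm hφ hz).hasMFDerivAt
  have e : φ ∘ φ.symm =ᶠ[nhds z] id := by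
    filter_upwards [φ.open_target.mem_nhds hz] with z' hz' using φ.right_inv hz'
  have u := hasMFDerivAt_unique (d.congr_of_eventuallyEq e.symm) (hasMFDerivAt_id z)
  have hi : Function.Injective (frame φ z).toLinearMap := by
    refine Function.LeftInverse.injective
      (g := (mfderiv (𝓡 n) (𝓡 n) φ (φ.symm z) : Coord n →L[ℝ] Coord n)) fun x => ?_
    exact congrArg (fun L : Coord n →L[ℝ] Coord n => L x) u
  exact ⟨hi, LinearMap.injective_iff_surjective.1 hi⟩

theorem PseudoRiemannianMetric.smoothMetric (g : PseudoRiemannianMetric n M)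
    (hφ : φ ∈ IsManifold.maximalAtlas (𝓡 n) ∞ M) :
    SmoothMetric (bilinComp g.form φ) φ.target where
  isOpen := φ.open_target
  smooth := g.smooth φ hφ
  symm z _ i j := g.symm _ _ _
  det_ne_zero z hz hdet := by
    -- A kernel vector of the matrix would be orthogonal to the whole tangent space, since the frame
    -- is onto.
    obtain ⟨v, hv0, hv⟩ := Matrix.exists_mulVec_eq_zero_iff.2 hdet
    obtain ⟨hi, hs⟩ := frame_bijective hφ hz
    obtain ⟨x, hx⟩ : ∃ x : Coord n, WithLp.toLp 2 v = x := ⟨_, rfl⟩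
    have hx' : ∀ i, x i = v i := fun i => by rw [← hx]
    have h1 : ∀ y, metricF (bilinComp g.form φ) z y x = 0 := by
      refine isLinearMap_ext (f := fun y => metricF (bilinComp g.form φ) z y x) (g := fun _ => 0)
        ⟨fun _ _ => by simp, fun _ _ => by simp⟩ ⟨fun _ _ => by simp, fun _ _ => by simp⟩ fun i => ?_
      have := congrFun hv i
      simp only [Matrix.mulVec, dotProduct, Pi.zero_apply] at this
      simp only [metricF, lin_bv]
      rw [lin_apply, ← this]
      exact Finset.sum_congr rfl fun j _ => by rw [hx', smul_eq_mul, mul_comm]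
    have h2 : frame φ z x = 0 := by
      refine g.nondegenerate (φ.symm z) (frame φ z x) fun w => ?_
      obtain ⟨y, hy⟩ := hs w
      have h4 := h1 y
      rw [metricF_bilinComp, hy] at h4
      exact (g.symm (φ.symm z) (frame φ z x) w).trans h4
    have h3 : x = 0 := hi (by rw [h2, map_zero])
    exact hv0 (funext fun i => by rw [← hx', h3]; rfl)

theorem PseudoRiemannianMetric.isometricChange (g : PseudoRiemannianMetric n M)
    (hφ : φ ∈ IsManifold.maximalAtlas (𝓡 n) ∞ M) (hφ' : φ' ∈ IsManifold.maximalAtlas (𝓡 n) ∞ M) :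
    IsometricChange (bilinComp g.form φ) (bilinComp g.form φ')
      (φ.target ∩ φ.symm ⁻¹' φ'.source) φ'.target (φ' ∘ φ.symm) where
  left := (g.smoothMetric hφ).mono (φ.symm.isOpen_inter_preimage φ'.open_source)
    Set.inter_subset_left
  right := g.smoothMetric hφ'
  mapsTo z hz := φ'.map_source hz.2
  smooth := contDiffOn_transition hφ hφ'
  metric z hz x y := by
    rw [metricF_bilinComp, metricF_bilinComp, frame_transition hφ hφ' hz,
      frame_transition hφ hφ' hz]
    have e : φ'.symm ((φ' ∘ φ.symm) z) = φ.symm z := φ'.left_inv hz.2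
    let B : M → Form2 n := g.form
    exact congrArg (fun p => B p (frame φ z x) (frame φ z y)) e.symm

theorem grycakScalar_chart (g : PseudoRiemannianMetric n M)
    (α : (x : M) → TangentSpace (𝓡 n) x →L[ℝ] ℝ)
    (hφ : φ ∈ IsManifold.maximalAtlas (𝓡 n) ∞ M) (hφ' : φ' ∈ IsManifold.maximalAtlas (𝓡 n) ∞ M)
    {z : Coord n} (hz : z ∈ φ.target) (hz' : φ.symm z ∈ φ'.source) :
    grycakScalar (bilinComp g.form φ) (covecComp α φ) z
      = grycakScalar (bilinComp g.form φ') (covecComp α φ') (φ' (φ.symm z)) := by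
  refine (g.isometricChange hφ hφ').grycakScalar_eq ⟨hz, hz'⟩ fun x => ?_
  rw [covecF_covecComp, covecF_covecComp, frame_transition hφ hφ' ⟨hz, hz'⟩]
  have e : φ'.symm ((φ' ∘ φ.symm) z) = φ.symm z := φ'.left_inv hz'
  let a : M → Form1 n := α
  exact congrArg (fun p => a p (frame φ z x)) e.symm

theorem covecF_sharpF_eq (γ : Coord n → Matrix (Fin n) (Fin n) ℝ) (α : Coord n → Fin n → ℝ)
    (z : Coord n) : covecF α z (sharpF γ α z) = covecSq γ α z := by
  simp only [sharpF, sharp, map_sum, map_smul, covecF, lin_bv, covecSq, smul_eq_mul, mul_right_comm]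

/-- The gradient formula in components. -/
theorem Recurrent.pd_grycakScalar {γ : Coord n → Matrix (Fin n) (Fin n) ℝ}
    {α : Coord n → Fin n → ℝ} {U : Set (Coord n)} (h : Recurrent γ α U) {z : Coord n}
    (hz : z ∈ U) (hN : covecSq γ α z ≠ 0) (j : Fin n) :
    pd j (grycakScalar γ α) z
      = (n * ((n : ℝ) - 2) ^ 2) / (((n : ℝ) - 1) ^ 2 * ((n : ℝ) - 4))
        * ∑ m, (α z j * α z m / covecSq γ α z - γ z j m / n) * gradUp γ (scalar γ) m z := by
  have e1 : fderiv ℝ (scalar γ) z (sharpF γ α z) = ∑ m, α z m * gradUp γ (scalar γ) m z := by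
    simp only [sharpF, sharp, map_sum, map_smul, covecF, lin_bv, smul_eq_mul, gradUp,
      Finset.mul_sum, pd]
    rw [Finset.sum_comm]
    refine Finset.sum_congr rfl fun m _ => Finset.sum_congr rfl fun k _ => ?_
    rw [h.inv_symm hz k m]
    ring
  have e2 : pd j (scalar γ) z = ∑ m, γ z j m * gradUp γ (scalar γ) m z := by
    simp only [gradUp, Finset.mul_sum]
    rw [Finset.sum_comm]
    have : ∀ k, ∑ m, γ z j m * ((γ z)⁻¹ m k * pd k (scalar γ) z)
        = (if j = k then 1 else 0) * pd k (scalar γ) z := by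
      intro k
      have h1 := congrFun (congrFun (h.mul_inv_cancel hz) j) k
      rw [Matrix.mul_apply, Matrix.one_apply] at h1
      rw [← h1, Finset.sum_mul]
      exact Finset.sum_congr rfl fun _ _ => by ring
    simp [this]
  have key := h.fderiv_grycakScalar hz (by rwa [covecF_sharpF_eq]) (bv j)
  rw [pd, key, covecF_sharpF_eq, e1]
  have e3 : fderiv ℝ (scalar γ) z (bv j) = pd j (scalar γ) z := rfl
  rw [e3, e2]
  congr 1
  simp only [covecF, lin_bv, sub_mul, Finset.sum_sub_distrib, Finset.mul_sum, Finset.sum_div]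
  congr 1 <;> exact Finset.sum_congr rfl fun m _ => by ring

end Charts

end CRn

end

theorem mainTheorem9 (n : ℕ) (hn : 5 ≤ n)
    (M : Type*) [TopologicalSpace M] [ChartedSpace (CRn.Coord n) M] [IsManifold (𝓡 n) ∞ M]
    (g : CRn.PseudoRiemannianMetric n M)
    (α : (x : M) → TangentSpace (𝓡 n) x →L[ℝ] ℝ)
    (hCR : CRn.IsConformallyRecurrent g α)
    (hC : ∀ φ ∈ IsManifold.maximalAtlas (𝓡 n) ∞ M, ∀ y ∈ φ.target,
      CRn.weylSq (CRn.bilinComp g.form φ) y ≠ 0) :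
    ∃ G : M → ℝ,
      ∀ φ ∈ IsManifold.maximalAtlas (𝓡 n) ∞ M, ∀ y ∈ φ.target,
        CRn.covecSq (CRn.bilinComp g.form φ) (CRn.covecComp α φ) y ≠ 0 →
          (∀ c : ℝ, CRn.GrycakRelation (CRn.bilinComp g.form φ) c y ↔ c = G (φ.symm y)) ∧
          ContDiffAt ℝ ∞ (G ∘ φ.symm) y ∧
          ∀ j : Fin n,
            CRn.pd j (G ∘ φ.symm) y =
              (n * ((n : ℝ) - 2) ^ 2) / (((n : ℝ) - 1) ^ 2 * ((n : ℝ) - 4)) *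
                ∑ m : Fin n,
                  (CRn.covecComp α φ y j * CRn.covecComp α φ y m
                      / CRn.covecSq (CRn.bilinComp g.form φ) (CRn.covecComp α φ) y
                    - CRn.bilinComp g.form φ y j m / n)
                  * CRn.gradUp (CRn.bilinComp g.form φ)
                      (CRn.scalar (CRn.bilinComp g.form φ)) m y := by
  -- G is computed at each point in the preferred chart of that point. By `hG` it agrees with the
  -- formula of any chart φ on its whole target, so it can be differentiated there. Where α² = 0 its
  -- value comes from a division by zero and carries no claim.
  refine ⟨fun x => CRn.grycakScalar (CRn.bilinComp g.form (chartAt (CRn.Coord n) x))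
    (CRn.covecComp α (chartAt (CRn.Coord n) x)) (chartAt (CRn.Coord n) x x),
    fun φ hφ y hy hN => ?_⟩
  have hR : CRn.Recurrent (CRn.bilinComp g.form φ) (CRn.covecComp α φ) φ.target :=
    { g.smoothMetric hφ with
      five_le := hn
      covWeyl_eq := hCR.2 φ hφ
      weylSq_ne_zero := hC φ hφ }
  have hG : ∀ z ∈ φ.target, CRn.grycakScalar (CRn.bilinComp g.form φ) (CRn.covecComp α φ) z
      = CRn.grycakScalar (CRn.bilinComp g.form (chartAt (CRn.Coord n) (φ.symm z)))
        (CRn.covecComp α (chartAt (CRn.Coord n) (φ.symm z)))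
        (chartAt (CRn.Coord n) (φ.symm z) (φ.symm z)) := fun z hz =>
    CRn.grycakScalar_chart g α hφ (IsManifold.chart_mem_maximalAtlas _) hz (mem_chart_source _ _)
  have hN' : CRn.covecF (CRn.covecComp α φ) y
      (CRn.sharpF (CRn.bilinComp g.form φ) (CRn.covecComp α φ) y) ≠ 0 := by
    rwa [CRn.covecF_sharpF_eq]
  have ev : (fun x => CRn.grycakScalar (CRn.bilinComp g.form (chartAt (CRn.Coord n) x))
      (CRn.covecComp α (chartAt (CRn.Coord n) x)) (chartAt (CRn.Coord n) x x)) ∘ φ.symm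
      =ᶠ[nhds y] CRn.grycakScalar (CRn.bilinComp g.form φ) (CRn.covecComp α φ) := by
    filter_upwards [φ.open_target.mem_nhds hy] with z hz using (hG z hz).symm
  refine ⟨fun c => ?_, (hR.contDiffAt_grycakScalar hy hN').congr_of_eventuallyEq ev, fun j => ?_⟩
  · rw [hR.grycakRelation_iff hy hN', hG y hy]
  · rw [← hR.pd_grycakScalar hy hN j, CRn.pd, ev.fderiv_eq, CRn.pd]
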